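/- Variables are natural numbers; a literal is a variable $v$ or its complement $\overline v$; a clause is a finite set of literals not containing a complementary pair; a clause-set is a finite set of clauses; $\bot$ is the empty clause and $\top$ the empty clause-set. For a clause-set $F$ let $\mathrm{var}(F)$ be the set of variables occurring in $F$, $n(F)=|\mathrm{var}(F)|$ and $\ell(F)=\sum_{C\in F}|C|$. For a partial assignment $\varphi$ (a map from a finite set of variables to $\{0,1\}$), $\varphi*F$ results from $F$ by removing all clauses containing a literal made true by $\varphi$, and removing the literals made false by $\varphi$ from the remaining clauses; $F$ is satisfiable if $\varphi*F=\top$ for some $\varphi$. A literal $x$ is forced for $F$ if $\langle x\to 0\rangle*F$ is unsatisfiable. For $k\ge 0$ the reduction $r_k$ is given by: $r_0(F)=\{\bot\}$ if $\bot\in F$, and $r_0(F)=F$ otherwise; $r_{k+1}(F)=r_{k+1}(\langle x\to1\rangle*F)$ if there is a literal $x$ over $\mathrm{var}(F)$ with $r_k(\langle x\to0\rangle*F)=\{\bot\}$ (the choice of $x$ does not matter), and $r_{k+1}(F)=F$ otherwise; so $r_1$ is unit-clause propagation. For a set $V$ of variables, the relative hardness $\mathrm{hd}^V(F)$ is the least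 $k$ such that $r_k(\varphi*F)=\{\bot\}$ for all partial assignments $\varphi$ on subsets of $V$ with $\varphi*F$ unsatisfiable. The relative p-hardness $\mathrm{phd}^V(F)$ is the least $k$ such that for all partial assignments $\varphi$ on subsets of $V$: if $\varphi*F$ is unsatisfiable then $r_k(\varphi*F)=\{\bot\}$, and otherwise no literal over $V$ is forced for $r_k(\varphi*F)$. Let $f:\{0,1\}^{\mathrm{var}(f)}\to\{0,1\}$ be a boolean function on a finite set $\mathrm{var}(f)$ of variables, and $n(f)=|\mathrm{var}(f)|$. A representation of $f$ is a clause-set $F$ with $\mathrm{var}(f)\subseteq\mathrm{var}(F)$ such that for every total assignment $\varphi$ on $\mathrm{var}(f)$, $\varphi*F$ is satisfiable iff $f(\varphi)=1$. It is a UR-representation if $\mathrm{hd}^{\mathrm{var}(f)}(F)\le1$. It is a forcing representation if $\mathrm{phd}^{\mathrm{var}(f)}(F)\le1$ (that is, it is a GAC-representation) and it has sat-recognition via unit-clause propagation: $r_1(\varphi*F)=\top$ for every total assignment $\varphi$ on $\mathrm{var}(f)$ with $\varphi*F$ satisfiable. Theorem. There is an algorithm (a program for a unit-cost random access machine with addition,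 subtraction and indirect addressing) which, given $\mathrm{var}(f)$ and a UR-representation $F$ of a boolean function $f$ (listed without repetitions, in any order), outputs a forcing representation of $f$ (again listed without repetitions). If all clauses of $F$ have length at most $p$, then its running time is $$O\bigl(n(f)\cdot p\cdot n(F)\cdot\ell(F)\bigr),$$ where the constant is absolute (independent of $p$, $f$ and $F$), and factors equal to $0$ are read as $1$. -/

import Mathlib

namespace ForcingRep

/-! ### Clause-sets -/

/-- Variables are natural numbers. A literal is a variable (`pos = true`) or a complemented
variable (`pos = false`). -/
structure Lit where
  var : ℕ
  pos : Bool
deriving DecidableEq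

/-- Complementation of literals. -/
def Lit.compl (x : Lit) : Lit := ⟨x.var, !x.pos⟩

/-- Finite sets of finite sets of literals; see `CLS` for complement-freeness of clauses. -/
abbrev ClauseSet := Finset (Finset Lit)

/-- The clause-sets: every clause is complement-free. -/
def CLS : Set ClauseSet := {F | ∀ C ∈ F, ∀ x ∈ C, x.compl ∉ C}

/-- The clause-sets all of whose clauses have length at most `p`. -/
def PCLS (p : ℕ) : Set ClauseSet := {F | F ∈ CLS ∧ ∀ C ∈ F, C.card ≤ p}

/-- The set of variables occurring in a clause-set. -/
def vars (F : ClauseSet) : Finset ℕ := F.biUnion fun C => C.image Lit.var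

/-- The literals over the variables of a clause-set. -/
def lits (F : ClauseSet) : Set Lit := {x | x.var ∈ vars F}

/-- The number of variables. -/
def numVars (F : ClauseSet) : ℕ := (vars F).card

/-- The number of literal occurrences. -/
def numOcc (F : ClauseSet) : ℕ := ∑ C ∈ F, C.card

/-! ### Partial assignments -/

/-- A partial assignment is a map from a finite set of variables to truth values. For a finite set
`V` of variables and `φ : V → Bool`, the total assignment `φ` on `V` is `⟨V, φ⟩`. -/
structure PAss where
  dom : Finset ℕ
  val : dom → Bool

/-- `φ.Sets x ε`: the partial assignment `φ` gives the literal `x` the value `ε`. -/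
def PAss.Sets (φ : PAss) (x : Lit) (ε : Bool) : Prop :=
  ∃ h : x.var ∈ φ.dom, φ.val ⟨x.var, h⟩ = (if x.pos then ε else !ε)

instance (φ : PAss) (x : Lit) (ε : Bool) : Decidable (φ.Sets x ε) := by
  unfold PAss.Sets; infer_instance

/-- The partial assignment `⟨x → ε⟩`. -/
def PAss.single (x : Lit) (ε : Bool) : PAss :=
  ⟨{x.var}, fun _ => if x.pos then ε else !ε⟩

/-- `φ * F`: remove the clauses containing a literal set to true, and remove the literals set to
false from the remaining clauses. -/
def PAss.apply (φ : PAss) (F : ClauseSet) : ClauseSet :=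
  (F.filter fun C => ∀ x ∈ C, ¬ φ.Sets x true).image fun C => C.filter fun x => ¬ φ.Sets x false

/-- Satisfiability. -/
def Sat (F : ClauseSet) : Prop := ∃ φ : PAss, φ.apply F = ∅

/-- The forced literals of a clause-set. -/
def forcedLits (F : ClauseSet) : Set Lit := {x | ¬ Sat ((PAss.single x false).apply F)}

/-! ### (Generalised) unit-clause propagation -/

theorem numVars_single_lt {F : ClauseSet} {x : Lit} (hx : x ∈ lits F) (ε : Bool) :
    numVars ((PAss.single x ε).apply F) < numVars F := by
  refine Finset.card_lt_card (Finset.ssubset_iff_of_subset ?_ |>.2 ⟨x.var, hx, ?_⟩)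
  · intro v hv
    simp only [vars, PAss.apply, Finset.mem_biUnion, Finset.mem_image, Finset.mem_filter] at hv ⊢
    obtain ⟨_, ⟨D, hD, rfl⟩, y, hy, rfl⟩ := hv
    exact ⟨D, hD.1, y, (Finset.mem_filter.1 hy).1, rfl⟩
  · intro hv
    simp only [vars, PAss.apply, Finset.mem_biUnion, Finset.mem_image, Finset.mem_filter] at hv
    obtain ⟨_, ⟨D, hD, rfl⟩, y, hy, hyx⟩ := hv
    obtain ⟨hyD, hy⟩ := Finset.mem_filter.1 hy
    have h1 := hD.2 y hyD
    have hm : y.var ∈ (PAss.single x ε).dom := by simp [PAss.single, hyx]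
    simp only [PAss.Sets, not_exists] at h1 hy
    have h1 := h1 hm
    have h2 := hy hm
    revert h1 h2
    cases y.pos <;> simp

open Classical in
/-- Repeatedly set a literal `x` over the variables of `F` to true as long as the predicate
`Refuted` holds after setting `x` to false. -/
noncomputable def propagate (Refuted : ClauseSet → Prop) (F : ClauseSet) : ClauseSet :=
  if h : ∃ x ∈ lits F, Refuted ((PAss.single x false).apply F) then
    propagate Refuted ((PAss.single h.choose true).apply F)
  else F
termination_by numVars F
decreasing_by exact numVars_single_lt h.choose_spec.1 true

/-- Generalised unit-clause propagation `r_k`; `r_1` is ordinary unit-clause propagation.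
The clause-set consisting only of the empty clause is `{∅}`. -/
noncomputable def r : ℕ → ClauseSet → ClauseSet
  | 0, F => if ∅ ∈ F then {∅} else F
  | k + 1, F => propagate (fun G => r k G = {∅}) F

/-! ### Hardness measures -/

/-- Hardness relative to `V`. -/
noncomputable def hardness (V : Set ℕ) (F : ClauseSet) : ℕ∞ :=
  ⨅ (k : ℕ) (_ : ∀ φ : PAss, (φ.dom : Set ℕ) ⊆ V → ¬ Sat (φ.apply F) →
    r k (φ.apply F) = {∅}), (k : ℕ∞)

/-- Propagation-hardness relative to `V`. -/
noncomputable def phardness (V : Set ℕ) (F : ClauseSet) : ℕ∞ :=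
  ⨅ (k : ℕ) (_ : ∀ φ : PAss, (φ.dom : Set ℕ) ⊆ V →
    (¬ Sat (φ.apply F) → r k (φ.apply F) = {∅}) ∧
    (Sat (φ.apply F) → ∀ x ∈ forcedLits (r k (φ.apply F)), x.var ∉ V)), (k : ℕ∞)

/-! ### Boolean functions and their representations -/

/-- A boolean function on a finite set of variables. -/
structure BoolFun where
  vars : Finset ℕ
  val : (vars → Bool) → Bool

/-- The number of variables of a boolean function. -/
def BoolFun.numVars (f : BoolFun) : ℕ := f.vars.card

/-- `F` is a CNF-representation of `f`. -/
def IsRep (F : ClauseSet) (f : BoolFun) : Prop :=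
  F ∈ CLS ∧ f.vars ⊆ vars F ∧
    ∀ φ : f.vars → Bool, Sat (PAss.apply ⟨f.vars, φ⟩ F) ↔ f.val φ = true

/-- `F` is a UR-representation of `f`. -/
def IsURRep (F : ClauseSet) (f : BoolFun) : Prop :=
  IsRep F f ∧ hardness f.vars F ≤ 1

/-- `F` has sat-recognition via `red` w.r.t. `V`. -/
def SatRecognition (red : ClauseSet → ClauseSet) (V : Finset ℕ) (F : ClauseSet) : Prop :=
  ∀ φ : V → Bool, Sat (PAss.apply ⟨V, φ⟩ F) → red (PAss.apply ⟨V, φ⟩ F) = ∅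

/-- `F` is forcing w.r.t. `V`. -/
def IsForcing (V : Finset ℕ) (F : ClauseSet) : Prop :=
  phardness V F ≤ 1 ∧ SatRecognition (r 1) V F

/-- `F` is a forcing representation of `f`. -/
def IsForcingRep (F : ClauseSet) (f : BoolFun) : Prop :=
  IsRep F f ∧ IsForcing f.vars F

/-! ### Random access machines with unit cost -/

/-- The state of a random access machine: registers, memory, the unread part of the input, and
the output written so far. -/
structure RAMState where
  reg : ℕ → ℕ
  mem : ℕ → ℕ
  inp : List ℕ
  out : List ℕ

/-- Elementary instructions (register numbers are fixed in the program). -/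
inductive Instr where
  /-- `reg a := n` -/
  | const (a n : ℕ)
  /-- `reg a := reg b` -/
  | copy (a b : ℕ)
  /-- `reg a := reg b + reg c` -/
  | add (a b c : ℕ)
  /-- `reg a := reg b - reg c` (truncated subtraction) -/
  | sub (a b c : ℕ)
  /-- `reg a := mem (reg b)` -/
  | load (a b : ℕ)
  /-- `mem (reg a) := reg b` -/
  | store (a b : ℕ)
  /-- `reg a :=` the next input number (`0` if the input is exhausted) -/
  | read (a : ℕ)
  /-- append `reg a` to the output -/
  | write (a : ℕ)

/-- The effect of an elementary instruction. -/
def Instr.exec : Instr → RAMState → RAMState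
  | .const a n, s => { s with reg := Function.update s.reg a n }
  | .copy a b, s => { s with reg := Function.update s.reg a (s.reg b) }
  | .add a b c, s => { s with reg := Function.update s.reg a (s.reg b + s.reg c) }
  | .sub a b c, s => { s with reg := Function.update s.reg a (s.reg b - s.reg c) }
  | .load a b, s => { s with reg := Function.update s.reg a (s.mem (s.reg b)) }
  | .store a b, s => { s with mem := Function.update s.mem (s.reg a) (s.reg b) }
  | .read a, s => { s with reg := Function.update s.reg a (s.inp.headD 0), inp := s.inp.tail }
  | .write a, s => { s with out := s.out ++ [s.reg a] }

/-- Programs: elementary instructions with structured control flow. -/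
inductive Prog where
  | skip
  | instr (i : Instr)
  | seq (P Q : Prog)
  /-- if `reg a ≠ 0` then `P` else `Q` -/
  | cond (a : ℕ) (P Q : Prog)
  /-- while `reg a ≠ 0` do `P` -/
  | loop (a : ℕ) (P : Prog)

/-- `Exec P s t s'`: program `P`, started in state `s`, halts in state `s'` after `t` steps, where
each elementary instruction and each test of a register counts as one step. -/
inductive Exec : Prog → RAMState → ℕ → RAMState → Prop
  | skip (s : RAMState) : Exec .skip s 0 s
  | instr (i : Instr) (s : RAMState) : Exec (.instr i) s 1 (i.exec s)
  | seq {P Q : Prog} {s s' s'' : RAMState} {t t' : ℕ} :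
      Exec P s t s' → Exec Q s' t' s'' → Exec (.seq P Q) s (t + t') s''
  | cond_true {a : ℕ} {P Q : Prog} {s s' : RAMState} {t : ℕ} :
      s.reg a ≠ 0 → Exec P s t s' → Exec (.cond a P Q) s (t + 1) s'
  | cond_false {a : ℕ} {P Q : Prog} {s s' : RAMState} {t : ℕ} :
      s.reg a = 0 → Exec Q s t s' → Exec (.cond a P Q) s (t + 1) s'
  | loop_exit {a : ℕ} {P : Prog} {s : RAMState} :
      s.reg a = 0 → Exec (.loop a P) s 1 s
  | loop_step {a : ℕ} {P : Prog} {s s' s'' : RAMState} {t t' : ℕ} :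
      s.reg a ≠ 0 → Exec P s t s' → Exec (.loop a P) s' t' s'' →
      Exec (.loop a P) s (t + t' + 1) s''

/-- On the given input, `P` halts after exactly `t` steps with the given output. Registers and
memory are initially zero. -/
def Prog.Computes (P : Prog) (input : List ℕ) (t : ℕ) (output : List ℕ) : Prop :=
  ∃ s : RAMState, Exec P ⟨fun _ => 0, fun _ => 0, input, []⟩ t s ∧ s.out = output

/-! ### Input and output format -/

/-- `vs` lists the elements of `V` without repetition. -/
def ListsVars (vs : List ℕ) (V : Finset ℕ) : Prop := vs.Nodup ∧ vs.toFinset = V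

/-- `L` lists the clauses of `F` without repetition, each clause being given as a list of its
literals without repetition. -/
def ListsClauses (L : List (List Lit)) (F : ClauseSet) : Prop :=
  (∀ c ∈ L, c.Nodup) ∧ (L.map List.toFinset).Nodup ∧ (L.map List.toFinset).toFinset = F

/-- A list as a sequence of numbers: each entry is preceded by `1`, and the end is marked
by `0`. -/
def encodeList {α : Type} (enc : α → List ℕ) : List α → List ℕ
  | [] => [0]
  | a :: l => 1 :: (enc a ++ encodeList enc l)

def encodeVars (vs : List ℕ) : List ℕ := encodeList (fun v => [v]) vs

def encodeLit (x : Lit) : List ℕ := [if x.pos then 1 else 0, x.var]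

def encodeClauses (L : List (List Lit)) : List ℕ := encodeList (encodeList encodeLit) L

end ForcingRep

/-!
The output `G` consists of the defining clauses of circuits that simulate unit-clause propagation
on the given UR-representation `F`. There is one circuit for each literal `x` over `var(f)`. In
it, a variable `cur y` stands for "the literal `y` has been derived from the assumption that `x`
is false"; it starts out as equivalent to `y` for `y` over `var(f)`, as constantly true for the
complement of `x`, and as constantly false otherwise. A step with a literal `y` of a clause `C`
introduces a new variable equivalent to `cur y ∨ ⋀_{z ∈ C, z ≠ y} cur z.compl`, which then
replaces `cur y`; a round makes this step for all literal occurrences. After the rounds, a clause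
falsified by the derived literals implies `x`. One further circuit has a new, constantly false
variable in the place of `x`, so that it excludes every assignment refuted by propagation.

If a partial assignment `φ` to `var(f)` forces `x`, then `F` is unsatisfiable under `φ` with `x`
made false, so propagation refutes it, since `F` is a UR-representation; unit-clause propagation
in `G` follows the simulation and derives `x`. The number `2 n(F) + 1` of rounds is sufficient,
since in one of the rounds no new literal over `var(F)` is derived, and the literals derived
before that round form a set closed under propagation (`Gen.mem_of_copy`). Conversely, in a model
of `F` with `x` false the circuit for `x` only derives true literals, so every model of `F` extends
to one of `G` (`Inv.model`), and `G` represents `f`. As all gates are fully defined, a total assignment determines all variables by unit-clause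
propagation (`Inv.det`), which gives sat-recognition (`isForcing_of_closed`,
`isForcingRep_final`).

To reason about `r 1`, whose definition chooses literals arbitrarily, two facts are used: a
propagation that does not refute ends in a consistent set of literals closed under propagation
(`r_one_applySet`), and propagation does not refute if there is a set of literals closed under it
that falsifies no clause (`r_one_ne_of_closed`).

A round takes `O(p · ℓ(F))` steps, since a step with a literal of `C` takes `O(|C|)`; hence the
`2 n(f) + 1` circuits with `2 n(F) + 1` rounds each take `O(n(f) · p · n(F) · ℓ(F))` steps in all. The program writes each clause as soon as it is
generated. The clauses introduced together with a variable contain it as their largest variable,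
so no clause is repeated. The program is verified against the functional description `Gen.final`.
-/

namespace ForcingRep


/-! ### Semantics of clause-sets under total assignments -/

/-- The literal `x` is true under the total assignment `w`. -/
def Lit.Holds (w : ℕ → Bool) (x : Lit) : Prop := w x.var = x.pos

instance (w : ℕ → Bool) (x : Lit) : Decidable (x.Holds w) := by
  unfold Lit.Holds; infer_instance

/-- The total assignment `w` satisfies every clause of `F`. -/
def Models (w : ℕ → Bool) (F : ClauseSet) : Prop := ∀ C ∈ F, ∃ x ∈ C, x.Holds w

@[simp] theorem Lit.compl_compl (x : Lit) : x.compl.compl = x := by cases x; simp [Lit.compl]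

@[simp] theorem Lit.compl_var (x : Lit) : x.compl.var = x.var := rfl

theorem Lit.compl_ne (x : Lit) : x.compl ≠ x := by cases x; simp [Lit.compl]

theorem Lit.holds_compl {w : ℕ → Bool} {x : Lit} : x.compl.Holds w ↔ ¬ x.Holds w := by
  cases x with | mk v b => cases b <;> simp [Lit.compl, Lit.Holds]

theorem Lit.eq_or_eq_compl {x y : Lit} (h : x.var = y.var) : x = y ∨ x = y.compl := by
  obtain ⟨v, b⟩ := x
  obtain ⟨v', b'⟩ := y
  cases b <;> cases b' <;> simp_all [Lit.compl]

theorem mem_lits {F : ClauseSet} {x : Lit} : x ∈ lits F ↔ ∃ C ∈ F, ∃ y ∈ C, y.var = x.var := by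
  simp [lits, vars]

theorem PAss.sets_false {φ : PAss} {x : Lit} : φ.Sets x false ↔ φ.Sets x.compl true := by
  cases x with | mk v b => cases b <;> simp [Lit.compl, PAss.Sets]

theorem PAss.sets_or {φ : PAss} {x : Lit} (h : x.var ∈ φ.dom) :
    φ.Sets x true ∨ φ.Sets x.compl true := by
  cases x with | mk v b => cases b <;> simp_all [Lit.compl, PAss.Sets]

theorem PAss.sets_consistent {φ : PAss} {x : Lit} (h : φ.Sets x true) : ¬ φ.Sets x.compl true := by
  obtain ⟨h1, h2⟩ := h
  rintro ⟨h3, h4⟩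
  cases x with | mk v b => cases b <;> simp_all [Lit.compl]

theorem PAss.single_sets {x y : Lit} {b : Bool} :
    (PAss.single x b).Sets y true ↔ y = if b then x else x.compl := by
  obtain ⟨v, c⟩ := x
  obtain ⟨u, d⟩ := y
  cases b <;> cases c <;> cases d <;> simp [PAss.single, PAss.Sets, Lit.compl]

/-- The literals made true by a partial assignment. -/
def PAss.trueLits (φ : PAss) : Set Lit := {y | φ.Sets y true}

open Classical in
/-- The application of the (partial) assignment making the literals of `A` true. -/
noncomputable def applySet (A : Set Lit) (F : ClauseSet) : ClauseSet :=
  (F.filter fun C => ∀ x ∈ C, x ∉ A).image fun C => C.filter fun x => x.compl ∉ A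

theorem mem_applySet {A : Set Lit} {F : ClauseSet} {D : Finset Lit} :
    D ∈ applySet A F ↔ ∃ C ∈ F, (∀ x ∈ C, x ∉ A) ∧ ∀ x, x ∈ D ↔ x ∈ C ∧ x.compl ∉ A := by
  classical
  simp only [applySet, Finset.mem_image, Finset.mem_filter]
  constructor
  · rintro ⟨C, ⟨h1, h2⟩, rfl⟩
    exact ⟨C, h1, h2, fun x => by simp⟩
  · rintro ⟨C, h1, h2, h3⟩
    exact ⟨C, ⟨h1, h2⟩, by ext x; simp [h3]⟩

theorem PAss.apply_eq (φ : PAss) (F : ClauseSet) : φ.apply F = applySet φ.trueLits F := by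
  ext D
  rw [mem_applySet, PAss.apply, Finset.mem_image]
  constructor
  · rintro ⟨C, hC, rfl⟩
    have hC := Finset.mem_filter.1 hC
    exact ⟨C, hC.1, hC.2, fun x => by rw [Finset.mem_filter, PAss.sets_false]; rfl⟩
  · rintro ⟨C, hC, h1, h2⟩
    exact ⟨C, Finset.mem_filter.2 ⟨hC, h1⟩, by
      ext x; rw [Finset.mem_filter, PAss.sets_false, h2]; rfl⟩

/-- A set of literals without a complementary pair. -/
def Consistent (A : Set Lit) : Prop := ∀ x ∈ A, x.compl ∉ A

theorem not_mem_of_mem_lits_applySet {A : Set Lit} {F : ClauseSet} {x : Lit}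
    (h : x ∈ lits (applySet A F)) : x ∉ A ∧ x.compl ∉ A := by
  obtain ⟨D, hD, y, hy, hyx⟩ := mem_lits.1 h
  obtain ⟨C, _, h2, h3⟩ := mem_applySet.1 hD
  have h4 := (h3 y).1 hy
  have h5 := h2 y h4.1
  rcases Lit.eq_or_eq_compl hyx with rfl | rfl
  · exact ⟨h5, h4.2⟩
  · exact ⟨by simpa using h4.2, h5⟩

theorem applySet_singleton {A : Set Lit} {F : ClauseSet} {x : Lit} (h : x.compl ∉ A) :
    applySet {x} (applySet A F) = applySet (insert x A) F := by
  ext D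
  simp only [mem_applySet]
  constructor
  · rintro ⟨E, ⟨C, hC, h1, h2⟩, h3, h4⟩
    refine ⟨C, hC, fun y hy hyA => ?_, fun y => ?_⟩
    · rcases hyA with rfl | hyA
      · exact h3 y ((h2 y).2 ⟨hy, h⟩) rfl
      · exact h1 y hy hyA
    · rw [h4, h2]
      simp only [Set.mem_singleton_iff, Set.mem_insert_iff]
      tauto
  · rintro ⟨C, hC, h1, h2⟩
    classical
    refine ⟨C.filter fun x => x.compl ∉ A, ⟨C, hC, fun y hy hyA => h1 y hy (Or.inr hyA), by simp⟩,
      fun y hy hyx => ?_, fun y => ?_⟩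
    · exact h1 y (Finset.mem_filter.1 hy).1 (Or.inl hyx)
    · rw [h2]
      simp only [Set.mem_singleton_iff, Set.mem_insert_iff, Finset.mem_filter]
      tauto

theorem trueLits_single (x : Lit) : (PAss.single x true).trueLits = {x} := by
  ext y; simp [PAss.trueLits, PAss.single_sets]

theorem trueLits_single_false (x : Lit) : (PAss.single x false).trueLits = {x.compl} := by
  ext y; simp [PAss.trueLits, PAss.single_sets]

theorem applySet_of_not_mem_lits {F : ClauseSet} {x : Lit} (h : x ∉ lits F) :
    applySet {x} F = F := by
  have h' : ∀ C ∈ F, ∀ y ∈ C, y.var ≠ x.var := fun C hC y hy hyx =>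
    h (mem_lits.2 ⟨C, hC, y, hy, hyx⟩)
  have h1 : ∀ C ∈ F, ∀ y ∈ C, y ≠ x ∧ y.compl ≠ x := fun C hC y hy =>
    ⟨fun e => h' C hC y hy (e ▸ rfl), fun e => h' C hC y hy (e ▸ rfl)⟩
  ext D
  rw [mem_applySet]
  constructor
  · rintro ⟨C, hC, h2, h3⟩
    have : D = C := by
      ext y; rw [h3]
      exact ⟨fun h => h.1, fun h => ⟨h, (h1 C hC y h).2⟩⟩
    exact this ▸ hC
  · intro hD
    exact ⟨D, hD, fun y hy => (h1 D hD y hy).1, fun y => ⟨fun h => ⟨h, (h1 D hD y h).2⟩,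
      fun h => h.1⟩⟩

/-- A total assignment that makes `A` true satisfies `F` iff it satisfies `A * F`. -/
theorem models_applySet {A : Set Lit} {F : ClauseSet} {w : ℕ → Bool}
    (hw : ∀ x ∈ A, x.Holds w) : Models w (applySet A F) ↔ Models w F := by
  constructor
  · intro h C hC
    by_cases h1 : ∀ x ∈ C, x ∉ A
    · classical
      obtain ⟨x, hx, hxw⟩ := h (C.filter fun x => x.compl ∉ A)
        (mem_applySet.2 ⟨C, hC, h1, by simp⟩)
      exact ⟨x, (Finset.mem_filter.1 hx).1, hxw⟩
    · push Not at h1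
      obtain ⟨x, hx, hxA⟩ := h1
      exact ⟨x, hx, hw x hxA⟩
  · intro h D hD
    obtain ⟨C, hC, _, h2⟩ := mem_applySet.1 hD
    obtain ⟨x, hx, hxw⟩ := h C hC
    exact ⟨x, (h2 x).2 ⟨hx, fun hc => Lit.holds_compl.1 (hw _ hc) hxw⟩, hxw⟩

theorem sat_iff_models {F : ClauseSet} : Sat F ↔ ∃ w, Models w F := by
  constructor
  · rintro ⟨φ, hφ⟩
    refine ⟨fun v => if h : v ∈ φ.dom then φ.val ⟨v, h⟩ else false, fun C hC => ?_⟩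
    by_contra hcon
    push Not at hcon
    have : C.filter (fun x => ¬ φ.Sets x false) ∈ φ.apply F := by
      refine Finset.mem_image.2 ⟨C, Finset.mem_filter.2 ⟨hC, fun x hx hs => hcon x hx ?_⟩, rfl⟩
      obtain ⟨h1, h2⟩ := hs
      cases x with | mk v b => cases b <;> simp_all [Lit.Holds]
    simp [hφ] at this
  · rintro ⟨w, hw⟩
    refine ⟨⟨vars F, fun v => w v⟩, Finset.eq_empty_of_forall_notMem fun D hD => ?_⟩
    rw [PAss.apply_eq, mem_applySet] at hD
    obtain ⟨C, hC, h1, _⟩ := hD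
    obtain ⟨x, hx, hxw⟩ := hw C hC
    refine h1 x hx ⟨Finset.mem_biUnion.2 ⟨C, hC, Finset.mem_image_of_mem _ hx⟩, ?_⟩
    cases x with | mk v b => cases b <;> simp_all [Lit.Holds]

/-- `φ * F` is satisfiable iff some model of `F` extends `φ`. -/
theorem sat_apply_iff {φ : PAss} {F : ClauseSet} :
    Sat (φ.apply F) ↔ ∃ w, (∀ x ∈ φ.trueLits, x.Holds w) ∧ Models w F := by
  rw [sat_iff_models, PAss.apply_eq]
  constructor
  · rintro ⟨w, hw⟩
    let w' : ℕ → Bool := fun v => if h : v ∈ φ.dom then φ.val ⟨v, h⟩ else w v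
    have h' : ∀ x ∈ φ.trueLits, x.Holds w' := by
      rintro ⟨v, b⟩ ⟨h1, h2⟩
      cases b <;> simp_all [Lit.Holds, w']
    refine ⟨w', h', (models_applySet h').1 fun D hD => ?_⟩
    obtain ⟨x, hx, hxw⟩ := hw D hD
    refine ⟨x, hx, ?_⟩
    obtain ⟨C, hC, h1, h2⟩ := mem_applySet.1 hD
    have h3 := (h2 x).1 hx
    have : x.var ∉ φ.dom := fun hd => (PAss.sets_or hd).elim (h1 x h3.1) h3.2
    simpa [Lit.Holds, w', this] using hxw
  · rintro ⟨w, hw, h⟩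
    exact ⟨w, (models_applySet hw).2 h⟩

/-! ### Unit-clause propagation -/

/-- Properties preserved by single propagation steps hold for the result, to which no further step
applies. -/
theorem propagate_induction {R : ClauseSet → Prop} {P : ClauseSet → Prop}
    (step : ∀ F, ∀ x ∈ lits F, P F → R ((PAss.single x false).apply F) →
      P ((PAss.single x true).apply F)) (F : ClauseSet) (h : P F) :
    P (propagate R F) ∧
      ¬ ∃ x ∈ lits (propagate R F), R ((PAss.single x false).apply (propagate R F)) := by
  induction hn : numVars F using Nat.strong_induction_on generalizing F with
  | _ n ih =>
    rw [propagate]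
    split_ifs with hx
    · exact ih _ (hn ▸ numVars_single_lt hx.choose_spec.1 true) _
        (step F _ hx.choose_spec.1 h hx.choose_spec.2) rfl
    · exact ⟨h, hx⟩

theorem r_zero_eq {F : ClauseSet} : r 0 F = {∅} ↔ ∅ ∈ F := by
  rw [r]
  split_ifs with h
  · simp [h]
  · simp only [h, iff_false]
    rintro rfl
    simp at h

theorem empty_mem_single_false {F : ClauseSet} {x : Lit} :
    ∅ ∈ (PAss.single x false).apply F ↔ ∅ ∈ F ∨ {x} ∈ F := by
  rw [PAss.apply_eq, mem_applySet, trueLits_single_false]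
  constructor
  · rintro ⟨C, hC, _, h2⟩
    have h3 : ∀ y ∈ C, y = x := fun y hy => by
      by_contra hne
      have := (h2 y).2 ⟨hy, fun h => hne (by simpa using congrArg Lit.compl h)⟩
      simp at this
    rcases Finset.eq_empty_or_nonempty C with rfl | ⟨y, hy⟩
    · exact Or.inl hC
    · right
      have : C = {x} := by
        ext z; simp only [Finset.mem_singleton]
        exact ⟨h3 z, fun h => h ▸ (h3 y hy) ▸ hy⟩
      exact this ▸ hC
  · rintro (h | h)
    · exact ⟨∅, h, by simp, by simp⟩
    · exact ⟨{x}, h, by simpa using (Lit.compl_ne x).symm, by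
        intro y; simp only [Finset.notMem_empty, Finset.mem_singleton, Set.mem_singleton_iff,
          false_iff, not_and, not_not]
        rintro rfl; rfl⟩

/-- `S` is closed under unit-clause propagation in `F`: the last literal of a clause whose other
literals are falsified by `S` belongs to `S`. -/
def UnitClosed (S : Set Lit) (F : ClauseSet) : Prop :=
  ∀ C ∈ F, ∀ y ∈ C, (∀ z ∈ C, z ≠ y → z.compl ∈ S) → y ∈ S

/-- No clause of `F` is falsified by `S`. -/
def Unfalsified (S : Set Lit) (F : ClauseSet) : Prop := ∀ C ∈ F, ∃ z ∈ C, z.compl ∉ S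

theorem UnitClosed.applySet {S A : Set Lit} {F : ClauseSet} (h : UnitClosed S F) (hA : A ⊆ S) :
    UnitClosed S (applySet A F) := by
  intro D hD y hy hz
  obtain ⟨C, hC, _, h2⟩ := mem_applySet.1 hD
  refine h C hC y ((h2 y).1 hy).1 fun z hzC hzy => ?_
  by_cases hzA : z.compl ∈ A
  · exact hA hzA
  · exact hz z ((h2 z).2 ⟨hzC, hzA⟩) hzy

theorem Unfalsified.applySet {S A : Set Lit} {F : ClauseSet} (h : Unfalsified S F) (hA : A ⊆ S) :
    Unfalsified S (applySet A F) := by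
  intro D hD
  obtain ⟨C, hC, _, h2⟩ := mem_applySet.1 hD
  obtain ⟨z, hz, hzS⟩ := h C hC
  exact ⟨z, (h2 z).2 ⟨hz, fun h => hzS (hA h)⟩, hzS⟩

/-- Soundness: a set of literals that is closed under unit-clause propagation and falsifies no
clause witnesses that unit-clause propagation does not refute `F`. -/
theorem r_one_ne_of_closed {S : Set Lit} {F : ClauseSet} (h1 : UnitClosed S F)
    (h2 : Unfalsified S F) : r 1 F ≠ {∅} := by
  have := (propagate_induction (R := fun G => r 0 G = {∅})
    (P := fun G => UnitClosed S G ∧ Unfalsified S G) ?_ F ⟨h1, h2⟩).1.2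
  · intro h
    rw [r] at h
    rw [h] at this
    obtain ⟨z, hz, _⟩ := this ∅ (by simp)
    simp at hz
  · rintro G x _ ⟨h3, h4⟩ h5
    rw [r_zero_eq, empty_mem_single_false] at h5
    rw [PAss.apply_eq, trueLits_single]
    have hx : ({x} : Set Lit) ⊆ S := by
      rw [Set.singleton_subset_iff]
      rcases h5 with h5 | h5
      · obtain ⟨z, hz, _⟩ := h4 ∅ h5
        simp at hz
      · exact h3 {x} h5 x (by simp) (by simp)
    exact ⟨h3.applySet hx, h4.applySet hx⟩

/-- The outcome of unit-clause propagation on `A₀ * G`: either a refutation, or `A * G` for a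
consistent `A ⊇ A₀` that is closed under unit-clause propagation in `G` and consists of literals
true in all models of `G` that extend `A₀`. -/
theorem r_one_applySet (G : ClauseSet) {A₀ : Set Lit} (h0 : Consistent A₀) :
    r 1 (applySet A₀ G) = {∅} ∨
      ∃ A, A₀ ⊆ A ∧ Consistent A ∧ UnitClosed A G ∧ r 1 (applySet A₀ G) = applySet A G ∧
        ∅ ∉ applySet A G ∧
        ∀ w, Models w G → (∀ x ∈ A₀, x.Holds w) → ∀ x ∈ A, x.Holds w := by
  have hH : r 1 (applySet A₀ G) = propagate (fun G => r 0 G = {∅}) (applySet A₀ G) := by rw [r]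
  have key := propagate_induction (R := fun G => r 0 G = {∅})
    (P := fun H => ∃ A, A₀ ⊆ A ∧ Consistent A ∧ H = applySet A G ∧
      (∅ ∈ H ∨ ∀ w, Models w G → (∀ x ∈ A₀, x.Holds w) → ∀ x ∈ A, x.Holds w)) ?_
      (applySet A₀ G) ⟨A₀, le_rfl, h0, rfl, Or.inr fun w _ h => h⟩
  · rw [← hH] at key
    obtain ⟨⟨A, hA, hc, hHA, hm⟩, hno⟩ := key
    generalize r 1 (applySet A₀ G) = H at *
    simp only [r_zero_eq, empty_mem_single_false, not_exists, not_and, not_or] at hno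
    by_cases hE : ∅ ∈ H
    · left
      ext D
      simp only [Finset.mem_singleton]
      refine ⟨fun hD => Finset.eq_empty_of_forall_notMem fun x hx => ?_, fun h => h ▸ hE⟩
      exact (hno x (mem_lits.2 ⟨D, hD, x, hx, rfl⟩)).1 hE
    · right
      refine ⟨A, hA, hc, ?_, hHA, hHA ▸ hE, hm.resolve_left hE⟩
      intro C hC y hy hz
      by_contra hyA
      classical
      have hmem : C.filter (fun x => x.compl ∉ A) ∈ H := by
        rw [hHA]
        refine mem_applySet.2 ⟨C, hC, fun z hzC hzA => ?_, by simp⟩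
        by_cases hzy : z = y
        · exact hyA (hzy ▸ hzA)
        · exact hc z hzA (hz z hzC hzy)
      by_cases hyc : y.compl ∈ A
      · apply hE
        convert hmem
        symm
        refine Finset.filter_eq_empty_iff.2 fun z hzC => not_not.2 ?_
        by_cases hzy : z = y
        · exact hzy ▸ hyc
        · exact hz z hzC hzy
      · have : C.filter (fun x => x.compl ∉ A) = {y} := by
          ext z
          simp only [Finset.mem_filter, Finset.mem_singleton]
          constructor
          · rintro ⟨h1, h2⟩
            by_contra hzy
            exact h2 (hz z h1 hzy)
          · rintro rfl
            exact ⟨hy, hyc⟩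
        rw [this] at hmem
        exact (hno y (mem_lits.2 ⟨_, hmem, y, by simp, rfl⟩)).2 hmem
  · rintro H x hx ⟨A, hA, hc, rfl, hm⟩ h5
    rw [r_zero_eq, empty_mem_single_false] at h5
    have hxA := not_mem_of_mem_lits_applySet hx
    rw [PAss.apply_eq, trueLits_single]
    refine ⟨insert x A, hA.trans (Set.subset_insert _ _), ?_, applySet_singleton hxA.2, ?_⟩
    · rintro y (rfl | hy) (h | h)
      · exact Lit.compl_ne _ h
      · exact hxA.2 h
      · exact hxA.2 (h ▸ (by simpa using hy))
      · exact hc y hy h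
    · by_cases hE : ∅ ∈ applySet A G
      · left
        exact mem_applySet.2 ⟨∅, hE, by simp, by simp⟩
      · right
        intro w hw hw0
        have h6 := hm.resolve_left hE w hw hw0
        rintro y (rfl | hy)
        · obtain ⟨z, hz, hzw⟩ := (models_applySet h6).2 hw _ (h5.resolve_left hE)
          exact Finset.mem_singleton.1 hz ▸ hzw
        · exact h6 y hy

theorem r_one_of_empty_mem {F : ClauseSet} (h : ∅ ∈ F) : r 1 F = {∅} := by
  have key := propagate_induction (R := fun G => r 0 G = {∅}) (P := fun H => ∅ ∈ H)
    (fun H x _ h _ => by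
      rw [PAss.apply_eq]; exact mem_applySet.2 ⟨∅, h, by simp, by simp⟩) F h
  rw [r]
  obtain ⟨hE, hno⟩ := key
  ext D
  simp only [Finset.mem_singleton]
  refine ⟨fun hD => Finset.eq_empty_of_forall_notMem fun x hx => ?_, fun h => h ▸ hE⟩
  exact hno ⟨x, mem_lits.2 ⟨D, hD, x, hx, rfl⟩, r_zero_eq.2 (empty_mem_single_false.2 (Or.inl hE))⟩

/-- The cases of hardness `0` and `1` are combined, as `r 0` refutes only if `r 1` does. -/
theorem r_one_of_hardness_le_one {V : Set ℕ} {F : ClauseSet} (h : hardness V F ≤ 1) {φ : PAss}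
    (hφ : (φ.dom : Set ℕ) ⊆ V) (hs : ¬ Sat (φ.apply F)) : r 1 (φ.apply F) = {∅} := by
  by_contra hne
  have : (2 : ℕ∞) ≤ hardness V F := by
    refine le_iInf₂ fun k hk => ?_
    have h1 := hk φ hφ hs
    match k, h1 with
    | 0, h1 => exact absurd (r_one_of_empty_mem (r_zero_eq.1 h1)) hne
    | 1, h1 => exact absurd h1 hne
    | k + 2, _ => push_cast; exact le_add_self
  exact absurd (this.trans h) (by decide)

theorem PAss.consistent_trueLits (φ : PAss) : Consistent φ.trueLits :=
  fun _ h => PAss.sets_consistent h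

/-- A criterion for being forcing, in terms of the sets of literals that are closed under
unit-clause propagation. -/
theorem isForcing_of_closed {V : Finset ℕ} {G : ClauseSet}
    (hsat : ∀ (A : Set Lit) (φ : PAss), Consistent A → UnitClosed A G → φ.dom ⊆ V →
      φ.trueLits ⊆ A → Sat (φ.apply G))
    (hforced : ∀ (A : Set Lit) (φ : PAss) (x : Lit), Consistent A → UnitClosed A G → φ.dom ⊆ V →
      φ.trueLits ⊆ A → x.var ∈ V →
      (∀ w, Models w G → (∀ y ∈ φ.trueLits, y.Holds w) → x.Holds w) → x ∈ A ∨ x.compl ∈ A)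
    (htotal : ∀ A : Set Lit, Consistent A → UnitClosed A G →
      (∀ x : Lit, x.var ∈ V → x ∈ A ∨ x.compl ∈ A) → ∀ x ∈ lits G, x ∈ A ∨ x.compl ∈ A) :
    IsForcing V G := by
  have hne : ∀ φ : PAss, Sat (φ.apply G) → r 1 (φ.apply G) ≠ {∅} := by
    intro φ hs
    obtain ⟨w, hw, hm⟩ := sat_apply_iff.1 hs
    rw [PAss.apply_eq]
    refine r_one_ne_of_closed (S := {x | x.Holds w}) ?_ ?_
    · intro D hD y hy hz
      obtain ⟨z, hzD, hzw⟩ := (models_applySet hw).2 hm D hD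
      by_cases hzy : z = y
      · exact hzy ▸ hzw
      · exact absurd hzw (Lit.holds_compl.1 (hz z hzD hzy))
    · intro D hD
      obtain ⟨z, hzD, hzw⟩ := (models_applySet hw).2 hm D hD
      exact ⟨z, hzD, fun h => Lit.holds_compl.1 h hzw⟩
  refine ⟨iInf₂_le_of_le 1 (fun φ hφ => ⟨fun hs => ?_, fun hs x hx hxV => ?_⟩) (by simp),
    fun φ hs => ?_⟩
  · have := r_one_applySet G φ.consistent_trueLits
    rw [← PAss.apply_eq] at this
    rcases this with h | ⟨A, hA, hc, hcl, -⟩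
    · exact h
    · exact absurd (hsat A φ hc hcl (by exact_mod_cast hφ) hA) hs
  · have := r_one_applySet G φ.consistent_trueLits
    rw [← PAss.apply_eq] at this
    obtain ⟨A, hA, hc, hcl, hH, _, hmod⟩ := this.resolve_left (hne φ hs)
    rw [hH] at hx
    obtain ⟨w, hw, hm⟩ := sat_apply_iff.1 hs
    have hsatA : ∀ w, Models w G → (∀ y ∈ φ.trueLits, y.Holds w) → Models w (applySet A G) :=
      fun w hm hw => (models_applySet (hmod w hm hw)).2 hm
    by_cases hxA : x ∈ A ∨ x.compl ∈ A
    · refine hx ?_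
      rw [PAss.apply_eq, trueLits_single_false, applySet_of_not_mem_lits]
      · exact sat_iff_models.2 ⟨w, hsatA w hm hw⟩
      · intro h
        have := not_mem_of_mem_lits_applySet h
        rw [Lit.compl_compl] at this
        exact hxA.elim this.2 this.1
    · refine hxA (hforced A φ x hc hcl (by exact_mod_cast hφ) hA (by exact_mod_cast hxV) ?_)
      intro w hm hw
      by_contra hxw
      refine hx (sat_apply_iff.2 ⟨w, ?_, hsatA w hm hw⟩)
      rw [trueLits_single_false]
      rintro y rfl
      exact Lit.holds_compl.2 hxw
  · have := r_one_applySet G (PAss.consistent_trueLits ⟨V, φ⟩)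
    rw [← PAss.apply_eq] at this
    obtain ⟨A, hA, hc, hcl, hH, hE, -⟩ := this.resolve_left (hne _ hs)
    have ht := htotal A hc hcl fun x hx =>
      (PAss.sets_or (φ := ⟨V, φ⟩) (x := x) hx).imp (fun h => hA h) (fun h => hA h)
    rw [hH]
    refine Finset.eq_empty_of_forall_notMem fun D hD => ?_
    rcases Finset.eq_empty_or_nonempty D with rfl | ⟨x, hx⟩
    · exact hE hD
    · have h1 := not_mem_of_mem_lits_applySet (mem_lits.2 ⟨D, hD, x, hx, rfl⟩)
      obtain ⟨C, hC, _, h2⟩ := mem_applySet.1 hD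
      exact (ht x (mem_lits.2 ⟨C, hC, x, ((h2 x).1 hx).1, rfl⟩)).elim h1.1 h1.2


/-! ### The generator of the forcing representation -/

/-- The state of the generator of the output: `next` is the next unused variable, the variable
`cur y` stands for "the literal `y` has been derived", and `out` lists the clauses so far. -/
structure Gen where
  next : ℕ
  cur : Lit → ℕ
  out : List (List Lit)

namespace Gen

/-- Introduce the variable `g.next` together with the clauses `B`. -/
def emit (g : Gen) (B : List (List Lit)) : Gen := ⟨g.next + 1, g.cur, g.out ++ B⟩

/-- From now on, the most recent variable stands for `y`. -/
def assign (g : Gen) (y : Lit) : Gen := ⟨g.next, Function.update g.cur y (g.next - 1), g.out⟩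

/-- A new variable with constant value `b`. -/
def const (b : Bool) (g : Gen) : Gen := g.emit [[⟨g.next, b⟩]]

/-- A new variable equivalent to the literal `y`. -/
def equiv (g : Gen) (y : Lit) : Gen :=
  g.emit [[⟨g.next, true⟩, y.compl], [⟨g.next, false⟩, y]]

/-- A new variable equivalent to the conjunction (`s = true`) or the disjunction (`s = false`) of
the most recent variable and the variable `b`. -/
def gate (s : Bool) (g : Gen) (b : ℕ) : Gen :=
  g.emit [[⟨g.next, !s⟩, ⟨g.next - 1, s⟩], [⟨g.next, !s⟩, ⟨b, s⟩],
    [⟨g.next, s⟩, ⟨g.next - 1, !s⟩, ⟨b, !s⟩]]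

/-- The most recent variable implies `x`. The new variable, which is constantly true, only serves
to make the clauses distinct from all others. -/
def assert (x : Lit) (g : Gen) : Gen :=
  g.emit [[⟨g.next, true⟩], [⟨g.next, false⟩, ⟨g.next - 1, false⟩, x]]

/-- One conjunction gate of `chain`. -/
def chainStep (y : Option Lit) (g : Gen) (z : Lit) : Gen :=
  if some z = y then g else g.gate true (g.cur z.compl)

/-- A new variable for "the complements of all literals of `c`, except possibly `y`, have been
derived". -/
def chain (y : Option Lit) (c : List Lit) (g : Gen) : Gen :=
  c.foldl (chainStep y) (g.const true)

/-- Unit-clause propagation with the clause `c` and its literal `y`. -/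
def occStep (c : List Lit) (g : Gen) (y : Lit) : Gen :=
  ((g.chain (some y) c).gate false (g.cur y)).assign y

/-- Unit-clause propagation with the clause `c` and each of its literals. -/
def clauseStep (g : Gen) (c : List Lit) : Gen := c.foldl (occStep c) g

/-- One round of unit-clause propagation. -/
def round (L : List (List Lit)) (g : Gen) : Gen := L.foldl clauseStep g

/-- If the clause `c` is falsified by the derived literals, then `x`. -/
def assertStep (x : Lit) (g : Gen) (c : List Lit) : Gen := (g.chain none c).assert x

/-- The literals over the variable of `y` have not been derived. -/
def initOcc (g : Gen) (y : Lit) : Gen :=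
  (((g.const false).assign y).const false).assign y.compl

/-- No literal over the variables of the clause has been derived. -/
def initClause (g : Gen) (c : List Lit) : Gen := c.foldl initOcc g

/-- The literals over `v` are derived if they are true. -/
def initVar (g : Gen) (v : ℕ) : Gen :=
  (((g.equiv ⟨v, true⟩).assign ⟨v, true⟩).equiv ⟨v, false⟩).assign ⟨v, false⟩

/-- The state before the first round of unit-clause propagation with the assumption that `x` is
false. -/
def init (L : List (List Lit)) (vs : List ℕ) (g : Gen) (x : Lit) : Gen :=
  ((vs.foldl initVar (L.foldl initClause g)).const true).assign x.compl

/-- The circuit that derives `x` if unit-clause propagation refutes the assumption that `x` is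
false. -/
def copy (L : List (List Lit)) (vs : List ℕ) (R : ℕ) (g : Gen) (x : Lit) : Gen :=
  L.foldl (assertStep x) ((round L)^[R] (init L vs g x))

/-- The copies for both literals over `v`. -/
def varStep (L : List (List Lit)) (vs : List ℕ) (R : ℕ) (g : Gen) (v : ℕ) : Gen :=
  copy L vs R (copy L vs R g ⟨v, true⟩) ⟨v, false⟩

/-- The first state: the variable `M` is constantly false. -/
def start (M : ℕ) : Gen := const false ⟨M, fun _ => 0, []⟩

/-- The final state; `M` bounds the variables of `L`, and `R` is the number of rounds. -/
def final (L : List (List Lit)) (vs : List ℕ) (R M : ℕ) : Gen :=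
  vs.foldl (varStep L vs R) (copy L vs R (start M) ⟨M, true⟩)

end Gen

theorem foldl_induction {α β : Type*} {P : β → Prop} {f : β → α → β} (l : List α)
    (h : ∀ b, ∀ a ∈ l, P b → P (f b a)) (b : β) (hb : P b) : P (l.foldl f b) := by
  induction l generalizing b with
  | nil => exact hb
  | cons a l ih =>
    exact ih (fun b a' ha' => h b a' (List.mem_cons_of_mem _ ha')) _ (h b a (by simp) hb)

/-! ### Well-formedness and models of the generated clauses -/

/-- The list version of `Models`. -/
def ModelsList (w : ℕ → Bool) (L : List (List Lit)) : Prop := ∀ c ∈ L, ∃ x ∈ c, x.Holds w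

/-- The list version of `UnitClosed`. -/
def UnitClosedList (A : Set Lit) (L : List (List Lit)) : Prop :=
  ∀ c ∈ L, ∀ y ∈ c, (∀ z ∈ c, z ≠ y → z.compl ∈ A) → y ∈ A

/-- Closure passes to fewer clauses, so a set closed for the final output is closed for the output at
every earlier time. -/
theorem UnitClosedList.mono {A : Set Lit} {E E' : List (List Lit)} (h : UnitClosedList A E')
    (hE : E ⊆ E') : UnitClosedList A E := fun c hc => h c (hE hc)

/-- The invariant of the generator in the copy for the literal `x`. The literals in `D` are those
whose variable `cur` is meaningful. By `model`, every model `w` of `L` can be extended to a model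
of the output in which, if `x` is false, only true literals are derived, and the most recent
variable implies `T`; the condition `w M = false` is due to the constantly false variable `M`. -/
structure Inv (L : List (List Lit)) (V : Finset ℕ) (M : ℕ) (x : Lit) (D : Set Lit)
    (T : (ℕ → Bool) → Prop) (g : Gen) : Prop where
  next : M < g.next
  lt : ∀ c ∈ g.out, ∀ z ∈ c, z.var < g.next
  var : ∀ c ∈ g.out, ∀ z ∈ c, z.var ∈ V ∨ M ≤ z.var
  nodup_var : ∀ c ∈ g.out, (c.map Lit.var).Nodup
  nodup : (g.out.map List.toFinset).Nodup
  det : ∀ A, Consistent A → UnitClosedList A g.out →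
    (∀ z : Lit, z.var ∈ V → z ∈ A ∨ z.compl ∈ A) →
    ∀ z : Lit, M ≤ z.var → z.var < g.next → z ∈ A ∨ z.compl ∈ A
  cur_lt : ∀ y, g.cur y < g.next
  le_cur : ∀ y ∈ D, M ≤ g.cur y
  model : ∀ w, ModelsList w L → w M = false → ∃ m, (∀ v ≤ M, m v = w v) ∧ ModelsList m g.out ∧
    (¬ x.Holds w → ∀ y ∈ D, m (g.cur y) = true → y.Holds w) ∧
    (¬ x.Holds w → m (g.next - 1) = true → T w)

namespace Inv

variable {L : List (List Lit)} {V : Finset ℕ} {M : ℕ} {x : Lit} {D : Set Lit}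
  {T : (ℕ → Bool) → Prop} {g : Gen}

theorem weaken (h : Inv L V M x D T g) {D' : Set Lit} {T' : (ℕ → Bool) → Prop} (hD : D' ⊆ D)
    (hT : ∀ w, T w → T' w) : Inv L V M x D' T' g :=
  { h with
    le_cur := fun y hy => h.le_cur y (hD hy)
    model := fun w hw hM => by
      obtain ⟨m, h1, h2, h3, h4⟩ := h.model w hw hM
      exact ⟨m, h1, h2, fun hx y hy => h3 hx y (hD hy), fun hx hm => hT w (h4 hx hm)⟩ }

theorem reset (h : Inv L V M x D T g) (x' : Lit) : Inv L V M x' ∅ (fun _ => True) g :=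
  { h with
    le_cur := fun y hy => absurd hy (Set.notMem_empty y)
    model := fun w hw hM => by
      obtain ⟨m, h1, h2, h3, h4⟩ := h.model w hw hM
      exact ⟨m, h1, h2, fun _ y hy => absurd hy (Set.notMem_empty y), fun _ _ => trivial⟩ }

theorem assign (h : Inv L V M x D T g) {y : Lit}
    (hT : ∀ w, ModelsList w L → ¬ x.Holds w → T w → y.Holds w) :
    Inv L V M x (insert y D) (fun _ => True) (g.assign y) :=
  { next := h.next
    lt := h.lt
    var := h.var
    nodup_var := h.nodup_var
    nodup := h.nodup
    det := h.det
    cur_lt := fun z => by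
      have := h.next
      by_cases hz : z = y
      · subst hz; simp [Gen.assign]; omega
      · simpa [Gen.assign, hz] using h.cur_lt z
    le_cur := fun z hz => by
      have := h.next
      by_cases hzy : z = y
      · subst hzy; simp [Gen.assign]; omega
      · simpa [Gen.assign, hzy] using h.le_cur z (hz.resolve_left hzy)
    model := fun w hw hM => by
      obtain ⟨m, h1, h2, h3, h4⟩ := h.model w hw hM
      refine ⟨m, h1, h2, fun hx z hz hm => ?_, fun _ _ => trivial⟩
      by_cases hzy : z = y
      · subst hzy
        exact hT w hw hx (h4 hx (by simpa [Gen.assign] using hm))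
      · exact h3 hx z (hz.resolve_left hzy) (by simpa [Gen.assign, hzy] using hm) }

/-- A block of clauses may be emitted if the new variable is the largest one of each of its
clauses, and is determined by the other variables. -/
theorem emit (h : Inv L V M x D T g) {B : List (List Lit)}
    {T' : (ℕ → Bool) → Prop}
    (htop : ∀ c ∈ B, ∃ z ∈ c, z.var = g.next)
    (hle : ∀ c ∈ B, ∀ z ∈ c, z.var ≤ g.next ∧ (z.var ∈ V ∨ M ≤ z.var))
    (hnv : ∀ c ∈ B, (c.map Lit.var).Nodup) (hn : (B.map List.toFinset).Nodup)
    (hdet : ∀ A, Consistent A → UnitClosedList A B →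
      (∀ z : Lit, z.var < g.next → (z.var ∈ V ∨ M ≤ z.var) → z ∈ A ∨ z.compl ∈ A) →
      (⟨g.next, true⟩ : Lit) ∈ A ∨ (⟨g.next, false⟩ : Lit) ∈ A)
    (hmod : ∀ (w m : ℕ → Bool), ModelsList w L → (∀ v ≤ M, m v = w v) →
      (¬ x.Holds w → ∀ y ∈ D, m (g.cur y) = true → y.Holds w) →
      (¬ x.Holds w → m (g.next - 1) = true → T w) →
      ∃ b, ModelsList (Function.update m g.next b) B ∧ (¬ x.Holds w → b = true → T' w)) :
    Inv L V M x D T' (g.emit B) := by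
  have hnext := h.next
  refine
  { next := by simp [Gen.emit]; omega
    lt := fun c hc z hz => ?_
    var := fun c hc z hz => ?_
    nodup_var := fun c hc => ?_
    nodup := ?_
    det := fun A hA hcl hdV z hMz hz => ?_
    cur_lt := fun y => (h.cur_lt y).trans (Nat.lt_succ_self _)
    le_cur := h.le_cur
    model := fun w hw hM => ?_ }
  · rcases List.mem_append.1 hc with hc | hc
    · exact (h.lt c hc z hz).trans (Nat.lt_succ_self _)
    · exact Nat.lt_succ_of_le (hle c hc z hz).1
  · rcases List.mem_append.1 hc with hc | hc
    · exact h.var c hc z hz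
    · exact (hle c hc z hz).2
  · rcases List.mem_append.1 hc with hc | hc
    · exact h.nodup_var c hc
    · exact hnv c hc
  · simp only [Gen.emit, List.map_append]
    refine h.nodup.append hn fun C hC hC' => ?_
    obtain ⟨c, hc, rfl⟩ := List.mem_map.1 hC
    obtain ⟨c', hc', he⟩ := List.mem_map.1 hC'
    obtain ⟨z, hz, hzn⟩ := htop c' hc'
    have : z ∈ c := List.mem_toFinset.1 (he ▸ List.mem_toFinset.2 hz)
    exact absurd (h.lt c hc z this) (by omega)
  · have hcl1 : UnitClosedList A g.out := hcl.mono (List.subset_append_left _ _)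
    have hcl2 : UnitClosedList A B := hcl.mono (List.subset_append_right _ _)
    have hold := h.det A hA hcl1 hdV
    rcases (Nat.lt_succ_iff.1 hz).lt_or_eq with hz | hz
    · exact hold z hMz hz
    · have := hdet A hA hcl2 fun u hu hu' => hu'.elim (hdV u) fun hM => hold u hM hu
      obtain ⟨v, b⟩ := z
      subst hz
      cases b
      · exact this.symm
      · exact this
  · obtain ⟨m, h1, h2, h3, h4⟩ := h.model w hw hM
    obtain ⟨b, h5, h6⟩ := hmod w m hw h1 h3 h4
    refine ⟨Function.update m g.next b, fun v hv => ?_, fun c hc => ?_, fun hx y hy hm => ?_,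
      fun hx hm => h6 hx (by simpa [Gen.emit] using hm)⟩
    · rw [Function.update_of_ne (by omega), h1 v hv]
    · rcases List.mem_append.1 hc with hc | hc
      · obtain ⟨z, hz, hzm⟩ := h2 c hc
        refine ⟨z, hz, ?_⟩
        rw [Lit.Holds, Function.update_of_ne (h.lt c hc z hz).ne]
        exact hzm
      · exact h5 c hc
    · refine h3 hx y hy ?_
      rwa [Gen.emit, Function.update_of_ne (h.cur_lt y).ne] at hm

theorem const (h : Inv L V M x D T g) (b : Bool) :
    Inv L V M x D (fun _ => b = true) (g.const b) := by
  have := h.next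
  refine h.emit (by simp) (by simp; omega) (by simp) (by simp) (fun A _ hcl _ => ?_)
    fun w m _ _ _ _ => ⟨b, by simp [ModelsList, Lit.Holds], fun _ h => h⟩
  have := hcl [⟨g.next, b⟩] (by simp) ⟨g.next, b⟩ (by simp) (by simp)
  cases b
  · exact Or.inr this
  · exact Or.inl this

theorem equiv (h : Inv L V M x D T g) (hV : ∀ v ∈ V, v < M) {y : Lit} (hy : y.var ∈ V) :
    Inv L V M x D (fun w => y.Holds w) (g.equiv y) := by
  have hn := h.next
  have hyM := hV _ hy
  have hne : g.next ≠ y.var := by omega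
  refine h.emit (by simp) (by simp [hy]; omega) (by simp [hne]) ?_ (fun A _ hcl hd => ?_)
    fun w m _ hm _ _ => ⟨decide (y.Holds w), ?_, fun _ h => by simpa using h⟩
  · simp only [List.map_cons, List.map_nil, List.nodup_cons, List.mem_singleton,
      List.not_mem_nil, not_false_eq_true, List.nodup_nil, and_true]
    intro he
    have : (⟨g.next, true⟩ : Lit) ∈ [⟨g.next, false⟩, y].toFinset := by rw [← he]; simp
    simp only [List.mem_toFinset, List.mem_cons, Lit.mk.injEq, Bool.true_eq_false, and_false,
      List.not_mem_nil, or_false, false_or] at this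
    exact hne (by rw [← this])
  · rcases hd y (by omega) (Or.inl hy) with hyA | hyA
    · left
      refine hcl [⟨g.next, true⟩, y.compl] (by simp) _ (List.mem_cons_self) fun z hz hzn => ?_
      simp only [List.mem_cons, List.not_mem_nil, or_false] at hz
      rw [hz.resolve_left hzn]
      simpa using hyA
    · right
      refine hcl [⟨g.next, false⟩, y] (by simp) _ (List.mem_cons_self) fun z hz hzn => ?_
      simp only [List.mem_cons, List.not_mem_nil, or_false] at hz
      rw [hz.resolve_left hzn]
      exact hyA
  · have hu : ∀ b, (Function.update m g.next b) y.var = w y.var := fun b => by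
      rw [Function.update_of_ne (by omega), hm _ hyM.le]
    by_cases hyw : y.Holds w
    · intro c hc
      simp only [List.mem_cons, List.not_mem_nil, or_false] at hc
      rcases hc with rfl | rfl
      · exact ⟨⟨g.next, true⟩, by simp, (Function.update_self ..).trans (decide_eq_true hyw)⟩
      · exact ⟨y, by simp, by rw [Lit.Holds, hu]; exact hyw⟩
    · intro c hc
      simp only [List.mem_cons, List.not_mem_nil, or_false] at hc
      rcases hc with rfl | rfl
      · refine ⟨y.compl, by simp, Lit.holds_compl.2 ?_⟩
        rw [Lit.Holds, hu]; exact hyw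
      · exact ⟨⟨g.next, false⟩, by simp, (Function.update_self ..).trans (decide_eq_false hyw)⟩

theorem gate (h : Inv L V M x D T g) (s : Bool) {y : Lit} (hy : y ∈ D)
    (hlt : g.cur y + 1 < g.next) :
    Inv L V M x D (fun w => if s then T w ∧ y.Holds w else T w ∨ y.Holds w)
      (g.gate s (g.cur y)) := by
  have hn := h.next
  have hM := h.le_cur y hy
  have hne1 : g.next ≠ g.next - 1 := by omega
  have hne2 : g.next ≠ g.cur y := by omega
  have hne3 : g.next - 1 ≠ g.cur y := by omega
  refine h.emit (by simp) (by simp; omega) (by simp [hne1, hne2, hne3]) ?_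
    (fun A _ hcl hd => ?_)
    fun w m _ _ hD hT => ⟨if s then m (g.next - 1) && m (g.cur y) else
      m (g.next - 1) || m (g.cur y), ?_, ?_⟩
  · have e1 : (⟨g.next - 1, s⟩ : Lit) ∉ [(⟨g.next, !s⟩ : Lit), ⟨g.cur y, s⟩].toFinset := by
      simp [hne3, hne1.symm]
    have e2 : (⟨g.next, s⟩ : Lit) ∉ [(⟨g.next, !s⟩ : Lit), ⟨g.next - 1, s⟩].toFinset := by
      simp [hne1]
    have e3 : (⟨g.next, s⟩ : Lit) ∉ [(⟨g.next, !s⟩ : Lit), ⟨g.cur y, s⟩].toFinset := by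
      simp [hne2]
    simp only [List.map_cons, List.map_nil, List.nodup_cons, List.mem_cons,
      List.not_mem_nil, not_false_eq_true, List.nodup_nil, and_true, or_false, not_or]
    refine ⟨⟨fun he => e1 (he ▸ by simp), fun he => e2 (he ▸ by simp)⟩,
      fun he => e3 (he ▸ by simp)⟩
  · have ha := hd ⟨g.next - 1, s⟩ (by simp; omega) (Or.inr (by simp; omega))
    have hb := hd ⟨g.cur y, s⟩ (by simp; omega) (Or.inr hM)
    have key : (⟨g.next, s⟩ : Lit) ∈ A ∨ (⟨g.next, !s⟩ : Lit) ∈ A := by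
      -- The first two clauses determine the gate if one of the inputs does.
      have imp : ∀ v, v = g.next - 1 ∨ v = g.cur y → (⟨v, s⟩ : Lit).compl ∈ A →
          (⟨g.next, !s⟩ : Lit) ∈ A := by
        intro v hv hA
        refine hcl [⟨g.next, !s⟩, ⟨v, s⟩] (by rcases hv with rfl | rfl <;> simp) _
          (List.mem_cons_self) fun z hz hzn => ?_
        simp only [List.mem_cons, List.not_mem_nil, or_false] at hz
        rw [hz.resolve_left hzn]
        exact hA
      rcases ha with ha | ha
      · rcases hb with hb | hb
        · left
          refine hcl [⟨g.next, s⟩, ⟨g.next - 1, !s⟩, ⟨g.cur y, !s⟩] (by simp) _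
            (List.mem_cons_self) fun z hz hzn => ?_
          simp only [List.mem_cons, List.not_mem_nil, or_false] at hz
          rcases hz.resolve_left hzn with rfl | rfl
          · simpa [Lit.compl] using ha
          · simpa [Lit.compl] using hb
        · exact Or.inr (imp _ (Or.inr rfl) hb)
      · exact Or.inr (imp _ (Or.inl rfl) ha)
    cases s
    · exact key.symm
    · exact key
  · generalize hb : (if s then m (g.next - 1) && m (g.cur y) else
      m (g.next - 1) || m (g.cur y)) = b
    have u1 : Function.update m g.next b (g.next - 1) = m (g.next - 1) :=
      Function.update_of_ne hne1.symm _ _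
    have u2 : Function.update m g.next b (g.cur y) = m (g.cur y) :=
      Function.update_of_ne hne2.symm _ _
    simp only [ModelsList, Lit.Holds, List.mem_cons, List.not_mem_nil, or_false,
      forall_eq_or_imp, forall_eq, exists_eq_or_imp, exists_eq_left, Function.update_self,
      u1, u2]
    subst hb
    cases s <;> cases m (g.next - 1) <;> cases m (g.cur y) <;> simp
  · intro hx
    have h1 := hD hx y hy
    have h2 := hT hx
    cases s <;> cases hm1 : m (g.next - 1) <;> cases hm2 : m (g.cur y) <;> simp_all

theorem assert (h : Inv L V M x D T g) (hx : x.var ∈ V ∨ M ≤ x.var)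
    (hlt : x.var + 1 < g.next)
    (hT : ∀ w, ModelsList w L → ¬ x.Holds w → ¬ T w) (hxM : x.var ≤ M) :
    Inv L V M x D (fun _ => True) (g.assert x) := by
  have hn := h.next
  have hne1 : g.next ≠ g.next - 1 := by omega
  have hne2 : g.next ≠ x.var := by omega
  have hne3 : g.next - 1 ≠ x.var := by omega
  refine h.emit (by simp) (by simp [hx]; omega) (by simp [hne1, hne2, hne3]) ?_
    (fun A _ hcl hd => ?_)
    fun w m hw hm hD hT' => ⟨true, ?_, fun _ _ => trivial⟩
  · simp only [List.map_cons, List.map_nil, List.nodup_cons, List.mem_cons,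
      List.not_mem_nil, not_false_eq_true, List.nodup_nil, and_true, or_false]
    intro he
    have : (⟨g.next - 1, false⟩ : Lit) ∈ [(⟨g.next, true⟩ : Lit)].toFinset := by rw [he]; simp
    simp at this
  · exact Or.inl (hcl [⟨g.next, true⟩] (by simp) ⟨g.next, true⟩ (by simp) (by simp))
  · simp only [ModelsList, Lit.Holds, List.mem_cons, List.not_mem_nil, or_false,
      forall_eq_or_imp, forall_eq, exists_eq_or_imp, exists_eq_left, Function.update_self,
      Function.update_of_ne hne1.symm, Function.update_of_ne hne2.symm, hm _ hxM, true_and]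
    by_cases hxw : x.Holds w
    · exact Or.inr (Or.inr hxw)
    · refine Or.inr (Or.inl ?_)
      by_contra hcon
      exact hT w hw hxw (hT' hxw (by simpa using hcon))

end Inv


/-- The literals over the variables of a list of clauses. -/
def litsOf (L : List (List Lit)) : Set Lit :=
  {y | ∃ c ∈ L, ∃ z ∈ c, z.var = y.var}

theorem Gen.chain_cur {g : Gen} (y : Option Lit) (c : List Lit) : (g.chain y c).cur = g.cur :=
  foldl_induction (P := fun g' => Gen.cur g' = g.cur) c
    (fun b z _ hb => by rw [Gen.chainStep]; split_ifs <;> exact hb) _ rfl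

namespace Inv

variable {L : List (List Lit)} {V : Finset ℕ} {M : ℕ} {x : Lit} {D : Set Lit}
  {T : (ℕ → Bool) → Prop} {g : Gen}

theorem chain (h : Inv L V M x D T g) (y : Option Lit) {c : List Lit} (hc : ∀ z ∈ c, z.compl ∈ D) :
    Inv L V M x D (fun w => ∀ z ∈ c, some z ≠ y → z.compl.Holds w) (g.chain y c) ∧
      (∀ z, (g.chain y c).cur z + 1 < (g.chain y c).next) ∧ g.next < (g.chain y c).next := by
  have gen : ∀ (c : List Lit) (T : (ℕ → Bool) → Prop) (g : Gen), (∀ z ∈ c, z.compl ∈ D) →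
      Inv L V M x D T g → (∀ z, g.cur z + 1 < g.next) →
      Inv L V M x D (fun w => T w ∧ ∀ z ∈ c, some z ≠ y → z.compl.Holds w)
        (c.foldl (Gen.chainStep y) g) ∧
      (∀ z, (c.foldl (Gen.chainStep y) g).cur z + 1 < (c.foldl (Gen.chainStep y) g).next) ∧
      g.next ≤ (c.foldl (Gen.chainStep y) g).next := by
    intro c
    induction c with
    | nil => exact fun T g _ h hs => ⟨h.weaken le_rfl (by simp), hs, le_rfl⟩
    | cons a c ih =>
      intro T g hc h hs
      rw [List.foldl_cons, Gen.chainStep]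
      split_ifs with ha
      · obtain ⟨h1, h2, h3⟩ := ih T g (fun z hz => hc z (List.mem_cons_of_mem _ hz)) h hs
        refine ⟨h1.weaken le_rfl fun w hw => ⟨hw.1, ?_⟩, h2, h3⟩
        simpa [ha] using hw.2
      · have := h.gate true (hc a List.mem_cons_self) (hs _)
        obtain ⟨h1, h2, h3⟩ := ih _ _ (fun z hz => hc z (List.mem_cons_of_mem _ hz)) this
          (fun z => (hs z).trans (Nat.lt_succ_self _))
        refine ⟨h1.weaken le_rfl fun w hw => ?_, h2, (Nat.le_succ _).trans h3⟩
        simp only [if_true] at hw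
        refine ⟨hw.1.1, ?_⟩
        simp only [List.mem_cons, forall_eq_or_imp]
        exact ⟨fun _ => hw.1.2, hw.2⟩
  obtain ⟨h1, h2, h3⟩ := gen c _ (g.const true) hc (h.const true)
    (fun z => Nat.succ_lt_succ (h.cur_lt z))
  exact ⟨h1.weaken le_rfl fun w hw => hw.2, h2, h3⟩

theorem occStep (h : Inv L V M x D T g) {c : List Lit} (hcL : c ∈ L)
    (hc : ∀ z ∈ c, z ∈ D ∧ z.compl ∈ D) {y : Lit} (hy : y ∈ c) :
    Inv L V M x D (fun _ => True) (g.occStep c y) := by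
  obtain ⟨h1, h2, -⟩ := h.chain (some y) fun z hz => (hc z hz).2
  have h3 := h1.gate false (hc y hy).1 (h2 y)
  rw [Gen.chain_cur] at h3
  refine (h3.assign (y := y) fun w hw hx hT => ?_).weaken (Set.subset_insert _ _) fun _ h => h
  simp only [Bool.false_eq_true, if_false] at hT
  rcases hT with hT | hT
  · obtain ⟨z, hz, hzw⟩ := hw c hcL
    by_cases hzy : z = y
    · exact hzy ▸ hzw
    · exact absurd hzw (Lit.holds_compl.1 (hT z hz (by simpa using hzy)))
  · exact hT

theorem round (h : Inv L V M x D (fun _ => True) g) (hD : ∀ c ∈ L, ∀ z ∈ c, z ∈ D ∧ z.compl ∈ D) :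
    Inv L V M x D (fun _ => True) (g.round L) :=
  foldl_induction (P := Inv L V M x D fun _ => True) L
    (fun _ c hc h => foldl_induction (P := Inv L V M x D fun _ => True) c
      (fun _ _ hy h => h.occStep hc (hD c hc) hy) _ h) _ h

theorem assertStep (h : Inv L V M x D T g) (hx : x.var ∈ V ∨ M ≤ x.var) (hxM : x.var ≤ M)
    {c : List Lit} (hcL : c ∈ L) (hc : ∀ z ∈ c, z ∈ D ∧ z.compl ∈ D) :
    Inv L V M x D (fun _ => True) (g.assertStep x c) := by
  obtain ⟨h1, h2, h3⟩ := h.chain none fun z hz => (hc z hz).2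
  have := h.next
  refine h1.assert hx (by omega) (fun w hw _ hT => ?_) hxM
  obtain ⟨z, hz, hzw⟩ := hw c hcL
  exact Lit.holds_compl.1 (hT z hz (by simp)) hzw

theorem initOcc (h : Inv L V M x D T g) (y : Lit) :
    Inv L V M x (insert y.compl (insert y D)) (fun _ => True) (g.initOcc y) :=
  (((h.const false).assign (by simp)).const false).assign (by simp)

theorem initClause (h : Inv L V M x D (fun _ => True) g) (c : List Lit) :
    Inv L V M x (D ∪ {y | ∃ z ∈ c, z.var = y.var}) (fun _ => True) (g.initClause c) := by
  rw [Gen.initClause]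
  induction c generalizing D g with
  | nil => simpa using h
  | cons a c ih =>
    refine (ih (h.initOcc a)).weaken ?_ fun _ h => h
    rintro y (hy | ⟨z, hz, hzy⟩)
    · exact Or.inl (Or.inr (Or.inr hy))
    · rcases List.mem_cons.1 hz with rfl | hz
      · rcases Lit.eq_or_eq_compl hzy with rfl | rfl
        · exact Or.inl (Or.inr (Or.inl rfl))
        · exact Or.inl (Or.inl (by simp))
      · exact Or.inr ⟨z, hz, hzy⟩

theorem initClauses (h : Inv L V M x D (fun _ => True) g) (K : List (List Lit)) :
    Inv L V M x (D ∪ {y | ∃ c ∈ K, ∃ z ∈ c, z.var = y.var}) (fun _ => True)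
      (K.foldl Gen.initClause g) := by
  induction K generalizing D g with
  | nil => simpa using h
  | cons a K ih =>
    refine (ih (h.initClause a)).weaken ?_ fun _ h => h
    rintro y (hy | ⟨c, hc, hcy⟩)
    · exact Or.inl (Or.inl hy)
    · rcases List.mem_cons.1 hc with rfl | hc
      · exact Or.inl (Or.inr hcy)
      · exact Or.inr ⟨c, hc, hcy⟩

theorem initVar (h : Inv L V M x D T g) (hV : ∀ v ∈ V, v < M) {v : ℕ} (hv : v ∈ V) :
    Inv L V M x D (fun _ => True) (g.initVar v) :=
  ((((h.equiv hV (y := ⟨v, true⟩) hv).assign fun _ _ _ h => h).equiv hV (y := ⟨v, false⟩) hv).assign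
    fun _ _ _ h => h).weaken ((Set.subset_insert _ _).trans (Set.subset_insert _ _)) fun _ h => h

theorem copy (h : Inv L V M x D T g) (hV : ∀ v ∈ V, v < M) {x' : Lit}
    (hx : x'.var ∈ V ∨ M ≤ x'.var) (hxM : x'.var ≤ M) {vs : List ℕ} (hvs : ∀ v ∈ vs, v ∈ V)
    (R : ℕ) : Inv L V M x' ∅ (fun _ => True) (g.copy L vs R x') := by
  have h1 := (h.reset x').initClauses L
  have h2 := foldl_induction (P := Inv L V M x' _ fun _ => True) vs
    (fun _ v hv h => h.initVar hV (hvs v hv)) _ h1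
  have h3 := ((h2.const true).assign (y := x'.compl)
    fun w _ hx _ => Lit.holds_compl.2 hx).weaken (D' := litsOf L)
    (by intro y hy; exact Or.inr (Or.inr hy)) fun _ h => h
  have hD : ∀ c ∈ L, ∀ z ∈ c, z ∈ litsOf L ∧ z.compl ∈ litsOf L := fun c hc z hz =>
    ⟨⟨c, hc, z, hz, rfl⟩, ⟨c, hc, z, hz, rfl⟩⟩
  have h4 : Inv L V M x' (litsOf L) (fun _ => True) ((Gen.round L)^[R] (Gen.init L vs g x')) := by
    induction R with
    | zero => exact h3
    | succ R ih =>
      rw [Function.iterate_succ_apply']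
      exact ih.round hD
  exact (foldl_induction (P := Inv L V M x' (litsOf L) fun _ => True) L
    (fun _ c hc h => h.assertStep hx hxM hc (hD c hc)) _ h4).weaken (Set.empty_subset _)
    fun _ h => h

theorem start (L : List (List Lit)) {V : Finset ℕ} {M : ℕ} (x : Lit) :
    Inv L V M x ∅ (fun _ => True) (Gen.start M) where
  next := Nat.lt_succ_self _
  lt := by simp [Gen.start, Gen.const, Gen.emit]
  var := by simp [Gen.start, Gen.const, Gen.emit]
  nodup_var := by simp [Gen.start, Gen.const, Gen.emit]
  nodup := by simp [Gen.start, Gen.const, Gen.emit]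
  det := fun A _ hcl _ z h1 h2 => by
    obtain ⟨v, b⟩ := z
    have h2 : v < M + 1 := h2
    have h1 : M ≤ v := h1
    obtain rfl : v = M := by omega
    have : (⟨v, false⟩ : Lit) ∈ A := hcl [⟨v, false⟩]
      (by simp [Gen.start, Gen.const, Gen.emit]) _ (by simp) (by simp)
    cases b
    · exact Or.inl this
    · exact Or.inr this
  cur_lt := by simp [Gen.start, Gen.const, Gen.emit]
  le_cur := by simp
  model := fun w _ hM => ⟨w, fun _ _ => rfl,
    by simp [ModelsList, Gen.start, Gen.const, Gen.emit, Lit.Holds, hM], by simp, by simp⟩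

theorem final (L : List (List Lit)) {V : Finset ℕ} {M : ℕ} (hV : ∀ v ∈ V, v < M) {vs : List ℕ}
    (hvs : ∀ v ∈ vs, v ∈ V) (R : ℕ) :
    ∃ x, Inv L V M x ∅ (fun _ => True) (Gen.final L vs R M) :=
  foldl_induction (P := fun g => ∃ x, Inv L V M x ∅ (fun _ => True) g) vs
    (fun _ v hv ⟨_, h⟩ => ⟨⟨v, false⟩,
      (h.copy hV (x' := ⟨v, true⟩) (Or.inl (hvs v hv)) (hV v (hvs v hv)).le hvs R).copy hV
        (Or.inl (hvs v hv)) (hV v (hvs v hv)).le hvs R⟩) _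
    ⟨⟨M, true⟩, (start L ⟨M, true⟩).copy hV (Or.inr le_rfl) le_rfl hvs R⟩

end Inv

/-! ### Derivations in the generated clauses -/

namespace Gen

variable {A : Set Lit} {g : Gen}

/-- The literals that have been derived, if `A` is the set of literals of the output derived by
unit-clause propagation. -/
def derived (A : Set Lit) (g : Gen) : Set Lit := {y | (⟨g.cur y, true⟩ : Lit) ∈ A}

theorem subset_emit (B : List (List Lit)) : g.out ⊆ (g.emit B).out := List.subset_append_left _ _

theorem subset_foldl {α : Type*} {f : Gen → α → Gen} (h : ∀ g a, g.out ⊆ (f g a).out) (l : List α)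
    (g : Gen) : g.out ⊆ (l.foldl f g).out :=
  foldl_induction (P := fun g' => g.out ⊆ Gen.out g') l
    (fun _ _ _ hb => List.Subset.trans hb (h _ _)) _ (List.Subset.refl _)

theorem subset_chainStep (y : Option Lit) (g : Gen) (z : Lit) : g.out ⊆ (g.chainStep y z).out := by
  rw [chainStep]
  split_ifs
  · exact List.Subset.refl _
  · exact subset_emit _

theorem subset_chain (y : Option Lit) (c : List Lit) : g.out ⊆ (g.chain y c).out :=
  List.Subset.trans (subset_emit _) (subset_foldl (subset_chainStep y) _ _)

theorem subset_occStep (c : List Lit) (g : Gen) (y : Lit) : g.out ⊆ (g.occStep c y).out :=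
  List.Subset.trans (subset_chain _ _) (subset_emit _)

theorem subset_clauseStep (g : Gen) (c : List Lit) : g.out ⊆ (g.clauseStep c).out :=
  subset_foldl (subset_occStep c) c g

theorem subset_round (L : List (List Lit)) : g.out ⊆ (g.round L).out :=
  subset_foldl subset_clauseStep L g

theorem subset_assertStep (x : Lit) (g : Gen) (c : List Lit) : g.out ⊆ (g.assertStep x c).out :=
  List.Subset.trans (subset_chain _ _) (subset_emit _)

theorem subset_initVar (g : Gen) (v : ℕ) : g.out ⊆ (g.initVar v).out :=
  List.Subset.trans (subset_emit (g := g) [[⟨g.next, true⟩, ⟨v, false⟩], [⟨g.next, false⟩, ⟨v, true⟩]])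
    (subset_emit _)

theorem subset_initOcc (g : Gen) (y : Lit) : g.out ⊆ (g.initOcc y).out :=
  List.Subset.trans (subset_emit (g := g) [[⟨g.next, false⟩]]) (subset_emit _)

theorem subset_initClause (g : Gen) (c : List Lit) : g.out ⊆ (g.initClause c).out :=
  subset_foldl subset_initOcc c g

theorem subset_init (L : List (List Lit)) (vs : List ℕ) (x : Lit) :
    g.out ⊆ (g.init L vs x).out :=
  List.Subset.trans (subset_foldl subset_initClause L g)
    (List.Subset.trans (subset_foldl subset_initVar vs _) (subset_emit _))

theorem subset_iterate_round (L : List (List Lit)) (R : ℕ) :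
    g.out ⊆ ((round L)^[R] g).out := by
  induction R with
  | zero => exact List.Subset.refl _
  | succ R ih =>
    rw [Function.iterate_succ_apply']
    exact List.Subset.trans ih (subset_round L)

theorem subset_copy (L : List (List Lit)) (vs : List ℕ) (R : ℕ) (x : Lit) :
    g.out ⊆ (g.copy L vs R x).out :=
  List.Subset.trans (subset_init L vs x)
    (List.Subset.trans (subset_iterate_round L R) (subset_foldl (subset_assertStep x) L _))

theorem subset_varStep (L : List (List Lit)) (vs : List ℕ) (R : ℕ) (g : Gen) (v : ℕ) :
    g.out ⊆ (g.varStep L vs R v).out :=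
  List.Subset.trans (subset_copy ..) (subset_copy ..)

theorem derived_const (hA : UnitClosedList A (g.const true).out) : (⟨g.next, true⟩ : Lit) ∈ A :=
  hA [⟨g.next, true⟩] (List.mem_append_right _ (by simp)) _ (by simp) (by simp)

theorem derived_and {b : ℕ} (hA : UnitClosedList A (g.gate true b).out)
    (h1 : (⟨g.next - 1, true⟩ : Lit) ∈ A) (h2 : (⟨b, true⟩ : Lit) ∈ A) :
    (⟨g.next, true⟩ : Lit) ∈ A := by
  refine hA [⟨g.next, true⟩, ⟨g.next - 1, false⟩, ⟨b, false⟩]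
    (List.mem_append_right _ (by simp)) _ (by simp) ?_
  intro z hz hzn
  simp only [List.mem_cons, List.not_mem_nil, or_false] at hz
  rcases hz.resolve_left hzn with rfl | rfl <;> assumption

theorem derived_or {b : ℕ} (hA : UnitClosedList A (g.gate false b).out) {v : ℕ}
    (hv : v = g.next - 1 ∨ v = b) (h : (⟨v, true⟩ : Lit) ∈ A) : (⟨g.next, true⟩ : Lit) ∈ A := by
  refine hA [⟨g.next, true⟩, ⟨v, false⟩]
    (List.mem_append_right _ (by rcases hv with rfl | rfl <;> simp)) _ (by simp) ?_
  intro z hz hzn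
  simp only [List.mem_cons, List.not_mem_nil, or_false] at hz
  rcases hz.resolve_left hzn with rfl
  exact h

theorem derived_chain {y : Option Lit} {c : List Lit} (hA : UnitClosedList A (g.chain y c).out)
    (h : ∀ z ∈ c, some z ≠ y → z.compl ∈ derived A g) :
    (⟨(g.chain y c).next - 1, true⟩ : Lit) ∈ A := by
  have gen : ∀ (c : List Lit) (g : Gen), UnitClosedList A (c.foldl (chainStep y) g).out →
      (∀ z ∈ c, some z ≠ y → z.compl ∈ derived A g) → (⟨g.next - 1, true⟩ : Lit) ∈ A →
      (⟨(c.foldl (chainStep y) g).next - 1, true⟩ : Lit) ∈ A := by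
    intro c
    induction c with
    | nil => exact fun g _ _ h => h
    | cons a c ih =>
      intro g hA h h1
      rw [List.foldl_cons, chainStep] at hA ⊢
      split_ifs at hA ⊢ with ha
      · exact ih g hA (fun z hz => h z (List.mem_cons_of_mem _ hz)) h1
      · refine ih _ hA (fun z hz => h z (List.mem_cons_of_mem _ hz)) ?_
        refine derived_and (hA.mono ?_) h1 (h a (by simp) ha)
        exact subset_foldl (subset_chainStep y) c _
  refine gen c (g.const true) hA h (derived_const (g := g) (hA.mono ?_))
  exact subset_foldl (subset_chainStep y) c _

theorem derived_occStep {c : List Lit} {y : Lit} (hA : UnitClosedList A (g.occStep c y).out) :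
    derived A g ⊆ derived A (g.occStep c y) ∧
      ((∀ z ∈ c, z ≠ y → z.compl ∈ derived A g) → y ∈ derived A (g.occStep c y)) := by
  have hy : y ∈ derived A (g.occStep c y) ↔ (⟨(g.chain (some y) c).next, true⟩ : Lit) ∈ A := by
    simp [derived, occStep, assign, gate, emit]
  constructor
  · intro z hz
    by_cases hzy : z = y
    · subst hzy
      exact hy.2 (derived_or hA (Or.inr rfl) hz)
    · simpa [derived, occStep, assign, gate, emit, hzy, chain_cur] using hz
  · intro h
    refine hy.2 (derived_or hA (Or.inl rfl) (derived_chain (hA.mono (subset_emit _)) ?_))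
    exact fun z hz hne => h z hz (by simpa using hne)

theorem derived_clauseStep {c : List Lit} (hA : UnitClosedList A (g.clauseStep c).out) :
    derived A g ⊆ derived A (g.clauseStep c) ∧
      ∀ y ∈ c, (∀ z ∈ c, z ≠ y → z.compl ∈ derived A g) → y ∈ derived A (g.clauseStep c) := by
  have gen : ∀ (l : List Lit) (g : Gen), UnitClosedList A (l.foldl (occStep c) g).out →
      derived A g ⊆ derived A (l.foldl (occStep c) g) ∧
      ∀ y ∈ l, (∀ z ∈ c, z ≠ y → z.compl ∈ derived A g) →
        y ∈ derived A (l.foldl (occStep c) g) := by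
    intro l
    induction l with
    | nil => exact fun g _ => ⟨subset_rfl, by simp⟩
    | cons a l ih =>
      intro g hA
      have hA1 : UnitClosedList A (g.occStep c a).out := hA.mono
        (subset_foldl (subset_occStep c) l _)
      obtain ⟨h1, h2⟩ := derived_occStep hA1
      obtain ⟨h3, h4⟩ := ih _ hA
      refine ⟨h1.trans h3, fun y hy h => ?_⟩
      rcases List.mem_cons.1 hy with rfl | hy
      · exact h3 (h2 h)
      · exact h4 y hy fun z hz hzy => h1 (h z hz hzy)
  exact gen c g hA

/-- A round extends the set of derived literals, and it includes every single propagation from the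
literals derived before it. -/
theorem derived_round {L : List (List Lit)} (hA : UnitClosedList A (g.round L).out) :
    derived A g ⊆ derived A (g.round L) ∧
      ∀ c ∈ L, ∀ y ∈ c, (∀ z ∈ c, z ≠ y → z.compl ∈ derived A g) →
        y ∈ derived A (g.round L) := by
  rw [round] at *
  induction L generalizing g with
  | nil => exact ⟨subset_rfl, by simp⟩
  | cons a L ih =>
    have hA1 : UnitClosedList A (g.clauseStep a).out := hA.mono (subset_foldl subset_clauseStep L _)
    obtain ⟨h1, h2⟩ := derived_clauseStep hA1
    obtain ⟨h3, h4⟩ := ih hA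
    refine ⟨h1.trans h3, fun c hc y hy h => ?_⟩
    rcases List.mem_cons.1 hc with rfl | hc
    · exact h3 (h2 y hy h)
    · exact h4 c hc y hy fun z hz hzy => h1 (h z hz hzy)

theorem derived_iterate {L : List (List Lit)} {R i j : ℕ}
    (hA : UnitClosedList A ((round L)^[R] g).out) (hij : i ≤ j) (hj : j ≤ R) :
    derived A ((round L)^[i] g) ⊆ derived A ((round L)^[j] g) := by
  induction j, hij using Nat.le_induction with
  | base => exact subset_rfl
  | succ j hij ih =>
    refine (ih (by omega)).trans ?_
    rw [Function.iterate_succ_apply']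
    refine (derived_round (hA.mono ?_)).1
    rw [← Function.iterate_succ_apply' (round L), ← Nat.sub_add_cancel hj, Function.iterate_add_apply]
    exact subset_iterate_round L _

theorem derived_foldl_assertStep {x : Lit} {L : List (List Lit)}
    (hA : UnitClosedList A (L.foldl (assertStep x) g).out) {c : List Lit} (hc : c ∈ L)
    (h : ∀ z ∈ c, z.compl ∈ derived A g) : x ∈ A := by
  induction L generalizing g with
  | nil => simp at hc
  | cons a L ih =>
    rcases List.mem_cons.1 hc with rfl | hc
    · have hA1 : UnitClosedList A (g.assertStep x c).out := hA.mono
        (subset_foldl (subset_assertStep x) L _)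
      have h1 := derived_chain (y := none) (hA1.mono (subset_emit _)) fun z hz _ => h z hz
      have h2 : (⟨(g.chain none c).next, true⟩ : Lit) ∈ A :=
        hA1 [⟨(g.chain none c).next, true⟩] (List.mem_append_right _ (by simp)) _ (by simp) (by simp)
      refine hA1 [⟨(g.chain none c).next, false⟩, ⟨(g.chain none c).next - 1, false⟩, x]
        (List.mem_append_right _ (by simp)) x (by simp) fun z hz hzx => ?_
      simp only [List.mem_cons, List.not_mem_nil, or_false] at hz
      rcases hz with rfl | rfl | rfl
      · exact h2
      · exact h1
      · exact absurd rfl hzx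
    · refine ih hA hc fun z hz => ?_
      have := h z hz
      simpa [derived, assertStep, assert, emit, chain_cur] using this

theorem derived_initVar {v : ℕ} (hA : UnitClosedList A (g.initVar v).out) :
    (∀ y : Lit, y.var ≠ v → (y ∈ derived A g ↔ y ∈ derived A (g.initVar v))) ∧
      ∀ y : Lit, y.var = v → y ∈ A → y ∈ derived A (g.initVar v) := by
  constructor
  · intro y hy
    have h1 : y ≠ ⟨v, true⟩ := fun h => hy (by rw [h])
    have h2 : y ≠ ⟨v, false⟩ := fun h => hy (by rw [h])
    simp [derived, initVar, assign, equiv, emit, h1, h2]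
  · rintro ⟨v, b⟩ rfl hy
    cases b
    · have : (⟨g.next + 1, true⟩ : Lit) ∈ A := by
        refine hA [⟨g.next + 1, true⟩, ⟨v, true⟩] (List.mem_append_right _ (by
          simp [assign, equiv, emit, Lit.compl])) _ (by simp) fun z hz hzx => ?_
        simp only [List.mem_cons, List.not_mem_nil, or_false] at hz
        rcases hz.resolve_left hzx with rfl
        exact hy
      simpa [derived, initVar, assign, equiv, emit] using this
    · have : (⟨g.next, true⟩ : Lit) ∈ A := by
        refine hA [⟨g.next, true⟩, ⟨v, false⟩] (List.mem_append_left _ (List.mem_append_right _ (by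
          simp [Lit.compl]))) _ (by simp) fun z hz hzx => ?_
        simp only [List.mem_cons, List.not_mem_nil, or_false] at hz
        rcases hz.resolve_left hzx with rfl
        exact hy
      simpa [derived, initVar, assign, equiv, emit] using this

theorem derived_init {L : List (List Lit)} {vs : List ℕ} {x : Lit}
    (hA : UnitClosedList A (g.init L vs x).out) :
    x.compl ∈ derived A (g.init L vs x) ∧
      ∀ y : Lit, y.var ∈ vs → y ∈ A → y ∈ derived A (g.init L vs x) := by
  have h1 : x.compl ∈ derived A (g.init L vs x) := by
    have := derived_const hA
    simpa [derived, init, assign, const, emit] using this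
  refine ⟨h1, fun y hy hyA => ?_⟩
  by_cases hyx : y = x.compl
  · exact hyx ▸ h1
  · suffices y ∈ derived A (vs.foldl initVar (L.foldl initClause g)) by
      simpa [derived, init, assign, const, emit, hyx] using this
    have hA : UnitClosedList A (vs.foldl initVar (L.foldl initClause g)).out :=
      hA.mono (subset_emit _)
    generalize L.foldl initClause g = g' at hA ⊢
    have gen : ∀ (vs : List ℕ) (g : Gen), UnitClosedList A (vs.foldl initVar g).out →
        (y.var ∈ vs ∨ y ∈ derived A g) → y ∈ derived A (vs.foldl initVar g) := by
      intro vs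
      induction vs with
      | nil => exact fun g _ h => h.resolve_left (by simp)
      | cons v vs ih =>
        intro g hA h
        have hA1 : UnitClosedList A (g.initVar v).out := hA.mono (subset_foldl subset_initVar vs _)
        refine ih _ hA ?_
        by_cases hyv : y.var = v
        · exact Or.inr ((derived_initVar hA1).2 y hyv hyA)
        · rcases h with h | h
          · exact Or.inl ((List.mem_cons.1 h).resolve_left hyv)
          · exact Or.inr (((derived_initVar hA1).1 y hyv).1 h)
    exact gen vs g' hA (Or.inl hy)

end Gen

/-- A sufficiently long increasing chain of subsets of a finite set has a repetition. -/
theorem exists_eq_succ_of_card_lt {α : Type*} (s : Finset α) (S : ℕ → Set α) {R : ℕ}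
    (hR : s.card < R) (hS : ∀ i < R, S i ⊆ S (i + 1)) :
    ∃ i < R, ∀ a ∈ s, a ∈ S (i + 1) → a ∈ S i := by
  classical
  by_contra hcon
  push Not at hcon
  have key : ∀ i ≤ R, i ≤ (s.filter (· ∈ S i)).card := by
    intro i
    induction i with
    | zero => simp
    | succ i ih =>
      intro hi
      obtain ⟨a, ha, ha1, ha2⟩ := hcon i (by omega)
      refine (ih (by omega)).trans_lt (Finset.card_lt_card ?_)
      refine (Finset.ssubset_iff_of_subset fun b hb => ?_).2 ⟨a, by simp [ha, ha1], by simp [ha2]⟩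
      rw [Finset.mem_filter] at hb ⊢
      exact ⟨hb.1, hS i (by omega) hb.2⟩
  have := key R le_rfl
  have := Finset.card_filter_le s (· ∈ S R)
  omega

/-- The copy for `x` simulates unit-clause propagation: if no set of literals that contains
`x.compl` and the literals of `A` over `vs` witnesses that propagation does not refute `L`, then `x`
is derived. -/
theorem Gen.mem_of_copy {A : Set Lit} {g : Gen} {L : List (List Lit)} {vs : List ℕ} {R : ℕ}
    {x : Lit} (s : Finset Lit) (hs : ∀ c ∈ L, ∀ z ∈ c, z ∈ s) (hR : s.card < R)
    (hA : UnitClosedList A (g.copy L vs R x).out)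
    (h : ∀ S : Set Lit, x.compl ∈ S → (∀ y ∈ A, y.var ∈ vs → y ∈ S) → UnitClosedList S L →
      ∃ c ∈ L, ∀ z ∈ c, z.compl ∈ S) : x ∈ A := by
  have hA1 : UnitClosedList A ((round L)^[R] (g.init L vs x)).out :=
    hA.mono (subset_foldl (subset_assertStep x) L _)
  have hmono := fun i j => derived_iterate (i := i) (j := j) hA1
  obtain ⟨i, hi, heq⟩ := exists_eq_succ_of_card_lt s
    (fun i => derived A ((round L)^[i] (g.init L vs x))) hR fun i hi => hmono i (i + 1) (by omega) hi
  have hinit := derived_init (hA1.mono (subset_iterate_round L R))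
  have h0 := hmono 0 i (Nat.zero_le _) hi.le
  have hcl : UnitClosedList (derived A ((round L)^[i] (g.init L vs x))) L := by
    intro c hc y hy hz
    refine heq y (hs c hc y hy) ?_
    rw [Function.iterate_succ_apply']
    refine (derived_round (hA1.mono ?_)).2 c hc y hy hz
    rw [← Function.iterate_succ_apply' (round L), ← Nat.sub_add_cancel (Nat.succ_le_of_lt hi),
      Function.iterate_add_apply]
    exact subset_iterate_round L _
  obtain ⟨c, hc, hcz⟩ := h _ (h0 hinit.1) (fun y hy hyv => h0 (hinit.2 y hyv hy)) hcl
  exact derived_foldl_assertStep hA hc fun z hz => hmono i R hi.le le_rfl (hcz z hz)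


/-! ### The generated clauses form a forcing representation -/

/-- The partial assignment that agrees with `φ`, except that it makes `x` false. -/
def PAss.falsify (φ : PAss) (x : Lit) : PAss :=
  ⟨insert x.var φ.dom, fun v => if h : v.1 = x.var then !x.pos else
    φ.val ⟨v.1, (Finset.mem_insert.1 v.2).resolve_left h⟩⟩

theorem PAss.falsify_sets {φ : PAss} {x y : Lit} (h : y ∈ (φ.falsify x).trueLits) :
    y = x.compl ∨ (y.var ≠ x.var ∧ y ∈ φ.trueLits) := by
  obtain ⟨h1, h2⟩ := h
  obtain ⟨v, b⟩ := y
  simp only [PAss.falsify] at h1 h2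
  by_cases hv : v = x.var
  · left
    subst hv
    cases b <;> cases hx : x.pos <;> simp_all [Lit.compl]
  · right
    refine ⟨hv, (Finset.mem_insert.1 h1).resolve_left hv, ?_⟩
    simpa [hv] using h2

theorem PAss.compl_mem_trueLits_falsify (φ : PAss) (x : Lit) :
    x.compl ∈ (φ.falsify x).trueLits := by
  refine ⟨Finset.mem_insert_self _ _, ?_⟩
  cases x with | mk v b => cases b <;> simp [PAss.falsify, Lit.compl]

theorem PAss.mem_trueLits_falsify {φ : PAss} {x y : Lit} (h : y.var ≠ x.var)
    (hy : y ∈ φ.trueLits) : y ∈ (φ.falsify x).trueLits := by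
  obtain ⟨h1, h2⟩ := hy
  refine ⟨Finset.mem_insert_of_mem h1, ?_⟩
  simpa [PAss.falsify, h] using h2

/-- The clause-set listed by a list of lists of literals. -/
def toClauseSet (L : List (List Lit)) : ClauseSet := (L.map List.toFinset).toFinset

theorem mem_toClauseSet {L : List (List Lit)} {C : Finset Lit} :
    C ∈ toClauseSet L ↔ ∃ c ∈ L, c.toFinset = C := by
  simp [toClauseSet]

theorem models_toClauseSet {w : ℕ → Bool} {L : List (List Lit)} :
    Models w (toClauseSet L) ↔ ModelsList w L := by
  simp [Models, ModelsList, mem_toClauseSet]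

theorem unitClosed_toClauseSet {A : Set Lit} {L : List (List Lit)} :
    UnitClosed A (toClauseSet L) ↔ UnitClosedList A L := by
  simp [UnitClosed, UnitClosedList, mem_toClauseSet]

theorem mem_vars_toClauseSet {L : List (List Lit)} {v : ℕ} :
    v ∈ vars (toClauseSet L) ↔ ∃ c ∈ L, ∃ z ∈ c, z.var = v := by
  simp [vars, mem_toClauseSet]

/-- In a copy, every variable in `vs` occurs. -/
theorem Gen.exists_mem_copy (g : Gen) (L : List (List Lit)) (vs : List ℕ) (R : ℕ) (x : Lit)
    {v : ℕ} (hv : v ∈ vs) : ∃ c ∈ (g.copy L vs R x).out, ∃ z ∈ c, z.var = v := by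
  suffices ∃ c ∈ (vs.foldl initVar (L.foldl initClause g)).out, ∃ z ∈ c, z.var = v by
    obtain ⟨c, hc, h⟩ := this
    exact ⟨c, subset_foldl (subset_assertStep x) L _ (subset_iterate_round L R
      (subset_emit [[⟨_, true⟩]] hc)), h⟩
  generalize L.foldl initClause g = g'
  induction vs generalizing g' with
  | nil => simp at hv
  | cons u vs ih =>
    rcases List.mem_cons.1 hv with rfl | hv
    · refine ⟨[⟨g'.next, false⟩, ⟨v, true⟩], subset_foldl subset_initVar vs _ ?_, ⟨v, true⟩, ?_, rfl⟩
      · exact List.mem_append_left _ (List.mem_append_right _ (by simp))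
      · simp
    · exact ih hv _

section Final

variable {f : BoolFun} {L : List (List Lit)} {vs : List ℕ} {R M : ℕ}

theorem exists_model_final (hvs : vs.toFinset = f.vars)
    (hf : f.vars ⊆ vars (toClauseSet L)) (hM : ∀ v ∈ vars (toClauseSet L), v < M)
    {w : ℕ → Bool} (hw : Models w (toClauseSet L)) :
    ∃ m, (∀ v ∈ f.vars, m v = w v) ∧ Models m (toClauseSet (Gen.final L vs R M).out) := by
  obtain ⟨x, h⟩ := Inv.final L (V := f.vars) (fun v hv => hM v (hf hv)) (vs := vs)
    (fun v hv => hvs ▸ List.mem_toFinset.2 hv) R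
  -- The variable `M` does not occur in `L`, so `w` may be changed there.
  have hagree : ∀ v < M, Function.update w M false v = w v := fun v hv =>
    Function.update_of_ne hv.ne _ _
  obtain ⟨m, h1, h2, -⟩ := h.model (Function.update w M false) (fun c hc => by
    obtain ⟨z, hz, hzw⟩ := models_toClauseSet.1 hw c hc
    refine ⟨z, hz, ?_⟩
    rw [Lit.Holds, hagree _ (hM _ (mem_vars_toClauseSet.2 ⟨c, hc, z, hz, rfl⟩))]
    exact hzw) (Function.update_self ..)
  exact ⟨m, fun v hv => by
    have := hM v (hf hv)
    rw [h1 v this.le, hagree v this], models_toClauseSet.2 h2⟩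

/-- If `A` is closed under unit-clause propagation in the copy for `x`, and `F` is unsatisfiable
under an assignment whose literals belong to `A`, except for `x.compl`, then `x ∈ A`. -/
theorem mem_of_copy_of_not_sat {g : Gen} {x : Lit} (hvs : vs.toFinset = f.vars)
    (hR : 2 * numVars (toClauseSet L) < R)
    (hhd : hardness f.vars (toClauseSet L) ≤ 1) {A : Set Lit}
    (hA : UnitClosedList A (g.copy L vs R x).out) {θ : PAss} (hθ : θ.dom ⊆ f.vars)
    (hθA : ∀ y ∈ θ.trueLits, y = x.compl ∨ y ∈ A)
    (hs : ¬ Sat (θ.apply (toClauseSet L))) : x ∈ A := by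
  refine Gen.mem_of_copy ((vars (toClauseSet L) ×ˢ (Finset.univ : Finset Bool)).image
    fun p => ⟨p.1, p.2⟩) (fun c hc z hz => ?_) (lt_of_le_of_lt Finset.card_image_le ?_) hA
    fun S hx hS hcl => ?_
  · simp only [Finset.mem_image, Finset.mem_product, Finset.mem_univ, and_true, Prod.exists]
    exact ⟨z.var, z.pos, mem_vars_toClauseSet.2 ⟨c, hc, z, hz, rfl⟩, rfl⟩
  · rw [Finset.card_product, Finset.card_univ, Fintype.card_bool, mul_comm]
    exact hR
  · by_contra hcon
    push Not at hcon
    have hθS : θ.trueLits ⊆ S := fun y hy => (hθA y hy).elim (fun h => h ▸ hx)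
      fun h => hS y h (List.mem_toFinset.1 (hvs ▸ hθ hy.1))
    refine r_one_ne_of_closed (S := S) (F := θ.apply (toClauseSet L)) ?_ ?_
      (r_one_of_hardness_le_one hhd (by exact_mod_cast hθ) hs)
    · rw [PAss.apply_eq]
      exact (unitClosed_toClauseSet.2 hcl).applySet hθS
    · rw [PAss.apply_eq]
      refine Unfalsified.applySet (fun C hC => ?_) hθS
      obtain ⟨c, hc, rfl⟩ := mem_toClauseSet.1 hC
      simpa using hcon c hc

theorem exists_copy_subset_final {x : Lit} (hx : x.var ∈ vs) :
    ∃ g : Gen, (g.copy L vs R x).out ⊆ (Gen.final L vs R M).out := by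
  have gen : ∀ (us : List ℕ) (g : Gen), x.var ∈ us →
      ∃ g' : Gen, (g'.copy L vs R x).out ⊆ (us.foldl (Gen.varStep L vs R) g).out := by
    intro us
    induction us with
    | nil => simp
    | cons u us ih =>
      intro g hu
      by_cases hxu : x.var = u
      · have hsub := Gen.subset_foldl (Gen.subset_varStep L vs R) us (g.varStep L vs R u)
        obtain ⟨v, b⟩ := x
        subst hxu
        cases b
        · exact ⟨_, hsub⟩
        · exact ⟨g, List.Subset.trans (Gen.subset_copy ..) hsub⟩
      · exact ih _ ((List.mem_cons.1 hu).resolve_left hxu)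
  exact gen vs _ hx

/-- The generated clauses form a forcing representation. -/
theorem isForcingRep_final (hrep : IsURRep (toClauseSet L) f) (hvs : vs.toFinset = f.vars)
    (hM : ∀ v ∈ vars (toClauseSet L), v < M) (hR : 2 * numVars (toClauseSet L) < R) :
    IsForcingRep (toClauseSet (Gen.final L vs R M).out) f := by
  obtain ⟨⟨hCLS, hf, hval⟩, hhd⟩ := hrep
  have hV : ∀ v ∈ f.vars, v < M := fun v hv => hM v (hf hv)
  obtain ⟨x₀, hInv⟩ := Inv.final L (V := f.vars) hV (vs := vs)
    (fun v hv => hvs ▸ List.mem_toFinset.2 hv) R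
  have hcopy₀ : ((Gen.start M).copy L vs R ⟨M, true⟩).out ⊆ (Gen.final L vs R M).out :=
    Gen.subset_foldl (Gen.subset_varStep L vs R) vs _
  -- The copy for the constant `M` refutes every falsifying assignment.
  have hsatF : ∀ (A : Set Lit) (φ : PAss), Consistent A →
      UnitClosed A (toClauseSet (Gen.final L vs R M).out) → φ.dom ⊆ f.vars → φ.trueLits ⊆ A →
      Sat (φ.apply (toClauseSet L)) := by
    intro A φ hA hcl hφ hφA
    by_contra hs
    rw [unitClosed_toClauseSet] at hcl
    have h1 : (⟨M, true⟩ : Lit) ∈ A := mem_of_copy_of_not_sat hvs hR hhd (hcl.mono hcopy₀) hφ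
      (fun y hy => Or.inr (hφA hy)) hs
    have h2 : (⟨M, false⟩ : Lit) ∈ A := hcl [⟨M, false⟩]
      (hcopy₀ (Gen.subset_copy L vs R _ (by simp [Gen.start, Gen.const, Gen.emit]))) _
      (by simp) (by simp)
    exact hA _ h1 h2
  have hext : ∀ φ : PAss, φ.dom ⊆ f.vars → Sat (φ.apply (toClauseSet L)) →
      Sat (φ.apply (toClauseSet (Gen.final L vs R M).out)) := by
    intro φ hφ hs
    obtain ⟨w, hw, hm⟩ := sat_apply_iff.1 hs
    obtain ⟨m, hmw, hmm⟩ := exists_model_final (R := R) hvs hf hM hm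
    refine sat_apply_iff.2 ⟨m, fun y hy => ?_, hmm⟩
    rw [Lit.Holds, hmw _ (hφ hy.1)]
    exact hw y hy
  refine ⟨⟨?_, ?_, fun φ => ?_⟩, isForcing_of_closed ?_ ?_ ?_⟩
  · intro C hC z hz hzc
    obtain ⟨c, hc, rfl⟩ := mem_toClauseSet.1 hC
    have := List.inj_on_of_nodup_map (hInv.nodup_var c hc) (List.mem_toFinset.1 hz)
      (List.mem_toFinset.1 hzc) rfl
    exact Lit.compl_ne z this.symm
  · intro v hv
    obtain ⟨c, hc, h⟩ := (Gen.start M).exists_mem_copy L vs R ⟨M, true⟩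
      (List.mem_toFinset.1 (hvs ▸ hv : v ∈ vs.toFinset))
    exact mem_vars_toClauseSet.2 ⟨c, hcopy₀ hc, h⟩
  · rw [← hval]
    refine ⟨fun hs => ?_, hext _ (Finset.Subset.refl _)⟩
    obtain ⟨w, hw, hm⟩ := sat_apply_iff.1 hs
    refine hsatF {x | x.Holds w} _ (fun x hx => ?_) (fun C hC y hy hz => ?_)
      (Finset.Subset.refl _) hw
    · exact fun h => Lit.holds_compl.1 h hx
    · obtain ⟨z, hzC, hzw⟩ := hm C hC
      by_cases hzy : z = y
      · exact hzy ▸ hzw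
      · exact absurd hzw (Lit.holds_compl.1 (hz z hzC hzy))
  · exact fun A φ hA hcl hφ hφA => hext φ hφ (hsatF A φ hA hcl hφ hφA)
  · intro A φ x hA hcl hφ hφA hx himp
    by_cases hxA : x.compl ∈ A
    · exact Or.inr hxA
    by_cases hxφ : x ∈ φ.trueLits
    · exact Or.inl (hφA hxφ)
    left
    obtain ⟨g, hg⟩ := exists_copy_subset_final (L := L) (R := R) (M := M) (x := x)
      (List.mem_toFinset.1 (hvs ▸ hx : x.var ∈ vs.toFinset))
    refine mem_of_copy_of_not_sat hvs hR hhd ((unitClosed_toClauseSet.1 hcl).mono hg)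
      (θ := φ.falsify x) (Finset.insert_subset hx hφ)
      (fun y hy => (PAss.falsify_sets hy).imp id fun h => hφA h.2) fun hs => ?_
    obtain ⟨w, hw, hm⟩ := sat_apply_iff.1 hs
    obtain ⟨m, hmw, hmm⟩ := exists_model_final (R := R) hvs hf hM hm
    have hxw := hw _ (φ.compl_mem_trueLits_falsify x)
    refine Lit.holds_compl.1 hxw ?_
    rw [Lit.Holds, ← hmw _ hx]
    refine himp m hmm fun y hy => ?_
    rw [Lit.Holds, hmw _ (hφ hy.1)]
    refine hw y (PAss.mem_trueLits_falsify (fun hyx => ?_) hy)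
    rcases Lit.eq_or_eq_compl hyx with rfl | rfl
    · exact hxφ hy
    · exact hxA (hφA hy)
  · intro A hA hcl htot z hz
    obtain ⟨c, hc, u, hu, huz⟩ := mem_vars_toClauseSet.1 hz
    rcases hInv.var c hc u hu with h | h
    · exact htot z (huz ▸ h)
    · exact hInv.det A hA (unitClosed_toClauseSet.1 hcl) htot z (huz ▸ h)
        (huz ▸ hInv.lt c hc u hu)

end Final


/-! ### Reasoning about programs -/

/-- `P`, started in `s`, halts after at most `B` steps in a state satisfying `Q`. -/
def Halts (P : Prog) (s : RAMState) (B : ℕ) (Q : RAMState → Prop) : Prop :=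
  ∃ t s', t ≤ B ∧ Exec P s t s' ∧ Q s'

/-- The effect of a sequence of elementary instructions. -/
def runs (is : List Instr) (s : RAMState) : RAMState := is.foldl (fun s i => i.exec s) s

/-- A sequence of elementary instructions as a program. -/
def Prog.block (is : List Instr) : Prog := is.foldr (fun i P => .seq (.instr i) P) .skip

/-- The instruction does not write to register `r`. -/
def Instr.Avoids (r : ℕ) : Instr → Bool
  | .const a _ => a != r
  | .copy a _ => a != r
  | .add a _ _ => a != r
  | .sub a _ _ => a != r
  | .load a _ => a != r
  | .read a => a != r
  | .store _ _ => true
  | .write _ => true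

/-- The program does not write to register `r`. -/
def Prog.Avoids (r : ℕ) : Prog → Bool
  | .skip => true
  | .instr i => i.Avoids r
  | .seq P Q => P.Avoids r && Q.Avoids r
  | .cond _ P Q => P.Avoids r && Q.Avoids r
  | .loop _ P => P.Avoids r

theorem Instr.exec_reg_of_avoids {r : ℕ} {i : Instr} (h : i.Avoids r = true) (s : RAMState) :
    (i.exec s).reg r = s.reg r := by
  cases i <;> simp only [Instr.Avoids, bne_iff_ne, ne_eq] at h <;>
    first
    | exact Function.update_of_ne (Ne.symm h) _ _
    | rfl

theorem Exec.reg_of_avoids {r : ℕ} {P : Prog} {s s' : RAMState} {t : ℕ} (he : Exec P s t s')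
    (h : P.Avoids r = true) : s'.reg r = s.reg r := by
  induction he with
  | skip => rfl
  | instr i s => exact Instr.exec_reg_of_avoids h s
  | seq _ _ ih1 ih2 =>
    simp only [Prog.Avoids, Bool.and_eq_true] at h
    rw [ih2 h.2, ih1 h.1]
  | cond_true _ _ ih =>
    simp only [Prog.Avoids, Bool.and_eq_true] at h
    exact ih h.1
  | cond_false _ _ ih =>
    simp only [Prog.Avoids, Bool.and_eq_true] at h
    exact ih h.2
  | loop_exit _ => rfl
  | loop_step _ _ _ ih1 ih2 => rw [ih2 h, ih1 h]

namespace Halts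

variable {P P' : Prog} {s : RAMState} {B B' B'' : ℕ} {Q Q' : RAMState → Prop}

theorem mono (h : Halts P s B Q) (hB : B ≤ B') (hQ : ∀ s', Q s' → Q' s') : Halts P s B' Q' := by
  obtain ⟨t, s', h1, h2, h3⟩ := h
  exact ⟨t, s', h1.trans hB, h2, hQ _ h3⟩

/-- Registers that are not written to keep their contents. -/
theorem frame (h : Halts P s B Q) :
    Halts P s B fun s' => Q s' ∧ ∀ r, P.Avoids r = true → s'.reg r = s.reg r := by
  obtain ⟨t, s', h1, h2, h3⟩ := h
  exact ⟨t, s', h1, h2, h3, fun r hr => h2.reg_of_avoids hr⟩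

theorem skip (h : Q s) : Halts .skip s 0 Q := ⟨0, s, le_rfl, .skip s, h⟩

theorem seq (h1 : Halts P s B Q') (h2 : ∀ s', Q' s' → Halts P' s' B' Q) (hB : B + B' ≤ B'') :
    Halts (.seq P P') s B'' Q := by
  obtain ⟨t, s', h3, h4, h5⟩ := h1
  obtain ⟨t', s'', h6, h7, h8⟩ := h2 s' h5
  exact ⟨t + t', s'', by omega, .seq h4 h7, h8⟩

theorem block (is : List Instr) (h : Q (runs is s)) : Halts (.block is) s is.length Q := by
  induction is generalizing s with
  | nil => exact skip h
  | cons i is ih =>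
    exact seq (Q' := fun s' => s' = i.exec s) ⟨1, _, le_rfl, .instr i s, rfl⟩
      (fun s' hs' => ih (by subst hs'; exact h)) (by rw [List.length_cons, add_comm])

theorem block_seq (is : List Instr) (h : Halts P (runs is s) B Q) (hB : is.length + B ≤ B') :
    Halts (.seq (.block is) P) s B' Q :=
  seq (block is (Q := fun s' => s' = runs is s) rfl) (fun s' hs' => by subst hs'; exact h) hB

theorem cond {a : ℕ} (h1 : s.reg a ≠ 0 → Halts P s B Q) (h2 : s.reg a = 0 → Halts P' s B Q) :
    Halts (.cond a P P') s (B + 1) Q := by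
  by_cases ha : s.reg a = 0
  · obtain ⟨t, s', h3, h4, h5⟩ := h2 ha
    exact ⟨t + 1, s', by omega, .cond_false ha h4, h5⟩
  · obtain ⟨t, s', h3, h4, h5⟩ := h1 ha
    exact ⟨t + 1, s', by omega, .cond_true ha h4, h5⟩

/-- A loop that processes the entries of a list; `I l` holds when the entries in `l` have not yet
been processed. -/
theorem loop {α : Type*} {a : ℕ} (I : List α → RAMState → Prop) (c : α → ℕ)
    (hstep : ∀ x l s, I (x :: l) s → s.reg a ≠ 0 ∧ Halts P s (c x) (I l))
    (hexit : ∀ s, I [] s → s.reg a = 0) (l : List α) {s : RAMState} (h : I l s) :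
    Halts (.loop a P) s ((l.map fun x => c x + 1).sum + 1) (I []) := by
  induction l generalizing s with
  | nil => exact ⟨1, s, by simp, .loop_exit (hexit s h), h⟩
  | cons x l ih =>
    obtain ⟨h0, t, s', h1, h2, h3⟩ := hstep x l s h
    obtain ⟨t', s'', h4, h5, h6⟩ := ih h3
    refine ⟨t + t' + 1, s'', ?_, .loop_step h0 h2 h5, h6⟩
    simp only [List.map_cons, List.sum_cons]
    omega

end Halts

theorem runs_append (is js : List Instr) (s : RAMState) :
    runs (is ++ js) s = runs js (runs is s) := List.foldl_append

theorem runs_cons (i : Instr) (is : List Instr) (s : RAMState) :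
    runs (i :: is) s = runs is (i.exec s) := rfl

/-! ### Lists in memory -/

/-- The sequence `l` is stored at the addresses `p`, `p + 4`, `p + 8`, … -/
def Stored (m : ℕ → ℕ) : ℕ → List ℕ → Prop
  | _, [] => True
  | p, a :: l => 4 ∣ p ∧ m p = a ∧ Stored m (p + 4) l

theorem stored_append {m : ℕ → ℕ} {p : ℕ} {l l' : List ℕ} :
    Stored m p (l ++ l') ↔ Stored m p l ∧ Stored m (p + 4 * l.length) l' := by
  induction l generalizing p with
  | nil => simp [Stored]
  | cons a l ih =>
    simp only [List.cons_append, Stored, ih, List.length_cons, and_assoc]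
    rw [show p + 4 + 4 * l.length = p + 4 * (l.length + 1) by ring]

theorem Stored.congr {m m' : ℕ → ℕ} {p : ℕ} {l : List ℕ} (h : Stored m p l)
    (hm : ∀ a, 4 ∣ a → p ≤ a → a < p + 4 * l.length → m' a = m a) : Stored m' p l := by
  induction l generalizing p with
  | nil => trivial
  | cons a l ih =>
    obtain ⟨h1, h2, h3⟩ := h
    simp only [List.length_cons] at hm
    refine ⟨h1, by rw [hm p h1 le_rfl (by omega), h2], ih h3 fun b hb h4 h5 => ?_⟩
    exact hm b hb (by omega) (by omega)

/-- The memory cell holding the variable that stands for "`y` has been derived". Its address is `1` or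
`2` modulo `4`, so that the stored sequences do not interfere. -/
def cell (y : Lit) : ℕ := 4 * y.var + 1 + (if y.pos then 1 else 0)

theorem cell_injective : Function.Injective cell := by
  rintro ⟨v, b⟩ ⟨v', b'⟩ h
  cases b <;> cases b' <;> simp [cell] at h ⊢ <;> omega

theorem not_dvd_cell (y : Lit) : ¬ 4 ∣ cell y := by
  obtain ⟨v, b⟩ := y
  cases b <;> simp only [cell] <;> simp <;> omega

/-- In memory, a literal is represented by its cell and the cell of its complement. -/
def cellsOf (y : Lit) : List ℕ := [cell y, cell y.compl]

/-- The output written for a list of clauses, without the end mark. -/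
def encodeBody (E : List (List Lit)) : List ℕ := E.flatMap fun c => 1 :: encodeList encodeLit c

theorem encodeClauses_eq (E : List (List Lit)) : encodeClauses E = encodeBody E ++ [0] := by
  rw [encodeClauses]
  induction E with
  | nil => rfl
  | cons c E ih => simp [encodeList, encodeBody, ih]

theorem encodeBody_append (E E' : List (List Lit)) :
    encodeBody (E ++ E') = encodeBody E ++ encodeBody E' := List.flatMap_append

/-! ### Writing clauses -/

/-- Write a clause, each literal being given by a register with its sign and a register with its
variable. Register `0` contains `0`, and register `1` contains `1`. -/
def writeClause (c : List (ℕ × ℕ)) : List Instr :=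
  .write 1 :: (c.flatMap fun q => [.write 1, .write q.1, .write q.2]) ++ [.write 0]

/-- Write the clauses of `B`, and increase the register `3` containing the next variable. -/
def emitBlock (B : List (List (ℕ × ℕ))) : List Instr := B.flatMap writeClause ++ [.add 3 3 1]

/-- The literal given by a register with the sign and a register with the variable. -/
def litAt (s : RAMState) (q : ℕ × ℕ) : Lit := ⟨s.reg q.2, decide (s.reg q.1 = 1)⟩

theorem runs_writeClause (c : List (ℕ × ℕ)) (s : RAMState) (h0 : s.reg 0 = 0) (h1 : s.reg 1 = 1)
    (hc : ∀ q ∈ c, s.reg q.1 ≤ 1) :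
    runs (writeClause c) s =
      ⟨s.reg, s.mem, s.inp, s.out ++ 1 :: encodeList encodeLit (c.map (litAt s))⟩ := by
  have gen : ∀ (o : List ℕ), runs ((c.flatMap fun q =>
      [Instr.write 1, .write q.1, .write q.2]) ++ [.write 0]) ⟨s.reg, s.mem, s.inp, o⟩ =
      ⟨s.reg, s.mem, s.inp, o ++ encodeList encodeLit (c.map (litAt s))⟩ := by
    induction c with
    | nil => intro o; simp [runs, Instr.exec, encodeList, h0]
    | cons q c ih =>
      intro o
      have hq := hc q List.mem_cons_self
      have : (if s.reg q.1 = 1 then 1 else 0) = s.reg q.1 := by split_ifs <;> omega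
      simp only [List.flatMap_cons, List.cons_append, List.nil_append, runs_cons, Instr.exec,
        List.map_cons, encodeList, encodeLit, litAt]
      rw [ih fun q' hq' => hc q' (List.mem_cons_of_mem _ hq')]
      simp [this, h1]
  rw [writeClause, List.cons_append, runs_cons, Instr.exec, gen]
  simp [h1]

theorem runs_emitBlock (B : List (List (ℕ × ℕ))) (s : RAMState) (h0 : s.reg 0 = 0)
    (h1 : s.reg 1 = 1) (hB : ∀ c ∈ B, ∀ q ∈ c, s.reg q.1 ≤ 1) :
    runs (emitBlock B) s = ⟨Function.update s.reg 3 (s.reg 3 + 1), s.mem, s.inp,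
      s.out ++ encodeBody (B.map (List.map (litAt s)))⟩ := by
  rw [emitBlock]
  induction B generalizing s with
  | nil => simp [runs, Instr.exec, encodeBody, h1]
  | cons c B ih =>
    rw [List.flatMap_cons, List.append_assoc, runs_append,
      runs_writeClause c s h0 h1 (hB c List.mem_cons_self)]
    refine (ih ⟨s.reg, s.mem, s.inp, s.out ++ 1 :: encodeList encodeLit (c.map (litAt s))⟩ h0 h1
      fun c' hc' => hB c' (List.mem_cons_of_mem _ hc')).trans ?_
    simp [encodeBody]
    rfl

/-! ### Representing the state of the generator -/

/-- The machine state `s` represents the state `g` of the generator. Registers `0`, `1` and `2`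
contain the constants `0`, `1` and `4`, and register `3` the next variable; `m₀` is the part of the
memory at multiples of `4`, which does not change. -/
structure Rep (m₀ : ℕ → ℕ) (g : Gen) (s : RAMState) : Prop where
  zero : s.reg 0 = 0
  one : s.reg 1 = 1
  four : s.reg 2 = 4
  next : s.reg 3 = g.next
  cur : ∀ y, s.mem (cell y) = g.cur y
  mem : ∀ a, 4 ∣ a → s.mem a = m₀ a
  out : s.out = encodeBody g.out

namespace Rep

variable {m₀ : ℕ → ℕ} {g : Gen} {s : RAMState}

theorem of_eq (h : Rep m₀ g s) {s' : RAMState} (hr : ∀ i < 4, s'.reg i = s.reg i)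
    (hm : s'.mem = s.mem) (ho : s'.out = s.out) : Rep m₀ g s' where
  zero := by rw [hr 0 (by omega), h.zero]
  one := by rw [hr 1 (by omega), h.one]
  four := by rw [hr 2 (by omega), h.four]
  next := by rw [hr 3 (by omega), h.next]
  cur := by rw [hm]; exact h.cur
  mem := by rw [hm]; exact h.mem
  out := by rw [ho, h.out]

theorem emit (h : Rep m₀ g s) (B : List (List (ℕ × ℕ))) {E : List (List Lit)}
    (hB : ∀ c ∈ B, ∀ q ∈ c, s.reg q.1 ≤ 1) (hE : B.map (List.map (litAt s)) = E) :
    Rep m₀ (g.emit E) (runs (emitBlock B) s) := by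
  rw [runs_emitBlock B s h.zero h.one hB, hE]
  exact
  { zero := by simp [h.zero]
    one := by simp [h.one]
    four := by simp [h.four]
    next := by simp [h.next, Gen.emit]
    cur := h.cur
    mem := h.mem
    out := by simp [h.out, Gen.emit, encodeBody_append] }

theorem assign (h : Rep m₀ g s) {a : ℕ} {y : Lit} (ha : s.reg a = cell y) (ha' : a ≠ 22) :
    Rep m₀ (g.assign y) (runs [.sub 22 3 1, .store a 22] s) where
  zero := by simp [runs, Instr.exec, h.zero]
  one := by simp [runs, Instr.exec, h.one]
  four := by simp [runs, Instr.exec, h.four]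
  next := by simp [runs, Instr.exec, h.next, Gen.assign]
  cur := fun z => by
    by_cases hz : z = y
    · subst hz
      simp [runs, Instr.exec, h.next, Gen.assign, ha, ha', h.one]
    · have : cell z ≠ cell y := fun h => hz (cell_injective h)
      simp [runs, Instr.exec, Gen.assign, ha, ha', hz, this, h.cur]
  mem := fun b hb => by
    have : b ≠ cell y := fun h => not_dvd_cell y (h ▸ hb)
    simp [runs, Instr.exec, ha, ha', this, h.mem b hb]
  out := by simp [runs, Instr.exec, h.out, Gen.assign]

end Rep


/-! ### Instructions for the basic steps -/

/-- The instruction only changes registers from `4` on. -/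
def Instr.Scratch : Instr → Bool
  | .const a _ => 4 ≤ a
  | .copy a _ => 4 ≤ a
  | .add a _ _ => 4 ≤ a
  | .sub a _ _ => 4 ≤ a
  | .load a _ => 4 ≤ a
  | .read _ => false
  | .store _ _ => false
  | .write _ => false

/-- The register containing the truth value `b`. -/
def bitReg (b : Bool) : ℕ := if b then 1 else 0

/-- The part of the program for a gate; the input variable is in register `21`. -/
def gateInstrs (σ : Bool) : List Instr :=
  .sub 22 3 1 :: emitBlock [[(bitReg !σ, 3), (bitReg σ, 22)], [(bitReg !σ, 3), (bitReg σ, 21)],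
    [(bitReg σ, 3), (bitReg !σ, 22), (bitReg !σ, 21)]]

/-- The part of the program for `Gen.const`. -/
def constInstrs (b : Bool) : List Instr := emitBlock [[(bitReg b, 3)]]

/-- The part of the program for `Gen.equiv`; the variable is in register `17`. -/
def equivInstrs (b : Bool) : List Instr :=
  emitBlock [[(1, 3), (bitReg !b, 17)], [(0, 3), (bitReg b, 17)]]

/-- The part of the program for `Gen.assert`; the variable is in register `6` and the sign in
register `7`. -/
def assertInstrs : List Instr :=
  .sub 22 3 1 :: emitBlock [[(1, 3)], [(0, 3), (0, 22), (7, 6)]]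

/-- The part of the program for `Gen.assign`; the cell of the literal is in register `a`. -/
def assignInstrs (a : ℕ) : List Instr := [.sub 22 3 1, .store a 22]

namespace Rep

variable {m₀ : ℕ → ℕ} {g : Gen} {s : RAMState}

theorem scratch (h : Rep m₀ g s) (is : List Instr) (his : is.all Instr.Scratch = true) :
    Rep m₀ g (runs is s) := by
  induction is generalizing s with
  | nil => exact h
  | cons i is ih =>
    rw [List.all_cons, Bool.and_eq_true] at his
    refine ih ?_ his.2
    have hi := his.1
    cases i <;> simp only [Instr.Scratch, decide_eq_true_eq, Bool.false_eq_true] at hi <;>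
      exact h.of_eq (fun j hj => Function.update_of_ne (by omega) _ _) rfl rfl

theorem bit (h : Rep m₀ g s) (b : Bool) : s.reg (bitReg b) ≤ 1 ∧
    decide (s.reg (bitReg b) = 1) = b := by
  cases b <;> simp [bitReg, h.zero, h.one]

theorem const (h : Rep m₀ g s) (b : Bool) : Rep m₀ (g.const b) (runs (constInstrs b) s) := by
  refine h.emit _ ?_ ?_
  · simp [(h.bit b).1]
  · simp [litAt, (h.bit b).2, h.next]

theorem gate (h : Rep m₀ g s) (σ : Bool) {b : ℕ} (hb : s.reg 21 = b) :
    Rep m₀ (g.gate σ b) (runs (gateInstrs σ) s) := by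
  rw [gateInstrs, runs_cons]
  have h' := h.scratch [.sub 22 3 1] rfl
  refine Rep.emit (s := runs [.sub 22 3 1] s) h' _ ?_ ?_
  · simp only [List.mem_cons, List.not_mem_nil, or_false, forall_eq_or_imp, forall_eq]
    simp [(h'.bit σ).1, (h'.bit !σ).1]
  · have h1 : (runs [.sub 22 3 1] s).reg 22 = g.next - 1 := by
      simp [runs, Instr.exec, h.next, h.one]
    have h2 : (runs [.sub 22 3 1] s).reg 21 = b := by simp [runs, Instr.exec, hb]
    simp [litAt, (h'.bit σ).2, (h'.bit !σ).2, h'.next, h1, h2]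

theorem equiv (h : Rep m₀ g s) {v : ℕ} (b : Bool) (hv : s.reg 17 = v) :
    Rep m₀ (g.equiv ⟨v, b⟩) (runs (equivInstrs b) s) := by
  refine h.emit _ ?_ ?_
  · simp only [List.mem_cons, List.not_mem_nil, or_false, forall_eq_or_imp, forall_eq]
    simp [(h.bit b).1, (h.bit !b).1, h.zero, h.one]
  · simp [litAt, (h.bit b).2, (h.bit !b).2, h.next, h.zero, h.one, hv, Lit.compl]

theorem assert (h : Rep m₀ g s) {x : Lit} (h6 : s.reg 6 = x.var)
    (h7 : s.reg 7 = if x.pos then 1 else 0) : Rep m₀ (g.assert x) (runs assertInstrs s) := by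
  rw [assertInstrs, runs_cons]
  have h' := h.scratch [.sub 22 3 1] rfl
  refine Rep.emit (s := runs [.sub 22 3 1] s) h' _ ?_ ?_
  · have h3 : (runs [.sub 22 3 1] s).reg 7 ≤ 1 := by
      simp only [runs, Instr.exec, List.foldl_cons, List.foldl_nil]
      rw [Function.update_of_ne (by decide), h7]
      split_ifs <;> simp
    simp only [List.mem_cons, List.not_mem_nil, or_false, forall_eq_or_imp, forall_eq]
    simp [h'.zero, h'.one, h3]
  · have h1 : (runs [.sub 22 3 1] s).reg 22 = g.next - 1 := by
      simp [runs, Instr.exec, h.next, h.one]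
    have h2 : (runs [.sub 22 3 1] s).reg 6 = x.var := by simp [runs, Instr.exec, h6]
    have h3 : (runs [.sub 22 3 1] s).reg 7 = if x.pos then 1 else 0 := by
      simp [runs, Instr.exec, h7]
    simp [litAt, h'.next, h1, h2, h3, h'.zero, h'.one]

end Rep

theorem runs_reg_of_avoids {r : ℕ} (is : List Instr) (s : RAMState)
    (h : is.all (Instr.Avoids r) = true) : (runs is s).reg r = s.reg r := by
  induction is generalizing s with
  | nil => rfl
  | cons i is ih =>
    rw [List.all_cons, Bool.and_eq_true] at h
    rw [runs_cons, ih _ h.2, Instr.exec_reg_of_avoids h.1]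

/-! ### Unit-clause propagation by the program -/

/-- The number identifying the literal to be skipped in `Gen.chain`. -/
def code : Option Lit → ℕ
  | none => 0
  | some y => cell y

theorem cell_eq_code {z : Lit} {y : Option Lit} :
    cell z - code y + (code y - cell z) = 0 ↔ some z = y := by
  cases y with
  | none => simp [code, cell]
  | some y =>
    simp only [code, Option.some.injEq]
    exact ⟨fun h => cell_injective (by omega), fun h => by subst h; omega⟩

/-- The instructions fetching the cells of the next literal of a clause in `chainProg`, and
comparing the literal with the one to be skipped. -/
def chainFetch : List Instr :=
  [.add 19 19 2, .load 20 19, .add 19 19 2, .load 21 19, .add 19 19 2, .sub 22 20 17,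
    .sub 23 17 20, .add 22 22 23]

/-- The program for `Gen.chainStep`; register `19` contains the address of the current literal. -/
def chainBody : Prog :=
  .seq (.block chainFetch) (.seq (.cond 22 (.block (.load 21 21 :: gateInstrs true)) .skip)
    (.block [.load 18 19]))

/-- The program for `Gen.chain`; the address of the clause is in register `14`, and the code of the
literal to be skipped in register `17`. -/
def chainProg : Prog :=
  .seq (.block (constInstrs true)) (.seq (.block [.copy 19 14, .load 18 19]) (.loop 18 chainBody))

/-- Register `p` contains the address of the stored list `l`, which is followed by `rest`, and
register `r` the first token of it, which tells whether `l` is non-empty. -/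
structure Cursor {α : Type} (enc : α → List ℕ) (m₀ : ℕ → ℕ) (rest : List ℕ) (r p : ℕ) (l : List α)
    (s : RAMState) : Prop where
  stored : Stored m₀ (s.reg p) (encodeList enc l ++ rest)
  flag : s.reg r = m₀ (s.reg p)

theorem Cursor.exit {α : Type} {enc : α → List ℕ} {m₀ : ℕ → ℕ} {rest : List ℕ} {r p : ℕ}
    {s : RAMState} (h : Cursor enc m₀ rest r p [] s) : s.reg r = 0 ∧
      Stored m₀ (s.reg p) (0 :: rest) :=
  ⟨by rw [h.flag]; exact h.stored.2.1, h.stored⟩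

theorem stored_cons {α : Type} {enc : α → List ℕ} {m₀ : ℕ → ℕ} {rest : List ℕ} {p : ℕ} {a : α}
    {l : List α} : Stored m₀ p (encodeList enc (a :: l) ++ rest) ↔
      4 ∣ p ∧ m₀ p = 1 ∧ Stored m₀ (p + 4) (enc a ++ (encodeList enc l ++ rest)) := by
  simp [encodeList, Stored]

theorem Stored.dvd {m₀ : ℕ → ℕ} {α : Type} {enc : α → List ℕ} {rest : List ℕ} {p : ℕ} {l : List α}
    (h : Stored m₀ p (encodeList enc l ++ rest)) : 4 ∣ p := by
  cases l with
  | nil => exact h.1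
  | cons a l => exact h.1

theorem chainBody_spec {m₀ : ℕ → ℕ} {g : Gen} {s : RAMState} {y : Option Lit} {z : Lit}
    {l : List Lit} {rest : List ℕ} (h : Rep m₀ g s) (hy : s.reg 17 = code y)
    (hc : Cursor cellsOf m₀ rest 18 19 (z :: l) s) :
    Halts chainBody s 50 fun s' => Rep m₀ (g.chainStep y z) s' ∧ s'.reg 17 = code y ∧
      Cursor cellsOf m₀ rest 18 19 l s' := by
  obtain ⟨hp, -, hst⟩ := stored_cons.1 hc.stored
  obtain ⟨hp1, hz, hp2, hz', hst⟩ := hst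
  have hz : s.mem (s.reg 19 + 4) = cell z := (h.mem _ hp1).trans hz
  have hz' : s.mem (s.reg 19 + 4 + 4) = cell z.compl := (h.mem _ hp2).trans hz'
  have h1 := h.scratch chainFetch rfl
  refine Halts.block_seq _ (B := 42) ?_ le_rfl
  have e17 : (runs chainFetch s).reg 17 = code y :=
    (runs_reg_of_avoids _ _ rfl).trans hy
  have e19 : (runs chainFetch s).reg 19 = s.reg 19 + 4 + 4 + 4 := by
    simp [chainFetch, runs, Instr.exec, h.four]
  have e21 : (runs chainFetch s).reg 21 = cell z.compl := by
    simp [chainFetch, runs, Instr.exec, h.four, hz']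
  have e22 : (runs chainFetch s).reg 22 = cell z - code y + (code y - cell z) := by
    simp [chainFetch, runs, Instr.exec, h.four, hz, hy]
  generalize runs chainFetch s = s1 at *
  refine (Halts.cond (B := 40) (Q := Rep m₀ (g.chainStep y z)) (fun h22 => ?_)
    fun h22 => ?_).frame.seq (B' := 1) (fun s2 hs2 => ?_) le_rfl
  · have hne : some z ≠ y := fun h => h22 (by rw [e22]; exact cell_eq_code.2 h)
    rw [Gen.chainStep, if_neg hne]
    refine (Halts.block _ ?_).mono (by decide) fun _ h => h
    rw [runs_cons]
    refine Rep.gate (h1.scratch [.load 21 21] rfl) true ?_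
    simp [runs, Instr.exec, e21, h1.cur]
  · have heq : some z = y := cell_eq_code.1 (by rw [← e22]; exact h22)
    rw [Gen.chainStep, if_pos heq]
    exact (Halts.skip h1).mono (by decide) fun _ h => h
  · obtain ⟨hr, hf⟩ := hs2
    have f17 : s2.reg 17 = code y := (hf 17 rfl).trans e17
    have f19 : s2.reg 19 = s.reg 19 + 4 + 4 + 4 := (hf 19 rfl).trans e19
    refine Halts.block _ ⟨hr.scratch _ rfl, (runs_reg_of_avoids _ _ rfl).trans f17, ?_, ?_⟩
    · rw [runs_reg_of_avoids _ _ rfl, f19]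
      exact hst
    · have := hr.mem _ hst.dvd
      simp [runs, Instr.exec, f19, this]

theorem chainProg_spec {m₀ : ℕ → ℕ} {g : Gen} {s : RAMState} {y : Option Lit} {c : List Lit}
    {rest : List ℕ} (h : Rep m₀ g s) (hy : s.reg 17 = code y)
    (hst : Stored m₀ (s.reg 14) (encodeList cellsOf c ++ rest)) :
    Halts chainProg s (60 * (c.length + 1)) fun s' => Rep m₀ (g.chain y c) s' ∧
      Stored m₀ (s'.reg 19) (0 :: rest) := by
  refine Halts.block_seq _ (B := 51 * c.length + 3) ?_ (by
    rw [show (constInstrs true).length = 6 from rfl]; omega)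
  have h1 := h.const true
  have e14 : (runs (constInstrs true) s).reg 14 = s.reg 14 := runs_reg_of_avoids _ _ rfl
  have e17 : (runs (constInstrs true) s).reg 17 = code y := (runs_reg_of_avoids _ _ rfl).trans hy
  generalize runs (constInstrs true) s = s1 at *
  refine Halts.block_seq _ (B := 51 * c.length + 1) ?_ (by
    simp only [List.length_cons, List.length_nil]; omega)
  refine (Halts.loop (fun (l : List Lit) s' => ∃ g', Rep m₀ g' s' ∧
    l.foldl (Gen.chainStep y) g' = g.chain y c ∧ s'.reg 17 = code y ∧
    Cursor cellsOf m₀ rest 18 19 l s') (fun _ => 50) ?_ ?_ c ?_).mono ?_ ?_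
  · rintro z l s' ⟨g', hr, hg, h17, hc⟩
    refine ⟨by rw [hc.flag, hc.stored.2.1]; exact one_ne_zero, ?_⟩
    exact (chainBody_spec hr h17 hc).mono le_rfl fun s2 hs2 => ⟨_, hs2.1, hg, hs2.2⟩
  · rintro s' ⟨g', hr, hg, h17, hc⟩
    exact hc.exit.1
  · refine ⟨g.const true, h1.scratch _ rfl, rfl, (runs_reg_of_avoids _ _ rfl).trans e17, ?_, ?_⟩
    · simpa [runs, Instr.exec, e14] using hst
    · simpa [runs, Instr.exec, e14] using h1.mem _ hst.dvd
  · simp; omega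
  · rintro s' ⟨g', hr, hg, h17, hc⟩
    simp only [List.foldl_nil] at hg
    exact ⟨hg ▸ hr, hc.exit.2⟩


/-- The program for `Gen.occStep`: register `14` contains the address of the clause, and register
`16` the address of the current literal in it. -/
def occBody : Prog :=
  .seq (.block [.add 16 16 2, .load 17 16]) (.seq chainProg
    (.seq (.block (.load 21 17 :: gateInstrs false)) (.seq (.block (assignInstrs 17))
      (.block [.add 16 16 2, .add 16 16 2, .load 15 16]))))

/-- The program for `Gen.clauseStep`. -/
def clauseBody : Prog :=
  .seq (.block [.add 13 13 2, .copy 14 13, .copy 16 13, .load 15 16]) (.seq (.loop 15 occBody)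
    (.block [.add 13 16 2, .load 12 13]))

/-- The program for `Gen.round`; register `5` contains the address of the clauses. -/
def roundProg : Prog := .seq (.block [.copy 13 5, .load 12 13]) (.loop 12 clauseBody)

/-- The program for the rounds of unit-clause propagation, their number being in register `4`. -/
def roundsProg : Prog :=
  .seq (.block [.copy 11 4]) (.loop 11 (.seq roundProg (.block [.sub 11 11 1])))

/-- The program for `Gen.assertStep`. -/
def assertBody : Prog :=
  .seq (.block [.add 13 13 2, .copy 14 13, .const 17 0]) (.seq chainProg
    (.seq (.block assertInstrs) (.block [.add 13 19 2, .load 12 13])))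

/-- The program for `Gen.assertStep` with all clauses. -/
def assertsProg : Prog := .seq (.block [.copy 13 5, .load 12 13]) (.loop 12 assertBody)

section

variable {m₀ : ℕ → ℕ} {g : Gen} {s : RAMState} {rest : List ℕ}

theorem occBody_spec {c l : List Lit} {y : Lit} {rest' : List ℕ} (h : Rep m₀ g s)
    (hst : Stored m₀ (s.reg 14) (encodeList cellsOf c ++ rest'))
    (hc : Cursor cellsOf m₀ rest 15 16 (y :: l) s) :
    Halts occBody s (60 * (c.length + 1) + 50) fun s' => Rep m₀ (g.occStep c y) s' ∧
      s'.reg 14 = s.reg 14 ∧ Cursor cellsOf m₀ rest 15 16 l s' := by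
  obtain ⟨hp, -, hst'⟩ := stored_cons.1 hc.stored
  obtain ⟨hp1, hz, hp2, -, hst'⟩ := hst'
  have hz : s.mem (s.reg 16 + 4) = cell y := (h.mem _ hp1).trans hz
  refine Halts.block_seq _ (B := 60 * (c.length + 1) + 48) ?_ (by
    simp only [List.length_cons, List.length_nil]; omega)
  have h1 := h.scratch [.add 16 16 2, .load 17 16] rfl
  have e14 : (runs [.add 16 16 2, .load 17 16] s).reg 14 = s.reg 14 :=
    runs_reg_of_avoids _ _ rfl
  have e16 : (runs [.add 16 16 2, .load 17 16] s).reg 16 = s.reg 16 + 4 := by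
    simp [runs, Instr.exec, h.four]
  have e17 : (runs [.add 16 16 2, .load 17 16] s).reg 17 = cell y := by
    simp [runs, Instr.exec, h.four, hz]
  generalize runs [.add 16 16 2, .load 17 16] s = s1 at *
  refine (chainProg_spec (y := some y) (rest := rest') h1 e17 (by rw [e14]; exact hst)).frame.seq (B' := 48)
    (fun s2 ⟨⟨h2, _⟩, f2⟩ => ?_) le_rfl
  have e17 := (f2 17 rfl).trans e17
  have e16 := (f2 16 rfl).trans e16
  have e14 := (f2 14 rfl).trans e14
  refine Halts.block_seq _ (B := 10) ?_ (by decide)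
  have h3 : Rep m₀ ((g.chain (some y) c).gate false (g.cur y))
      (runs (.load 21 17 :: gateInstrs false) s2) := by
    rw [runs_cons]
    refine Rep.gate (h2.scratch [.load 21 17] rfl) false ?_
    simp [runs, Instr.exec, e17, h2.cur, Gen.chain_cur]
  have e14 := (runs_reg_of_avoids (.load 21 17 :: gateInstrs false) s2 rfl).trans e14
  have e16 := (runs_reg_of_avoids (.load 21 17 :: gateInstrs false) s2 rfl).trans e16
  have e17 := (runs_reg_of_avoids (.load 21 17 :: gateInstrs false) s2 rfl).trans e17
  generalize runs (.load 21 17 :: gateInstrs false) s2 = s3 at *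
  refine Halts.block_seq _ (B := 3) ?_ (by decide)
  have h4 := h3.assign e17 (by decide)
  have e14 := (runs_reg_of_avoids (assignInstrs 17) s3 rfl).trans e14
  have e16 := (runs_reg_of_avoids (assignInstrs 17) s3 rfl).trans e16
  change Rep m₀ _ (runs (assignInstrs 17) s3) at h4
  generalize runs (assignInstrs 17) s3 = s4 at *
  have e : (runs [.add 16 16 2, .add 16 16 2, .load 15 16] s4).reg 16 = s.reg 16 + 4 + 4 + 4 := by
    simp [runs, Instr.exec, h4.four, e16]
  refine Halts.block _ ⟨h4.scratch _ rfl, (runs_reg_of_avoids _ _ rfl).trans e14, ?_, ?_⟩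
  · rw [e]; exact hst'
  · rw [e, ← h4.mem _ hst'.dvd]
    simp [runs, Instr.exec, h4.four, e16]

theorem clauseBody_spec {c : List Lit} {l : List (List Lit)} (h : Rep m₀ g s)
    (hc : Cursor (encodeList cellsOf) m₀ rest 12 13 (c :: l) s) :
    Halts clauseBody s (c.length * (60 * (c.length + 1) + 51) + 7) fun s' =>
      Rep m₀ (g.clauseStep c) s' ∧ Cursor (encodeList cellsOf) m₀ rest 12 13 l s' := by
  obtain ⟨hp, -, hst⟩ := stored_cons.1 hc.stored
  refine Halts.block_seq _ (B := c.length * (60 * (c.length + 1) + 51) + 3) ?_ (by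
    simp only [List.length_cons, List.length_nil]; omega)
  have h1 := h.scratch [.add 13 13 2, .copy 14 13, .copy 16 13, .load 15 16] rfl
  have e14 : (runs [.add 13 13 2, .copy 14 13, .copy 16 13, .load 15 16] s).reg 14 =
      s.reg 13 + 4 := by simp [runs, Instr.exec, h.four]
  have e16 : (runs [.add 13 13 2, .copy 14 13, .copy 16 13, .load 15 16] s).reg 16 =
      s.reg 13 + 4 := by simp [runs, Instr.exec, h.four]
  have e15 : (runs [.add 13 13 2, .copy 14 13, .copy 16 13, .load 15 16] s).reg 15 =
      m₀ (s.reg 13 + 4) := by simp [runs, Instr.exec, h.four, h.mem _ hst.dvd]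
  generalize runs [.add 13 13 2, .copy 14 13, .copy 16 13, .load 15 16] s = s1 at *
  refine (Halts.loop (fun (k : List Lit) s' => ∃ g', Rep m₀ g' s' ∧
    k.foldl (Gen.occStep c) g' = g.clauseStep c ∧ s'.reg 14 = s.reg 13 + 4 ∧
    Cursor cellsOf m₀ (encodeList (encodeList cellsOf) l ++ rest) 15 16 k s')
    (fun _ => 60 * (c.length + 1) + 50) ?_ ?_ c ?_).seq (B' := 2) ?_ ?_
  · rintro y k s' ⟨g', hr, hg, h14, hcur⟩
    refine ⟨by rw [hcur.flag, hcur.stored.2.1]; exact one_ne_zero, ?_⟩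
    exact (occBody_spec hr (by rw [h14]; exact hst) hcur).mono le_rfl fun s2 hs2 =>
      ⟨_, hs2.1, hg, hs2.2.1.trans h14, hs2.2.2⟩
  · rintro s' ⟨g', hr, hg, h14, hcur⟩
    exact hcur.exit.1
  · refine ⟨g, h1, rfl, e14, ?_, ?_⟩
    · rw [e16]; exact hst
    · rw [e16, e15]
  · rintro s' ⟨g', hr, hg, h14, hcur⟩
    simp only [List.foldl_nil] at hg
    have hx := hcur.exit.2.2.2
    have e : (runs [.add 13 16 2, .load 12 13] s').reg 13 = s'.reg 16 + 4 := by
      simp [runs, Instr.exec, hr.four]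
    refine Halts.block _ ⟨hg ▸ hr.scratch _ rfl, ?_, ?_⟩
    · rw [e]; exact hx
    · rw [e, ← hr.mem _ hx.dvd]
      simp [runs, Instr.exec, hr.four]
  · simp

/-- A bound for the number of steps of one round of unit-clause propagation. -/
def roundCost (L : List (List Lit)) : ℕ :=
  (L.map fun c => c.length * (60 * (c.length + 1) + 51) + 7 + 1).sum + 3

theorem roundProg_spec {L : List (List Lit)} (h : Rep m₀ g s)
    (hst : Stored m₀ (s.reg 5) (encodeList (encodeList cellsOf) L ++ rest)) :
    Halts roundProg s (roundCost L) (Rep m₀ (g.round L)) := by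
  refine Halts.block_seq _ (Halts.loop (fun (l : List (List Lit)) s' => ∃ g', Rep m₀ g' s' ∧
    l.foldl Gen.clauseStep g' = g.round L ∧ Cursor (encodeList cellsOf) m₀ rest 12 13 l s')
    (fun c => c.length * (60 * (c.length + 1) + 51) + 7) ?_ ?_ L ?_ |>.mono le_rfl ?_) ?_
  · rintro c l s' ⟨g', hr, hg, hcur⟩
    refine ⟨by rw [hcur.flag, hcur.stored.2.1]; exact one_ne_zero, ?_⟩
    exact (clauseBody_spec hr hcur).mono le_rfl fun s2 hs2 => ⟨_, hs2.1, hg, hs2.2⟩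
  · rintro s' ⟨g', hr, hg, hcur⟩
    exact hcur.exit.1
  · refine ⟨g, h.scratch _ rfl, rfl, ?_, ?_⟩
    · simpa [runs, Instr.exec] using hst
    · simpa [runs, Instr.exec] using h.mem _ hst.dvd
  · rintro s' ⟨g', hr, hg, hcur⟩
    simp only [List.foldl_nil] at hg
    exact hg ▸ hr
  · simp only [roundCost, List.length_cons, List.length_nil]
    omega

theorem roundsProg_spec {L : List (List Lit)} {R : ℕ} (h : Rep m₀ g s) (hR : s.reg 4 = R)
    (hst : Stored m₀ (s.reg 5) (encodeList (encodeList cellsOf) L ++ rest)) :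
    Halts roundsProg s (R * (roundCost L + 1 + 1) + 2) (Rep m₀ ((Gen.round L)^[R] g)) := by
  refine Halts.block_seq _ (Halts.loop (fun (l : List Unit) s' => ∃ g', Rep m₀ g' s' ∧
    (Gen.round L)^[l.length] g' = (Gen.round L)^[R] g ∧ s'.reg 11 = l.length ∧
    s'.reg 5 = s.reg 5)
    (fun _ => roundCost L + 1) ?_ ?_ (List.replicate R ()) ?_ |>.mono le_rfl ?_) ?_
  · rintro _ l s' ⟨g', hr, hg, h11, h5⟩
    refine ⟨by simp [h11], ?_⟩
    refine (roundProg_spec hr (by rw [h5]; exact hst)).frame.seq (fun s2 ⟨h2, f2⟩ =>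
      Halts.block _ ⟨_, h2.scratch _ rfl, hg, ?_, ?_⟩) le_rfl
    · have := (f2 11 rfl).trans h11
      simp [runs, Instr.exec, this, h2.one]
    · exact (runs_reg_of_avoids _ _ rfl).trans ((f2 5 rfl).trans h5)
  · rintro s' ⟨g', hr, hg, h11, h5⟩
    exact h11
  · exact ⟨g, h.scratch _ rfl, by simp, by simp [runs, Instr.exec, hR],
      runs_reg_of_avoids _ _ rfl⟩
  · rintro s' ⟨g', hr, hg, -⟩
    simp only [List.length_nil, Function.iterate_zero, id] at hg
    exact hg ▸ hr
  · simp only [List.map_const', List.sum_replicate, List.length_replicate, smul_eq_mul,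
      List.length_cons, List.length_nil]
    omega

theorem assertBody_spec {c : List Lit} {l : List (List Lit)} {x : Lit} (h : Rep m₀ g s)
    (h6 : s.reg 6 = x.var) (h7 : s.reg 7 = if x.pos then 1 else 0)
    (hc : Cursor (encodeList cellsOf) m₀ rest 12 13 (c :: l) s) :
    Halts assertBody s (60 * (c.length + 1) + 30) fun s' =>
      Rep m₀ (g.assertStep x c) s' ∧ Cursor (encodeList cellsOf) m₀ rest 12 13 l s' := by
  obtain ⟨hp, -, hst⟩ := stored_cons.1 hc.stored
  refine Halts.block_seq _ (B := 60 * (c.length + 1) + 27) ?_ (by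
    simp only [List.length_cons, List.length_nil]; omega)
  have h1 := h.scratch [.add 13 13 2, .copy 14 13, .const 17 0] rfl
  have e14 : (runs [.add 13 13 2, .copy 14 13, .const 17 0] s).reg 14 = s.reg 13 + 4 := by
    simp [runs, Instr.exec, h.four]
  have e17 : (runs [.add 13 13 2, .copy 14 13, .const 17 0] s).reg 17 = code none := by
    simp [runs, Instr.exec, code]
  have e6 := (runs_reg_of_avoids [.add 13 13 2, .copy 14 13, .const 17 0] s rfl).trans h6
  have e7 := (runs_reg_of_avoids [.add 13 13 2, .copy 14 13, .const 17 0] s rfl).trans h7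
  generalize runs [.add 13 13 2, .copy 14 13, .const 17 0] s = s1 at *
  refine (chainProg_spec (rest := encodeList (encodeList cellsOf) l ++ rest) h1 e17
    (by rw [e14]; exact hst)).frame.seq (B' := 27)
    (fun s2 ⟨⟨h2, hx⟩, f2⟩ => ?_) le_rfl
  refine Halts.block_seq _ (B := 2) ?_ (by decide)
  have h3 := h2.assert ((f2 6 rfl).trans e6) ((f2 7 rfl).trans e7)
  have e19 := runs_reg_of_avoids (r := 19) assertInstrs s2 rfl
  generalize runs assertInstrs s2 = s3 at *
  have hx := hx.2.2
  have e : (runs [.add 13 19 2, .load 12 13] s3).reg 13 = s2.reg 19 + 4 := by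
    simp [runs, Instr.exec, h3.four, e19]
  refine Halts.block _ ⟨h3.scratch _ rfl, ?_, ?_⟩
  · rw [e]; exact hx
  · rw [e, ← h3.mem _ hx.dvd]
    simp [runs, Instr.exec, h3.four, e19]

/-- A bound for the number of steps of a loop over the clauses that processes each literal once. -/
def passCost (L : List (List Lit)) : ℕ :=
  (L.map fun c => 60 * (c.length + 1) + 30 + 1).sum + 3

theorem assertsProg_spec {L : List (List Lit)} {x : Lit} (h : Rep m₀ g s)
    (h6 : s.reg 6 = x.var) (h7 : s.reg 7 = if x.pos then 1 else 0)
    (hst : Stored m₀ (s.reg 5) (encodeList (encodeList cellsOf) L ++ rest)) :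
    Halts assertsProg s (passCost L) (Rep m₀ (L.foldl (Gen.assertStep x) g)) := by
  refine Halts.block_seq _ (Halts.loop (fun (l : List (List Lit)) s' => ∃ g', Rep m₀ g' s' ∧
    l.foldl (Gen.assertStep x) g' = L.foldl (Gen.assertStep x) g ∧ s'.reg 6 = s.reg 6 ∧
    s'.reg 7 = s.reg 7 ∧ Cursor (encodeList cellsOf) m₀ rest 12 13 l s')
    (fun c => 60 * (c.length + 1) + 30) ?_ ?_ L ?_ |>.mono le_rfl ?_) ?_
  · rintro c l s' ⟨g', hr, hg, e6, e7, hcur⟩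
    refine ⟨by rw [hcur.flag, hcur.stored.2.1]; exact one_ne_zero, ?_⟩
    exact (assertBody_spec hr (e6.trans h6) (e7.trans h7) hcur).frame.mono le_rfl
      fun s2 ⟨hs2, f2⟩ => ⟨_, hs2.1, hg, (f2 6 rfl).trans e6, (f2 7 rfl).trans e7, hs2.2⟩
  · rintro s' ⟨g', hr, hg, -, -, hcur⟩
    exact hcur.exit.1
  · refine ⟨g, h.scratch _ rfl, rfl, runs_reg_of_avoids _ _ rfl, runs_reg_of_avoids _ _ rfl, ?_, ?_⟩
    · simpa [runs, Instr.exec] using hst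
    · simpa [runs, Instr.exec] using h.mem _ hst.dvd
  · rintro s' ⟨g', hr, hg, -⟩
    simp only [List.foldl_nil] at hg
    exact hg ▸ hr
  · simp only [passCost, List.length_cons, List.length_nil]
    omega

/-! ### Initialisation, and the program for one copy -/

/-- The program for `Gen.initOcc`. -/
def initOccBody : Prog :=
  .seq (.block [.add 13 13 2, .load 17 13]) (.seq (.block (constInstrs false))
    (.seq (.block (assignInstrs 17)) (.seq (.block [.add 13 13 2, .load 17 13])
      (.seq (.block (constInstrs false)) (.seq (.block (assignInstrs 17))
        (.block [.add 13 13 2, .load 15 13]))))))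

/-- The program for `Gen.initClause`. -/
def initClauseBody : Prog :=
  .seq (.block [.add 13 13 2, .load 15 13]) (.seq (.loop 15 initOccBody)
    (.block [.add 13 13 2, .load 12 13]))

/-- The program for `Gen.initClause` with all clauses. -/
def initClausesProg : Prog := .seq (.block [.copy 13 5, .load 12 13]) (.loop 12 initClauseBody)

/-- The instructions fetching the next variable `v` in register `17`, and the cells of the literals
over `v` in registers `20` and `21`. -/
def varFetch : List Instr :=
  [.add 16 16 2, .load 17 16, .add 20 17 17, .add 20 20 20, .add 21 20 1, .add 20 21 1]

/-- The program for `Gen.initVar`. -/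
def initVarBody : Prog :=
  .seq (.block varFetch) (.seq (.block (equivInstrs true))
    (.seq (.block (assignInstrs 20)) (.seq (.block (equivInstrs false))
      (.seq (.block (assignInstrs 21)) (.block [.add 16 16 2, .load 15 16])))))

/-- The program for `Gen.initVar` with the list of variables, which is stored at address `0`. -/
def initVarsProg : Prog := .seq (.block [.copy 16 0, .load 15 16]) (.loop 15 initVarBody)

/-- The program for the assumption that `x` is false; register `20` is the cell of `x.compl`. -/
def assumeProg : Prog :=
  .seq (.block (constInstrs true)) (.seq
    (.block [.add 20 6 6, .add 20 20 20, .add 20 20 1, .sub 21 1 7, .add 20 20 21])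
    (.block (assignInstrs 20)))

/-- The program for `Gen.copy`; registers `6` and `7` contain the variable and the sign of `x`. -/
def copyProg : Prog :=
  .seq initClausesProg (.seq initVarsProg (.seq assumeProg (.seq roundsProg assertsProg)))

theorem initOccBody_spec {l : List Lit} {y : Lit} (h : Rep m₀ g s)
    (hc : Cursor cellsOf m₀ rest 15 13 (y :: l) s) :
    Halts initOccBody s 22 fun s' => Rep m₀ (g.initOcc y) s' ∧
      Cursor cellsOf m₀ rest 15 13 l s' := by
  obtain ⟨hp, -, hst⟩ := stored_cons.1 hc.stored
  obtain ⟨hp1, hz, hp2, hz', hst⟩ := hst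
  have hz : s.mem (s.reg 13 + 4) = cell y := (h.mem _ hp1).trans hz
  -- Each half fetches a cell and stores the new variable there.
  have half : ∀ {s : RAMState} {g : Gen} {p : ℕ} {z : Lit}, Rep m₀ g s → s.reg 13 = p →
      4 ∣ p + 4 → m₀ (p + 4) = cell z → ∀ {P : Prog} {B : ℕ} {Q : RAMState → Prop},
      (∀ s', Rep m₀ ((g.const false).assign z) s' → s'.reg 13 = p + 4 → Halts P s' B Q) →
      Halts (.seq (.block [.add 13 13 2, .load 17 13]) (.seq (.block (constInstrs false))
        (.seq (.block (assignInstrs 17)) P))) s (B + 10) Q := by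
    intro s g p z h h13 hp hz P B Q hP
    have hz : s.mem (p + 4) = cell z := (h.mem _ hp).trans hz
    refine Halts.block_seq _ (B := B + 8) (Halts.block_seq _ (B := B + 2)
      (Halts.block_seq _ (B := B) (hP _ ?_ ?_) ?_) ?_) ?_
    · refine ((h.scratch _ rfl).const false).assign ?_ (by decide)
      rw [runs_reg_of_avoids _ _ rfl]
      simp [runs, Instr.exec, h.four, h13, hz]
    · rw [runs_reg_of_avoids _ _ rfl, runs_reg_of_avoids _ _ rfl]
      simp [runs, Instr.exec, h.four, h13]
    · simp only [assignInstrs, List.length_cons, List.length_nil]; omega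
    · rw [show (constInstrs false).length = 6 from rfl]; omega
    · simp only [List.length_cons, List.length_nil]; omega
  refine half h rfl hp1 (by rw [← hz, h.mem _ hp1]) fun s2 h2 e2 => ?_
  refine half h2 e2 hp2 hz' fun s3 h3 e3 => ?_
  have e : (runs [.add 13 13 2, .load 15 13] s3).reg 13 = s.reg 13 + 4 + 4 + 4 := by
    simp [runs, Instr.exec, h3.four, e3]
  refine Halts.block _ ⟨h3.scratch _ rfl, ?_, ?_⟩
  · rw [e]; exact hst
  · rw [e, ← h3.mem _ hst.dvd]
    simp [runs, Instr.exec, h3.four, e3]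

theorem initClauseBody_spec {c : List Lit} {l : List (List Lit)} (h : Rep m₀ g s)
    (hc : Cursor (encodeList cellsOf) m₀ rest 12 13 (c :: l) s) :
    Halts initClauseBody s (60 * (c.length + 1) + 30) fun s' =>
      Rep m₀ (g.initClause c) s' ∧ Cursor (encodeList cellsOf) m₀ rest 12 13 l s' := by
  obtain ⟨hp, -, hst⟩ := stored_cons.1 hc.stored
  refine Halts.block_seq _ (B := 23 * c.length + 3) ?_ (by
    simp only [List.length_cons, List.length_nil]; omega)
  refine (Halts.loop (fun (k : List Lit) s' => ∃ g', Rep m₀ g' s' ∧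
    k.foldl Gen.initOcc g' = g.initClause c ∧
    Cursor cellsOf m₀ (encodeList (encodeList cellsOf) l ++ rest) 15 13 k s')
    (fun _ => 22) ?_ ?_ c ?_).seq (B' := 2) ?_ ?_
  · rintro y k s' ⟨g', hr, hg, hcur⟩
    refine ⟨by rw [hcur.flag, hcur.stored.2.1]; exact one_ne_zero, ?_⟩
    exact (initOccBody_spec hr hcur).mono le_rfl fun s2 hs2 => ⟨_, hs2.1, hg, hs2.2⟩
  · rintro s' ⟨g', hr, hg, hcur⟩
    exact hcur.exit.1
  · refine ⟨g, h.scratch _ rfl, rfl, ?_, ?_⟩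
    · simpa [runs, Instr.exec, h.four] using hst
    · simpa [runs, Instr.exec, h.four] using h.mem _ hst.dvd
  · rintro s' ⟨g', hr, hg, hcur⟩
    simp only [List.foldl_nil] at hg
    have hx := hcur.exit.2.2.2
    have e : (runs [.add 13 13 2, .load 12 13] s').reg 13 = s'.reg 13 + 4 := by
      simp [runs, Instr.exec, hr.four]
    refine Halts.block _ ⟨hg ▸ hr.scratch _ rfl, ?_, ?_⟩
    · rw [e]; exact hx
    · rw [e, ← hr.mem _ hx.dvd]
      simp [runs, Instr.exec, hr.four]
  · simp [mul_comm]

theorem initClausesProg_spec {L : List (List Lit)} (h : Rep m₀ g s)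
    (hst : Stored m₀ (s.reg 5) (encodeList (encodeList cellsOf) L ++ rest)) :
    Halts initClausesProg s (passCost L) (Rep m₀ (L.foldl Gen.initClause g)) := by
  refine Halts.block_seq _ (Halts.loop (fun (l : List (List Lit)) s' => ∃ g', Rep m₀ g' s' ∧
    l.foldl Gen.initClause g' = L.foldl Gen.initClause g ∧
    Cursor (encodeList cellsOf) m₀ rest 12 13 l s')
    (fun c => 60 * (c.length + 1) + 30) ?_ ?_ L ?_ |>.mono le_rfl ?_) ?_
  · rintro c l s' ⟨g', hr, hg, hcur⟩
    refine ⟨by rw [hcur.flag, hcur.stored.2.1]; exact one_ne_zero, ?_⟩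
    exact (initClauseBody_spec hr hcur).mono le_rfl fun s2 hs2 => ⟨_, hs2.1, hg, hs2.2⟩
  · rintro s' ⟨g', hr, hg, hcur⟩
    exact hcur.exit.1
  · refine ⟨g, h.scratch _ rfl, rfl, ?_, ?_⟩
    · simpa [runs, Instr.exec] using hst
    · simpa [runs, Instr.exec] using h.mem _ hst.dvd
  · rintro s' ⟨g', hr, hg, hcur⟩
    simp only [List.foldl_nil] at hg
    exact hg ▸ hr
  · simp only [passCost, List.length_cons, List.length_nil]
    omega

theorem initVarBody_spec {v : ℕ} {l : List ℕ} (h : Rep m₀ g s)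
    (hc : Cursor (fun v => [v]) m₀ rest 15 16 (v :: l) s) :
    Halts initVarBody s 60 fun s' => Rep m₀ (g.initVar v) s' ∧
      Cursor (fun v => [v]) m₀ rest 15 16 l s' := by
  obtain ⟨hp, -, hst⟩ := stored_cons.1 hc.stored
  obtain ⟨hp1, hz, hst⟩ := hst
  have hz : s.mem (s.reg 16 + 4) = v := (h.mem _ hp1).trans hz
  refine Halts.block_seq _ (B := 54) ?_ le_rfl
  have h1 := h.scratch varFetch rfl
  have e16 : (runs varFetch s).reg 16 = s.reg 16 + 4 := by
    simp [varFetch, runs, Instr.exec, h.four]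
  have e17 : (runs varFetch s).reg 17 = v := by
    simp [varFetch, runs, Instr.exec, h.four, hz]
  have e20 : (runs varFetch s).reg 20 = cell ⟨v, true⟩ := by
    simp [varFetch, runs, Instr.exec, h.four, h.one, hz, cell]; omega
  have e21 : (runs varFetch s).reg 21 = cell ⟨v, false⟩ := by
    simp [varFetch, runs, Instr.exec, h.four, h.one, hz, cell]; omega
  generalize runs varFetch s = s1 at *
  refine Halts.block_seq _ (B := 37) ?_ (by decide)
  have h2 := h1.equiv true e17
  have e16 := (runs_reg_of_avoids (equivInstrs true) s1 rfl).trans e16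
  have e17 := (runs_reg_of_avoids (equivInstrs true) s1 rfl).trans e17
  have e20 := (runs_reg_of_avoids (equivInstrs true) s1 rfl).trans e20
  have e21 := (runs_reg_of_avoids (equivInstrs true) s1 rfl).trans e21
  generalize runs (equivInstrs true) s1 = s2 at *
  refine Halts.block_seq _ (B := 35) ?_ (by decide)
  have h3 : Rep m₀ _ (runs (assignInstrs 20) s2) := h2.assign e20 (by decide)
  have e16 := (runs_reg_of_avoids (assignInstrs 20) s2 rfl).trans e16
  have e17 := (runs_reg_of_avoids (assignInstrs 20) s2 rfl).trans e17
  have e21 := (runs_reg_of_avoids (assignInstrs 20) s2 rfl).trans e21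
  generalize runs (assignInstrs 20) s2 = s3 at *
  refine Halts.block_seq _ (B := 18) ?_ (by decide)
  have h4 := h3.equiv false e17
  have e16 := (runs_reg_of_avoids (equivInstrs false) s3 rfl).trans e16
  have e21 := (runs_reg_of_avoids (equivInstrs false) s3 rfl).trans e21
  generalize runs (equivInstrs false) s3 = s4 at *
  refine Halts.block_seq _ (B := 2) ?_ (by decide)
  have h5 : Rep m₀ _ (runs (assignInstrs 21) s4) := h4.assign e21 (by decide)
  have e16 := (runs_reg_of_avoids (assignInstrs 21) s4 rfl).trans e16
  generalize runs (assignInstrs 21) s4 = s5 at *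
  have e : (runs [.add 16 16 2, .load 15 16] s5).reg 16 = s.reg 16 + 4 + 4 := by
    simp [runs, Instr.exec, h5.four, e16]
  refine Halts.block _ ⟨h5.scratch _ rfl, ?_, ?_⟩
  · rw [e]; exact hst
  · rw [e, ← h5.mem _ hst.dvd]
    simp [runs, Instr.exec, h5.four, e16]

theorem initVarsProg_spec {vs : List ℕ} (h : Rep m₀ g s)
    (hst : Stored m₀ 0 (encodeVars vs ++ rest)) :
    Halts initVarsProg s (61 * vs.length + 3) (Rep m₀ (vs.foldl Gen.initVar g)) := by
  refine Halts.block_seq _ (Halts.loop (fun (l : List ℕ) s' => ∃ g', Rep m₀ g' s' ∧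
    l.foldl Gen.initVar g' = vs.foldl Gen.initVar g ∧
    Cursor (fun v => [v]) m₀ rest 15 16 l s')
    (fun c => 60) ?_ ?_ vs ?_ |>.mono le_rfl ?_) ?_
  · rintro c l s' ⟨g', hr, hg, hcur⟩
    refine ⟨by rw [hcur.flag, hcur.stored.2.1]; exact one_ne_zero, ?_⟩
    exact (initVarBody_spec hr hcur).mono le_rfl fun s2 hs2 => ⟨_, hs2.1, hg, hs2.2⟩
  · rintro s' ⟨g', hr, hg, hcur⟩
    exact hcur.exit.1
  · refine ⟨g, h.scratch _ rfl, rfl, ?_, ?_⟩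
    · simpa [runs, Instr.exec, h.zero, encodeVars] using hst
    · simpa [runs, Instr.exec, h.zero] using h.mem _ hst.dvd
  · rintro s' ⟨g', hr, hg, hcur⟩
    simp only [List.foldl_nil] at hg
    exact hg ▸ hr
  · simp only [List.map_const', List.sum_replicate, smul_eq_mul, List.length_cons,
      List.length_nil]
    omega

theorem assumeProg_spec {x : Lit} (h : Rep m₀ g s) (h6 : s.reg 6 = x.var)
    (h7 : s.reg 7 = if x.pos then 1 else 0) :
    Halts assumeProg s 13 (Rep m₀ ((g.const true).assign x.compl)) := by
  refine Halts.block_seq _ (B := 7) ?_ (by decide)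
  have h1 := h.const true
  have e6 := (runs_reg_of_avoids (constInstrs true) s rfl).trans h6
  have e7 := (runs_reg_of_avoids (constInstrs true) s rfl).trans h7
  generalize runs (constInstrs true) s = s1 at *
  refine Halts.block_seq _ (B := 2) ?_ (by decide)
  refine Halts.block _ ((h1.scratch _ rfl).assign ?_ (by decide))
  have h0 := h1.one
  obtain ⟨v, b⟩ := x
  cases b <;> simp [runs, Instr.exec, e6, e7, h0, cell, Lit.compl] at e7 ⊢ <;> omega

/-- A bound for the number of steps of `copyProg`. -/
def copyCost (L : List (List Lit)) (vs : List ℕ) (R : ℕ) : ℕ :=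
  passCost L + (61 * vs.length + 3) + 13 + (R * (roundCost L + 1 + 1) + 2) + passCost L

theorem copyProg_spec {L : List (List Lit)} {vs : List ℕ} {R : ℕ} {x : Lit} {rest' : List ℕ}
    (h : Rep m₀ g s) (h6 : s.reg 6 = x.var) (h7 : s.reg 7 = if x.pos then 1 else 0)
    (hR : s.reg 4 = R) (hvs : Stored m₀ 0 (encodeVars vs ++ rest'))
    (hst : Stored m₀ (s.reg 5) (encodeList (encodeList cellsOf) L ++ rest)) :
    Halts copyProg s (copyCost L vs R) (Rep m₀ (g.copy L vs R x)) := by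
  refine (initClausesProg_spec h hst).frame.seq (fun s1 ⟨h1, f1⟩ => ?_)
    (B' := 61 * vs.length + 3 + (13 + (R * (roundCost L + 1 + 1) + 2 + passCost L)))
    (by rw [copyCost]; omega)
  refine (initVarsProg_spec h1 hvs).frame.seq (fun s2 ⟨h2, f2⟩ => ?_) le_rfl
  refine (assumeProg_spec (x := x) h2 (((f2 6 rfl).trans (f1 6 rfl)).trans h6)
    (((f2 7 rfl).trans (f1 7 rfl)).trans h7)).frame.seq (fun s3 ⟨h3, f3⟩ => ?_) le_rfl
  have f : ∀ r, initClausesProg.Avoids r = true → initVarsProg.Avoids r = true →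
      assumeProg.Avoids r = true → s3.reg r = s.reg r := fun r a1 a2 a3 =>
    (f3 r a3).trans ((f2 r a2).trans (f1 r a1))
  refine (roundsProg_spec (L := L) (rest := rest) h3 ((f 4 rfl rfl rfl).trans hR)
    (by rw [f 5 rfl rfl rfl]; exact hst)).frame.seq (fun s4 ⟨h4, f4⟩ => ?_) le_rfl
  have f : ∀ r, initClausesProg.Avoids r = true → initVarsProg.Avoids r = true →
      assumeProg.Avoids r = true → roundsProg.Avoids r = true → s4.reg r = s.reg r :=
    fun r a1 a2 a3 a4 => (f4 r a4).trans (f r a1 a2 a3)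
  exact assertsProg_spec (rest := rest) h4 ((f 6 rfl rfl rfl rfl).trans h6)
    ((f 7 rfl rfl rfl rfl).trans h7) (by rw [f 5 rfl rfl rfl rfl]; exact hst)

end


/-! ### Reading the input -/

/-- Read a number and append it to the stored sequence, whose end is in register `13`. -/
def readTok (r : ℕ) : List Instr := [.read r, .store 13 r, .add 13 13 2]

/-- Read and store the list of variables. -/
def readVarsProg : Prog :=
  .seq (.block (readTok 9)) (.loop 9 (.seq (.block (readTok 17)) (.block (readTok 9))))

/-- Read a literal and append its cells to the stored sequence. Register `3` becomes a strict upper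
bound of its variable. The cell `4 * v + 3` is `2` if the variable `v` has been read before, and
otherwise `0`, so register `4` increases by `2` for every new variable. -/
def readLit : List Instr :=
  [.read 16, .read 17, .add 20 17 17, .add 20 20 20, .add 22 20 1, .add 20 22 16,
    .sub 23 1 16, .add 21 22 23, .store 13 20, .add 13 13 2, .store 13 21, .add 13 13 2,
    .add 24 17 1, .sub 24 24 3, .add 3 3 24,
    .add 22 22 1, .add 22 22 1, .load 23 22, .const 25 2, .sub 24 25 23, .add 4 4 24, .store 22 25]

/-- Read and store a clause. -/
def readClauseBody : Prog :=
  .seq (.block (readTok 15)) (.seq (.loop 15 (.seq (.block readLit) (.block (readTok 15))))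
    (.block (readTok 12)))

/-- Read and store the clauses. -/
def readClausesProg : Prog := .seq (.block (readTok 12)) (.loop 12 readClauseBody)

/-- The state while reading: the sequence `W` has been stored, the variables in `seen` have occurred
in clauses, and `inp` is still to be read. -/
structure Reading (W : List ℕ) (seen : Finset ℕ) (inp : List ℕ) (s : RAMState) : Prop where
  zero : s.reg 0 = 0
  one : s.reg 1 = 1
  four : s.reg 2 = 4
  ptr : s.reg 13 = 4 * W.length
  stored : Stored s.mem 0 W
  cells : ∀ y, s.mem (cell y) = 0
  mark : ∀ v, s.mem (4 * v + 3) = if v ∈ seen then 2 else 0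
  bound : ∀ v ∈ seen, v < s.reg 3
  count : s.reg 4 = 2 * seen.card + 1
  inp : s.inp = inp
  out : s.out = []

theorem Stored.snoc {m : ℕ → ℕ} {W : List ℕ} (h : Stored m 0 W) (a : ℕ) :
    Stored (Function.update m (4 * W.length) a) 0 (W ++ [a]) := by
  rw [stored_append, Nat.zero_add]
  refine ⟨h.congr fun b _ _ hb => Function.update_of_ne (by omega) _ _, ?_⟩
  exact ⟨Nat.dvd_mul_right _ _, Function.update_self .., trivial⟩

namespace Reading

variable {W inp : List ℕ} {seen : Finset ℕ} {s : RAMState}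

theorem tok {a : ℕ} (h : Reading W seen (a :: inp) s) {r : ℕ} (hr : 5 ≤ r) (hr' : r ≠ 13) :
    Reading (W ++ [a]) seen inp (runs (readTok r) s) ∧ (runs (readTok r) s).reg r = a := by
  have hi := h.inp
  have e : ∀ i < 5, (runs (readTok r) s).reg i = s.reg i := fun i hi => by
    have h1 : i ≠ 13 := by omega
    have h2 : i ≠ r := by omega
    simp [readTok, runs, Instr.exec, h1, h2]
  have em : (runs (readTok r) s).mem = Function.update s.mem (4 * W.length) a := by
    simp [readTok, runs, Instr.exec, hr'.symm, h.ptr, hi]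
  refine ⟨
  { zero := by rw [e 0 (by omega), h.zero]
    one := by rw [e 1 (by omega), h.one]
    four := by rw [e 2 (by omega), h.four]
    ptr := ?_
    stored := by rw [em]; exact h.stored.snoc a
    cells := fun y => ?_
    mark := fun v => ?_
    bound := by rw [e 3 (by omega)]; exact h.bound
    count := by rw [e 4 (by omega)]; exact h.count
    inp := by simp [readTok, runs, Instr.exec, hi]
    out := by simp [readTok, runs, Instr.exec, h.out] }, ?_⟩
  · have h2 : 2 ≠ r := by omega
    simp [readTok, runs, Instr.exec, hr'.symm, h2, h.ptr, h.four]
    ring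
  · rw [em, Function.update_of_ne, h.cells]
    exact fun h => not_dvd_cell y (h ▸ Nat.dvd_mul_right _ _)
  · rw [em, Function.update_of_ne (by omega), h.mark]
  · simp [readTok, runs, Instr.exec, hr', hi]

theorem lit {y : Lit} (h : Reading W seen (encodeLit y ++ inp) s) :
    Reading (W ++ cellsOf y) (insert y.var seen) inp (runs readLit s) := by
  obtain ⟨v, b⟩ := y
  have hi := h.inp
  simp only [encodeLit, List.cons_append, List.nil_append] at hi
  have hz := h.zero
  have ho := h.one
  have hf := h.four
  have hp := h.ptr
  have e1 : v + v + (v + v) + 1 + (if b then 1 else 0) = cell ⟨v, b⟩ := by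
    simp only [cell]; omega
  have e2 : v + v + (v + v) + 1 + (1 - if b then 1 else 0) = cell (Lit.compl ⟨v, b⟩) := by
    cases b <;> simp [cell, Lit.compl] <;> omega
  have e3 : v + v + (v + v) + 1 + 1 + 1 = 4 * v + 3 := by omega
  have n1 : 4 * v + 3 ≠ 4 * W.length + 4 := by omega
  have n2 : 4 * v + 3 ≠ 4 * W.length := by omega
  have em : (runs readLit s).mem = Function.update (Function.update (Function.update s.mem
      (4 * W.length) (cell ⟨v, b⟩)) (4 * W.length + 4) (cell (Lit.compl ⟨v, b⟩)))
      (4 * v + 3) 2 := by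
    simp [readLit, runs, Instr.exec, hi, ho, hf, hp, e1, e2, e3]
  have hcell : ∀ z, cell z ≠ 4 * v + 3 := by
    rintro ⟨u, c⟩
    simp only [cell]
    split_ifs <;> omega
  have er3 : (runs readLit s).reg 3 = s.reg 3 + (v + 1 - s.reg 3) := by
    simp [readLit, runs, Instr.exec, hi, ho]
  have er4 : (runs readLit s).reg 4 = s.reg 4 + (2 - s.mem (4 * v + 3)) := by
    simp [readLit, runs, Instr.exec, hi, ho, hf, hp, e3]
    rw [Function.update_of_ne n1, Function.update_of_ne n2]
  exact
  { zero := (runs_reg_of_avoids _ _ rfl).trans hz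
    one := (runs_reg_of_avoids _ _ rfl).trans ho
    four := (runs_reg_of_avoids _ _ rfl).trans hf
    ptr := by
      simp [readLit, runs, Instr.exec, hf, hp, cellsOf]
      ring
    stored := by
      rw [em]
      have h1 := (h.stored.snoc (cell ⟨v, b⟩)).snoc (cell (Lit.compl ⟨v, b⟩))
      rw [List.append_assoc, List.length_append, List.length_singleton, Nat.mul_add] at h1
      exact h1.congr fun a ha _ _ => Function.update_of_ne (by omega) _ _
    cells := fun z => by
      have hd := not_dvd_cell z
      rw [em, Function.update_of_ne (hcell z), Function.update_of_ne (by omega),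
        Function.update_of_ne (by omega), h.cells]
    mark := fun u => by
      by_cases hu : u = v
      · subst hu
        simp [em]
      · rw [em, Function.update_of_ne (by omega), Function.update_of_ne (by omega),
          Function.update_of_ne (by omega), h.mark]
        simp [hu]
    bound := fun u hu => by
      rw [er3]
      rcases Finset.mem_insert.1 hu with hu | hu
      · simp only at hu
        omega
      · have := h.bound u hu
        omega
    count := by
      rw [er4, h.mark, h.count]
      by_cases hv : v ∈ seen
      · simp [hv]
      · simp [hv]
        ring
    inp := by simp [readLit, runs, Instr.exec, hi]
    out := by simp [readLit, runs, Instr.exec, h.out] }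

end Reading

/-- The first token of the list `l` has been read into register `r`. -/
def ReadingList {α : Type} (enc : α → List ℕ) (rest : List ℕ) (r : ℕ) (W : List ℕ)
    (seen : Finset ℕ) (l : List α) (s : RAMState) : Prop :=
  ∃ a tl, encodeList enc l = a :: tl ∧ Reading (W ++ [a]) seen (tl ++ rest) s ∧ s.reg r = a

section ReadingList

variable {α : Type} {enc : α → List ℕ} {rest W : List ℕ} {seen : Finset ℕ} {r : ℕ} {s : RAMState}

theorem readingList_nil : ReadingList enc rest r W seen [] s ↔
    Reading (W ++ [0]) seen rest s ∧ s.reg r = 0 := by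
  simp only [ReadingList, encodeList, List.cons.injEq]
  constructor
  · rintro ⟨a, tl, ⟨rfl, rfl⟩, h⟩
    exact h
  · exact fun h => ⟨0, [], ⟨rfl, rfl⟩, h⟩

theorem readingList_cons {x : α} {l : List α} : ReadingList enc rest r W seen (x :: l) s ↔
    Reading (W ++ [1]) seen (enc x ++ (encodeList enc l ++ rest)) s ∧ s.reg r = 1 := by
  simp only [ReadingList, encodeList, List.cons.injEq]
  constructor
  · rintro ⟨a, tl, ⟨rfl, rfl⟩, h⟩
    rwa [List.append_assoc] at h
  · intro h
    rw [← List.append_assoc] at h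
    exact ⟨1, _, ⟨rfl, rfl⟩, h⟩

theorem Reading.list {l : List α} (h : Reading W seen (encodeList enc l ++ rest) s) (hr : 5 ≤ r)
    (hr' : r ≠ 13) : ReadingList enc rest r W seen l (runs (readTok r) s) := by
  cases l with
  | nil => exact readingList_nil.2 (h.tok hr hr')
  | cons x l =>
    rw [encodeList, List.cons_append, List.append_assoc] at h
    exact readingList_cons.2 (h.tok hr hr')

end ReadingList

section

variable {W rest : List ℕ} {seen : Finset ℕ} {s : RAMState}

theorem readVarsProg_spec {vs : List ℕ} (h : Reading W seen (encodeVars vs ++ rest) s) :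
    Halts readVarsProg s (7 * vs.length + 4) (Reading (W ++ encodeVars vs) seen rest) := by
  refine Halts.block_seq _ (Halts.loop (fun (l : List ℕ) s' => ∃ W',
    ReadingList (fun v => [v]) rest 9 W' seen l s' ∧
      W' ++ encodeVars l = W ++ encodeVars vs) (fun _ => 6) ?_ ?_ vs ?_ |>.mono le_rfl ?_) ?_
  · rintro v l s' ⟨W', hr, hW⟩
    obtain ⟨hr, h9⟩ := readingList_cons.1 hr
    refine ⟨by rw [h9]; exact one_ne_zero, ?_⟩
    have h1 := hr.tok (r := 17) (by decide) (by decide)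
    refine Halts.block_seq _ (Halts.block _ ⟨_, Reading.list h1.1 (by decide) (by decide), ?_⟩) le_rfl
    rw [← hW]
    simp [encodeVars, encodeList]
  · rintro s' ⟨W', hr, hW⟩
    exact (readingList_nil.1 hr).2
  · exact ⟨W, Reading.list h (by decide) (by decide), rfl⟩
  · rintro s' ⟨W', hr, hW⟩
    rw [← hW]
    exact (readingList_nil.1 hr).1
  · simp [readTok]
    omega

theorem readClauseBody_spec {c : List Lit} {l : List (List Lit)}
    (h : ReadingList (encodeList encodeLit) rest 12 W seen (c :: l) s) :
    Halts readClauseBody s (26 * c.length + 7)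
      (ReadingList (encodeList encodeLit) rest 12 (W ++ 1 :: encodeList cellsOf c)
        ((c.toFinset.image Lit.var) ∪ seen) l) := by
  have h := (readingList_cons.1 h).1
  refine Halts.block_seq _ (Halts.seq (Halts.loop (fun (k : List Lit) s' => ∃ W' seen',
    ReadingList encodeLit (encodeList (encodeList encodeLit) l ++ rest) 15 W' seen' k s' ∧
      W' ++ encodeList cellsOf k = W ++ 1 :: encodeList cellsOf c ∧
      (k.toFinset.image Lit.var) ∪ seen' = (c.toFinset.image Lit.var) ∪ seen)
    (fun _ => 25) ?_ ?_ c ?_) (B' := 3) ?_ le_rfl) ?_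
  · rintro y k s' ⟨W', seen', hr, hW, hs⟩
    obtain ⟨hr, h15⟩ := readingList_cons.1 hr
    refine ⟨by rw [h15]; exact one_ne_zero, ?_⟩
    refine Halts.block_seq _ (Halts.block _ ⟨_, _, Reading.list hr.lit (by decide) (by decide),
      ?_, ?_⟩) le_rfl
    · rw [← hW]
      simp [encodeList]
    · rw [← hs]
      ext u
      simp only [List.toFinset_cons, Finset.image_insert, Finset.mem_union, Finset.mem_insert]
      tauto
  · rintro s' ⟨W', seen', hr, -⟩
    exact (readingList_nil.1 hr).2
  · exact ⟨_, seen, Reading.list h (by decide) (by decide), by simp, rfl⟩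
  · rintro s' ⟨W', seen', hr, hW, hs⟩
    rw [← hW, ← hs]
    refine Halts.block _ ?_
    simpa [encodeList] using Reading.list (readingList_nil.1 hr).1 (by decide) (by decide)
  · simp [readTok]
    omega

/-- A bound for the number of steps for reading the clauses. -/
def readCost (L : List (List Lit)) : ℕ := (L.map fun c => 26 * c.length + 7 + 1).sum + 4

theorem readClausesProg_spec {L : List (List Lit)} (h : Reading W seen (encodeClauses L) s) :
    Halts readClausesProg s (readCost L) (Reading (W ++ encodeList (encodeList cellsOf) L)
      (vars (toClauseSet L) ∪ seen) []) := by
  rw [encodeClauses, ← List.append_nil (encodeList _ L)] at h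
  refine Halts.block_seq _ (Halts.loop (fun (l : List (List Lit)) s' => ∃ W' seen',
    ReadingList (encodeList encodeLit) [] 12 W' seen' l s' ∧
      W' ++ encodeList (encodeList cellsOf) l = W ++ encodeList (encodeList cellsOf) L ∧
      vars (toClauseSet l) ∪ seen' = vars (toClauseSet L) ∪ seen)
    (fun c => 26 * c.length + 7) ?_ ?_ L ?_ |>.mono le_rfl ?_) ?_
  · rintro c l s' ⟨W', seen', hr, hW, hs⟩
    refine ⟨by rw [(readingList_cons.1 hr).2]; exact one_ne_zero, ?_⟩
    refine (readClauseBody_spec hr).mono le_rfl fun s2 h2 => ⟨_, _, h2, ?_, ?_⟩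
    · rw [← hW]
      simp [encodeList]
    · rw [← hs]
      ext u
      simp only [Finset.mem_union, mem_vars_toClauseSet, List.mem_cons, exists_eq_or_imp,
        Finset.mem_image, List.mem_toFinset]
      rw [or_left_comm, or_assoc]
  · rintro s' ⟨W', seen', hr, -⟩
    exact (readingList_nil.1 hr).2
  · exact ⟨_, seen, Reading.list h (by decide) (by decide), rfl, rfl⟩
  · rintro s' ⟨W', seen', hr, hW, hs⟩
    rw [← hW, ← hs]
    simpa [encodeList, toClauseSet, vars] using (readingList_nil.1 hr).1
  · simp [readTok, readCost]
    omega

/-! ### The complete program -/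

/-- The program for `Gen.varStep`. -/
def varBody : Prog :=
  .seq (.block [.add 10 10 2, .load 6 10, .const 7 1]) (.seq copyProg (.seq (.block [.const 7 0])
    (.seq copyProg (.block [.add 10 10 2, .load 9 10]))))

/-- The program that is run after reading the input. -/
def genProg : Prog :=
  .seq (.block [.copy 6 3, .const 7 1]) (.seq (.block (constInstrs false)) (.seq copyProg
    (.seq (.block [.copy 10 0, .load 9 10]) (.seq (.loop 9 varBody) (.block [.write 0])))))

/-- The complete program. Register `5` becomes the address of the clauses. -/
def mainProg : Prog :=
  .seq (.block [.const 1 1, .const 2 4, .const 4 1]) (.seq readVarsProg (.seq (.block [.copy 5 13])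
    (.seq readClausesProg genProg)))

theorem varBody_spec {m₀ : ℕ → ℕ} {g : Gen} {L : List (List Lit)} {vs l : List ℕ} {v R : ℕ}
    {rest' rest'' : List ℕ} (h : Rep m₀ g s)
    (hR : s.reg 4 = R) (hvs : Stored m₀ 0 (encodeVars vs ++ rest'))
    (hst : Stored m₀ (s.reg 5) (encodeList (encodeList cellsOf) L ++ rest))
    (hc : Cursor (fun v => [v]) m₀ rest'' 9 10 (v :: l) s) :
    Halts varBody s (2 * copyCost L vs R + 6) fun s' => Rep m₀ (g.varStep L vs R v) s' ∧
      Cursor (fun v => [v]) m₀ rest'' 9 10 l s' := by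
  obtain ⟨hp, -, hst'⟩ := stored_cons.1 hc.stored
  obtain ⟨hp1, hz, hst'⟩ := hst'
  have hz : s.mem (s.reg 10 + 4) = v := (h.mem _ hp1).trans hz
  refine Halts.block_seq _ (B := 2 * copyCost L vs R + 3) ?_ (by
    simp only [List.length_cons, List.length_nil]; omega)
  have h1 := h.scratch [.add 10 10 2, .load 6 10, .const 7 1] rfl
  have e4 := runs_reg_of_avoids (r := 4) [.add 10 10 2, .load 6 10, .const 7 1] s rfl
  have e5 := runs_reg_of_avoids (r := 5) [.add 10 10 2, .load 6 10, .const 7 1] s rfl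
  have e6 : (runs [.add 10 10 2, .load 6 10, .const 7 1] s).reg 6 = v := by
    simp [runs, Instr.exec, h.four, hz]
  have e7 : (runs [.add 10 10 2, .load 6 10, .const 7 1] s).reg 7 = 1 := by
    simp [runs, Instr.exec]
  have e10 : (runs [.add 10 10 2, .load 6 10, .const 7 1] s).reg 10 = s.reg 10 + 4 := by
    simp [runs, Instr.exec, h.four]
  generalize runs [.add 10 10 2, .load 6 10, .const 7 1] s = s1 at *
  refine (copyProg_spec (L := L) (rest := rest) (x := ⟨v, true⟩) h1 e6 e7 (e4.trans hR) hvs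
    (by rw [e5]; exact hst)).frame.seq (B' := copyCost L vs R + 3) (fun s2 ⟨h2, f2⟩ => ?_)
    (by omega)
  refine Halts.block_seq _ (B := copyCost L vs R + 2) ?_ (by
    simp only [List.length_cons, List.length_nil]; omega)
  have f : ∀ r, copyProg.Avoids r = true → r ≠ 7 → (runs [.const 7 0] s2).reg r = s1.reg r :=
    fun r hr hr7 => (runs_reg_of_avoids _ _ (by simp [Instr.Avoids, hr7.symm])).trans (f2 r hr)
  have h3 := h2.scratch [.const 7 0] rfl
  have e7 : (runs [.const 7 0] s2).reg 7 = 0 := by simp [runs, Instr.exec]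
  generalize runs [.const 7 0] s2 = s3 at *
  refine (copyProg_spec (L := L) (rest := rest) (x := ⟨v, false⟩) h3 ((f 6 rfl (by decide)).trans e6) e7
    (((f 4 rfl (by decide)).trans e4).trans hR) hvs
    (by rw [f 5 rfl (by decide), e5]; exact hst)).frame.seq (B' := 2) (fun s4 ⟨h4, f4⟩ => ?_) le_rfl
  have e10 : s4.reg 10 = s.reg 10 + 4 := (f4 10 rfl).trans ((f 10 rfl (by decide)).trans e10)
  have e : (runs [.add 10 10 2, .load 9 10] s4).reg 10 = s.reg 10 + 4 + 4 := by
    simp [runs, Instr.exec, h4.four, e10]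
  refine Halts.block _ ⟨h4.scratch _ rfl, ?_, ?_⟩
  · rw [e]; exact hst'
  · rw [e, ← h4.mem _ hst'.dvd]
    simp [runs, Instr.exec, h4.four, e10]

theorem genProg_spec {L : List (List Lit)} {vs : List ℕ} {seen : Finset ℕ}
    (h : Reading (encodeVars vs ++ encodeList (encodeList cellsOf) L) seen [] s)
    (h5 : s.reg 5 = 4 * (encodeVars vs).length) :
    Halts genProg s (vs.length * (2 * copyCost L vs (s.reg 4) + 7) + copyCost L vs (s.reg 4) + 12)
      fun s' => s'.out = encodeClauses (Gen.final L vs (s.reg 4) (s.reg 3)).out := by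
  have hvs := h.stored
  have hst := (stored_append.1 hvs).2
  rw [Nat.zero_add, ← h5] at hst
  rw [← List.append_nil (encodeList _ L)] at hst
  have h0 : Rep s.mem ⟨s.reg 3, fun _ => 0, []⟩ s :=
    { zero := h.zero
      one := h.one
      four := h.four
      next := rfl
      cur := h.cells
      mem := fun _ _ => rfl
      out := h.out }
  generalize s.mem = m₀ at *
  generalize hR : s.reg 4 = R at *
  generalize hM : s.reg 3 = M at *
  refine Halts.block_seq _ (B := vs.length * (2 * copyCost L vs R + 7) + copyCost L vs R + 10) ?_ (by
    simp only [List.length_cons, List.length_nil]; omega)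
  have h1 := h0.scratch [.copy 6 3, .const 7 1] rfl
  have e4 := (runs_reg_of_avoids [.copy 6 3, .const 7 1] s rfl).trans hR
  have e5 := runs_reg_of_avoids (r := 5) [.copy 6 3, .const 7 1] s rfl
  have e6 : (runs [.copy 6 3, .const 7 1] s).reg 6 = M := by simp [runs, Instr.exec, hM]
  have e7 : (runs [.copy 6 3, .const 7 1] s).reg 7 = 1 := by simp [runs, Instr.exec]
  generalize runs [.copy 6 3, .const 7 1] s = s1 at *
  refine Halts.block_seq _ (B := vs.length * (2 * copyCost L vs R + 7) + copyCost L vs R + 4) ?_ (by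
    rw [show (constInstrs false).length = 6 from rfl]; omega)
  have h2 : Rep m₀ (Gen.start M) _ := h1.const false
  have e4 := (runs_reg_of_avoids (constInstrs false) s1 rfl).trans e4
  have e5 := (runs_reg_of_avoids (constInstrs false) s1 rfl).trans e5
  have e6 := (runs_reg_of_avoids (constInstrs false) s1 rfl).trans e6
  have e7 := (runs_reg_of_avoids (constInstrs false) s1 rfl).trans e7
  generalize runs (constInstrs false) s1 = s2 at *
  refine (copyProg_spec (L := L) (rest := []) (x := ⟨M, true⟩) h2 e6 e7 e4 hvs
    (by rw [e5]; exact hst)).frame.seq (B' := vs.length * (2 * copyCost L vs R + 7) + 4)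
    (fun s3 ⟨h3, f3⟩ => ?_) (by omega)
  refine Halts.block_seq _ (B := vs.length * (2 * copyCost L vs R + 7) + 2) ?_ (by
    simp only [List.length_cons, List.length_nil]; omega)
  refine (Halts.loop (fun (l : List ℕ) s' => ∃ g', Rep m₀ g' s' ∧
    l.foldl (Gen.varStep L vs R) g' = Gen.final L vs R M ∧ s'.reg 4 = R ∧ s'.reg 5 = s.reg 5 ∧
    Cursor (fun v => [v]) m₀ (encodeList (encodeList cellsOf) L) 9 10 l s')
    (fun _ => 2 * copyCost L vs R + 6) ?_ ?_ vs ?_).seq (B' := 1) ?_ ?_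
  · rintro v l s' ⟨g', hr, hg, e4, e5, hcur⟩
    refine ⟨by rw [hcur.flag, hcur.stored.2.1]; exact one_ne_zero, ?_⟩
    exact (varBody_spec hr e4 hvs (by rw [e5]; exact hst) hcur).frame.mono le_rfl
      fun s2 ⟨hs2, f2⟩ => ⟨_, hs2.1, hg, (f2 4 rfl).trans e4, (f2 5 rfl).trans e5, hs2.2⟩
  · rintro s' ⟨g', hr, hg, -, -, hcur⟩
    exact hcur.exit.1
  · refine ⟨_, h3.scratch _ rfl, rfl, (runs_reg_of_avoids _ _ rfl).trans ((f3 4 rfl).trans e4),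
      (runs_reg_of_avoids _ _ rfl).trans ((f3 5 rfl).trans e5), ?_, ?_⟩
    · simpa [runs, Instr.exec, h3.zero, encodeVars] using hvs
    · have : 4 ∣ 0 := by decide
      simpa [runs, Instr.exec, h3.zero] using h3.mem _ this
  · rintro s' ⟨g', hr, hg, -⟩
    simp only [List.foldl_nil] at hg
    refine Halts.block _ ?_
    simp [runs, Instr.exec, hr.zero, hr.out, hg, encodeClauses_eq]
  · have e : 2 * copyCost L vs R + 6 + 1 = 2 * copyCost L vs R + 7 := rfl
    simp only [List.map_const', List.sum_replicate, smul_eq_mul, e]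
    omega

end

/-- A bound for the number of steps of the complete program. -/
def mainCost (L : List (List Lit)) (vs : List ℕ) (R : ℕ) : ℕ :=
  7 * vs.length + readCost L + vs.length * (2 * copyCost L vs R + 7) + copyCost L vs R + 20

theorem mainProg_computes (L : List (List Lit)) (vs : List ℕ) :
    ∃ t M, (∀ v ∈ vars (toClauseSet L), v < M) ∧
      t ≤ mainCost L vs (2 * numVars (toClauseSet L) + 1) ∧
      mainProg.Computes (encodeVars vs ++ encodeClauses L) t
        (encodeClauses (Gen.final L vs (2 * numVars (toClauseSet L) + 1) M).out) := by
  have key : Halts mainProg ⟨fun _ => 0, fun _ => 0, encodeVars vs ++ encodeClauses L, []⟩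
      (mainCost L vs (2 * numVars (toClauseSet L) + 1)) fun s' =>
        ∃ M, (∀ v ∈ vars (toClauseSet L), v < M) ∧
        s'.out = encodeClauses (Gen.final L vs (2 * numVars (toClauseSet L) + 1) M).out := by
    generalize hs : (⟨fun _ => 0, fun _ => 0, encodeVars vs ++ encodeClauses L, []⟩ : RAMState) = s
    refine Halts.block_seq _ (B := mainCost L vs (2 * numVars (toClauseSet L) + 1) - 3) ?_ (by
      rw [mainCost]; simp only [List.length_cons, List.length_nil]; omega)
    have h0 : Reading [] ∅ (encodeVars vs ++ encodeClauses L)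
        (runs [.const 1 1, .const 2 4, .const 4 1] s) := by
      subst hs
      constructor <;> simp [runs, Instr.exec, Stored]
    generalize runs [.const 1 1, .const 2 4, .const 4 1] s = s1 at *
    refine (readVarsProg_spec h0).seq (B' := mainCost L vs (2 * numVars (toClauseSet L) + 1) - 3 -
      (7 * vs.length + 4)) (fun s2 h2 => ?_) (by rw [mainCost]; omega)
    rw [List.nil_append] at h2
    have h3 : Reading (encodeVars vs) ∅ (encodeClauses L) (runs [.copy 5 13] s2) := by
      obtain ⟨a1, a2, a3, a4, a5, a6, a7, a8, a9, a10, a11⟩ := h2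
      constructor <;> simp_all [runs, Instr.exec]
    have e5 : (runs [.copy 5 13] s2).reg 5 = 4 * (encodeVars vs).length := by
      simp [runs, Instr.exec, h2.ptr]
    refine Halts.block_seq _ (B := mainCost L vs (2 * numVars (toClauseSet L) + 1) - 3 -
      (7 * vs.length + 4) - 1) ?_ (by
        rw [mainCost]; simp only [List.length_cons, List.length_nil]; omega)
    generalize runs [.copy 5 13] s2 = s3 at *
    refine (readClausesProg_spec h3).frame.seq (B' := vs.length * (2 * copyCost L vs
      (2 * numVars (toClauseSet L) + 1) + 7) + copyCost L vs (2 * numVars (toClauseSet L) + 1) + 12)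
      (fun s4 ⟨h4, f4⟩ => ?_) (by rw [mainCost]; omega)
    have hb := h4.bound
    have hc := h4.count
    rw [Finset.union_empty] at hb hc
    have := genProg_spec h4 ((f4 5 rfl).trans e5)
    rw [hc] at this
    exact this.mono le_rfl fun s5 h5 => ⟨_, hb, h5⟩
  obtain ⟨t, s', ht, he, M, hM, ho⟩ := key
  exact ⟨t, M, hM, ht, s', he, ho⟩

/-! ### The running time -/

/-- At most one clause is empty, hence the bound for the number of clauses. -/
theorem length_le_of_listsClauses {L : List (List Lit)} {F : ClauseSet} (h : ListsClauses L F) :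
    (L.map List.length).sum = numOcc F ∧ L.length ≤ numOcc F + 1 := by
  obtain ⟨h1, h2, h3⟩ := h
  have hsum : ∀ w : Finset Lit → ℕ, ∑ C ∈ F, w C = ((L.map List.toFinset).map w).sum := fun w => by
    rw [← h3, List.sum_toFinset _ h2]
  have e1 : (L.map List.length).sum = numOcc F := by
    rw [numOcc, hsum, List.map_map]
    congr 1
    exact List.map_congr_left fun c hc => (List.toFinset_card_of_nodup (h1 c hc)).symm
  refine ⟨e1, ?_⟩
  have e2 : L.length = F.card := by
    rw [← h3, List.toFinset_card_of_nodup h2, List.length_map]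
  have e3 : (F.erase ∅).card ≤ numOcc F := by
    rw [numOcc, Finset.card_eq_sum_ones]
    refine (Finset.sum_le_sum fun C hC => ?_).trans
      (Finset.sum_le_sum_of_subset (Finset.erase_subset ∅ F))
    exact Finset.card_pos.2 (Finset.nonempty_iff_ne_empty.2 (Finset.ne_of_mem_erase hC))
  have := Finset.pred_card_le_card_erase (s := F) (a := ∅)
  omega

theorem numVars_le_numOcc (F : ClauseSet) : numVars F ≤ numOcc F :=
  Finset.card_biUnion_le.trans (Finset.sum_le_sum fun _ _ => Finset.card_image_le)

theorem sum_map_affine (L : List (List Lit)) (a b : ℕ) :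
    (L.map fun c => a * c.length + b).sum = a * (L.map List.length).sum + b * L.length := by
  induction L with
  | nil => simp
  | cons c L ih => simp only [List.map_cons, List.sum_cons, ih, List.length_cons]; ring

theorem mainCost_le {L : List (List Lit)} {vs : List ℕ} {a n p o : ℕ} (ha : 1 ≤ a) (hn : 1 ≤ n)
    (hp : 1 ≤ p) (ho : 1 ≤ o) (hvs : vs.length ≤ a) (hvo : vs.length ≤ o)
    (hL : ∀ c ∈ L, c.length ≤ p) (hsum : (L.map List.length).sum ≤ o) (hlen : L.length ≤ 2 * o)
    {R : ℕ} (hR : R ≤ 3 * n) : mainCost L vs R ≤ 10000 * (a * p * n * o) := by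
  -- A clause `c` costs at most `60 |c| (|c| + 1) + 51 |c| + 8`, where `|c| + 1 ≤ 2 p`.
  have hround : roundCost L ≤ 200 * (p * o) := by
    have h1 : roundCost L ≤ (L.map fun c => (171 * p) * c.length + 8).sum + 3 := by
      refine Nat.add_le_add_right (List.sum_le_sum fun c hc => ?_) 3
      have := hL c hc
      nlinarith
    rw [sum_map_affine] at h1
    nlinarith
  have hpass : passCost L ≤ 250 * o := by
    have : passCost L = (L.map fun c => 60 * c.length + 91).sum + 3 := by
      rw [passCost]; congr 3
    rw [this, sum_map_affine]
    omega
  have hread : readCost L ≤ 50 * o := by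
    have : readCost L = (L.map fun c => 26 * c.length + 8).sum + 4 := rfl
    rw [this, sum_map_affine]
    omega
  have hpo : o ≤ p * o := Nat.le_mul_of_pos_left _ hp
  have hX : p * o ≤ p * n * o := by
    rw [mul_right_comm]; exact Nat.le_mul_of_pos_right _ hn
  have hcopy : copyCost L vs R ≤ 1300 * (p * n * o) := by
    have h1 : R * (roundCost L + 1 + 1) ≤ 3 * n * (202 * (p * o)) :=
      Nat.mul_le_mul hR (by omega)
    have h2 : 3 * n * (202 * (p * o)) = 606 * (p * n * o) := by ring
    rw [copyCost]
    omega
  have h1 : vs.length * (2 * copyCost L vs R + 7) ≤ a * (2607 * (p * n * o)) :=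
    Nat.mul_le_mul hvs (by omega)
  have h2 : p * n * o ≤ a * (p * n * o) := Nat.le_mul_of_pos_left _ ha
  have h3 : a * p * n * o = a * (p * n * o) := by ring
  have h4 : a * (2607 * (p * n * o)) = 2607 * (a * (p * n * o)) := by ring
  rw [mainCost, h3]
  omega

end ForcingRep


theorem mainTheorem5 :
    ∃ (P : ForcingRep.Prog) (c : ℕ),
      ∀ (p : ℕ) (f : ForcingRep.BoolFun) (F : ForcingRep.ClauseSet),
        F ∈ ForcingRep.PCLS p → ForcingRep.IsURRep F f →
        ∀ (vs : List ℕ) (L : List (List ForcingRep.Lit)),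
          ForcingRep.ListsVars vs f.vars → ForcingRep.ListsClauses L F →
          ∃ (G : ForcingRep.ClauseSet) (M : List (List ForcingRep.Lit)) (t : ℕ),
            P.Computes (ForcingRep.encodeVars vs ++ ForcingRep.encodeClauses L) t
              (ForcingRep.encodeClauses M) ∧
            ForcingRep.ListsClauses M G ∧
            ForcingRep.IsForcingRep G f ∧
            t ≤ c * (max 1 f.numVars * max 1 p * max 1 (ForcingRep.numVars F) *
              max 1 (ForcingRep.numOcc F)) := by
  refine ⟨ForcingRep.mainProg, 10000, fun p f F hF hrep vs L hvs hL => ?_⟩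
  obtain rfl : ForcingRep.toClauseSet L = F := hL.2.2
  obtain ⟨t, M, hM, ht, hcomp⟩ := ForcingRep.mainProg_computes L vs
  obtain ⟨x, hInv⟩ := ForcingRep.Inv.final L (V := f.vars)
    (fun v hv => hM v (hrep.1.2.1 hv)) (vs := vs)
    (fun v hv => hvs.2 ▸ List.mem_toFinset.2 hv)
    (2 * ForcingRep.numVars (ForcingRep.toClauseSet L) + 1)
  refine ⟨_, _, t, hcomp, ⟨fun c hc => (hInv.nodup_var c hc).of_map _, hInv.nodup, rfl⟩,
    ForcingRep.isForcingRep_final hrep hvs.2 hM (Nat.lt_succ_self _), ht.trans ?_⟩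
  obtain ⟨hsum, hlen⟩ := ForcingRep.length_le_of_listsClauses hL
  have hcard : vs.length = f.numVars := by
    rw [ForcingRep.BoolFun.numVars, ← hvs.2, List.toFinset_card_of_nodup hvs.1]
  have hfF : f.numVars ≤ ForcingRep.numVars (ForcingRep.toClauseSet L) :=
    Finset.card_le_card hrep.1.2.1
  have hFo := ForcingRep.numVars_le_numOcc (ForcingRep.toClauseSet L)
  refine ForcingRep.mainCost_le (le_max_left _ _) (le_max_left _ _) (le_max_left _ _)
    (le_max_left _ _) (by omega) (by omega) (fun c hc => ?_) (by omega) (by omega) (by omega)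
  have := hF.2 _ (ForcingRep.mem_toClauseSet.2 ⟨c, hc, rfl⟩)
  rw [List.toFinset_card_of_nodup (hL.1 c hc)] at this
  omega
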